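/- Manifolds are smooth, finite-dimensional and without boundary, and they are Hausdorff and second countable, except that the arrow manifold of $\mathcal G$ below need not be Hausdorff. Let $\mathcal H\rightrightarrows N$ and $\mathcal G\rightrightarrows M$ be Lie groupoids with structure maps $s,t,u,i,m$, let $I\subseteq\mathbb R$ be an open interval containing $0$, and let $k\ge 0$. A $k$-deformation of a Lie groupoid morphism $(\Phi_0,\phi_0):\mathcal H\to\mathcal G$ is a pair of smooth maps $\Phi:\mathcal H\times I^k\to\mathcal G$, $\phi:N\times I^k\to M$ such that $(\Phi_\varepsilon,\phi_\varepsilon)=(\Phi(\cdot,\varepsilon),\phi(\cdot,\varepsilon))$ is a Lie groupoid morphism for every $\varepsilon=(\varepsilon_1,\dots,\varepsilon_k)\in I^k$ and equals $(\Phi_0,\phi_0)$ for $\varepsilon=0$. "For small $\varepsilon$" means: for all $\varepsilon\in J^k$, for some open interval $J\subseteq I$ containing $0$; the families involved are smooth in all their variables, including $\varepsilon\in J^k$. A bisection of $\mathcal G$ is a smooth $\sigma:M\to\mathcal G$ with $s\circ\sigma=\mathrm{id}_M$ and $t\circ\sigma$ a diffeomorphism, and $I_\sigma(g)=\sigma(t(g))\,g\,\sigma(s(g))^{-1}$.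 Let $A_{\mathcal G}=\ker(ds)|_M$. For a morphism $\Psi:\mathcal H\to\mathcal G$ with base map $\psi$ and a section $\beta$ of $\psi^*A_{\mathcal G}$ put $\delta_\Psi(\beta)(h)=r_{\Psi(h)}(\beta_{t(h)})+l_{\Psi(h)}(di(\beta_{s(h)}))$, where $r_g,l_g$ are the differentials of right and left translation by $g$. A vector field on $\mathcal H$ is multiplicative if it is a groupoid morphism $\mathcal H\to T\mathcal H$ over some vector field on $N$. **Theorem.** Let $\Phi$ be a $k$-deformation of $\Phi_0:\mathcal H\to\mathcal G$ and assume that $\mathcal H$ is compact (and Hausdorff). The following are equivalent. 1. $\Phi$ is strongly trivial up to automorphisms of $\mathcal H$: there are smooth families $F_\varepsilon$ of automorphisms of $\mathcal H$ and $\sigma_\varepsilon$ of bisections of $\mathcal G$ with $F_0=\mathrm{id}_{\mathcal H}$, $\sigma_0=u$ and $\Phi_\varepsilon\circ F_\varepsilon=I_{\sigma_\varepsilon}\circ\Phi_0$ for small $\varepsilon$. 2. The canonical 1-deformations in $\Phi$ are strongly trivial up to automorphisms of $\mathcal H$, smoothly in the remaining parameters: for each $i=1,\dots,k$ there are smooth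 families $F^i_\varepsilon$ of automorphisms of $\mathcal H$ and $\sigma^i_\varepsilon$ of bisections of $\mathcal G$, equal to $\mathrm{id}_{\mathcal H}$ and $u$ whenever $\varepsilon_i=0$, such that $\Phi_\varepsilon\circ F^i_\varepsilon=I_{\sigma^i_\varepsilon}\circ\Phi_{\varepsilon_1,\dots,\varepsilon_{i-1},0,\varepsilon_{i+1},\dots,\varepsilon_k}$ for small $\varepsilon$. 3. There are smooth families $Y^1,\dots,Y^k$ of multiplicative vector fields on $\mathcal H$ and $\alpha^1,\dots,\alpha^k$ of sections of $A_{\mathcal G}$ such that, for small $\varepsilon$ and $i=1,\dots,k$, $$\frac{\partial\Phi_\varepsilon}{\partial\varepsilon_i}=(\Phi_\varepsilon)_*Y^i_\varepsilon+\delta_{\Phi_\varepsilon}(\phi_\varepsilon^*\alpha^i_\varepsilon).$$ **Pair groupoids and the Thom–Levine theorem.** Let $N$ and $M$ be manifolds with $N$ compact. Every $k$-deformation $(\Phi,\phi)$ of a morphism between the pair groupoids $N\times N\rightrightarrows N$ and $M\times M\rightrightarrows M$ has the form $\Phi_\varepsilon=\phi_\varepsilon\times\phi_\varepsilon$. Conversely,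 let $f:N\times I^k\to M$ be a $k$-deformation of a map $f_0:N\to M$, i.e. a smooth map with $f(\cdot,0)=f_0$. Then $f_\varepsilon\times f_\varepsilon$ is a $k$-deformation of $f_0\times f_0$ between the pair groupoids. Call $f$ trivial if there are smooth families of maps $F_\varepsilon:N\to N$ and $K_\varepsilon:M\to M$ with $F_0=\mathrm{id}_N$, $K_0=\mathrm{id}_M$ and $f_\varepsilon\circ F_\varepsilon=K_\varepsilon\circ f_0$ for small $\varepsilon$; and say that $f$ satisfies the Thom–Levine equations if there are smooth families of vector fields $\zeta^i_\varepsilon\in\mathfrak X(N)$ and $\eta^i_\varepsilon\in\mathfrak X(M)$, $i=1,\dots,k$, with $$\frac{\partial f_\varepsilon}{\partial\varepsilon_i}=df_\varepsilon(\zeta^i_\varepsilon)+\eta^i_\varepsilon\circ f_\varepsilon\qquad\text{for small }\varepsilon .$$ Then $f$ is trivial if and only if $f_\varepsilon\times f_\varepsilon$ satisfies 1; $f$ satisfies the Thom–Levine equations if and only if $f_\varepsilon\times f_\varepsilon$ satisfies 3; and $f$ is trivial if and only if it satisfies the Thom–Levine equations. -/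

import Mathlib

open Set
open scoped Manifold ContDiff Topology

noncomputable section

/-! ## Lie groupoids -/

section LieGroupoids

variable {EG HG EM HM : Type*}
  [NormedAddCommGroup EG] [NormedSpace ℝ EG] [TopologicalSpace HG]
  [NormedAddCommGroup EM] [NormedSpace ℝ EM] [TopologicalSpace HM]

/-- A Lie groupoid `G ⇉ M`.  An arrow `g` goes from `s g` to `t g`, and `mul g h = g h` is only
meaningful when `s g = t h`: no condition is imposed on its values at other pairs.  Smoothness of
the multiplication is smoothness on the set of composable pairs, which is an embedded submanifold
of `G × G` because `s` and `t` are submersions.  The arrow space need not be Hausdorff. -/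
structure LieGroupoid (IG : ModelWithCorners ℝ EG HG) (G : Type*) [TopologicalSpace G]
    [ChartedSpace HG G] (IM : ModelWithCorners ℝ EM HM) (M : Type*) [TopologicalSpace M]
    [ChartedSpace HM M] where
  s : G → M
  t : G → M
  u : M → G
  inv : G → G
  mul : G → G → G
  s_mul : ∀ g h, s g = t h → s (mul g h) = s h
  t_mul : ∀ g h, s g = t h → t (mul g h) = t g
  mul_assoc : ∀ g h l, s g = t h → s h = t l → mul (mul g h) l = mul g (mul h l)
  s_u : ∀ x, s (u x) = x
  t_u : ∀ x, t (u x) = x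
  u_mul : ∀ g, mul (u (t g)) g = g
  mul_u : ∀ g, mul g (u (s g)) = g
  s_inv : ∀ g, s (inv g) = t g
  t_inv : ∀ g, t (inv g) = s g
  inv_mul : ∀ g, mul (inv g) g = u (s g)
  mul_inv : ∀ g, mul g (inv g) = u (t g)
  contMDiff_s : ContMDiff IG IM ∞ s
  contMDiff_t : ContMDiff IG IM ∞ t
  contMDiff_u : ContMDiff IM IG ∞ u
  contMDiff_inv : ContMDiff IG IG ∞ inv
  contMDiffOn_mul : ContMDiffOn (IG.prod IG) IG ∞ (fun p : G × G => mul p.1 p.2)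
    {p : G × G | s p.1 = t p.2}
  submersion_s : ∀ g, Function.Surjective (mfderiv IG IM s g)
  submersion_t : ∀ g, Function.Surjective (mfderiv IG IM t g)

namespace LieGroupoid

variable {IG : ModelWithCorners ℝ EG HG} {G : Type*} [TopologicalSpace G] [ChartedSpace HG G]
  {IM : ModelWithCorners ℝ EM HM} {M : Type*} [TopologicalSpace M] [ChartedSpace HM M]

/-- The differential `dm (v, w) ∈ T_{gh} G` of the multiplication at a composable pair `(g, h)`,
where `(v, w)` is tangent to the manifold of composable pairs, that is `ds v = dt w`.  On such
vectors the derivative within the set of composable pairs is uniquely determined. -/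
def tangentMul (𝓖 : LieGroupoid IG G IM M) (g h : G) (v : TangentSpace IG g)
    (w : TangentSpace IG h) : TangentSpace IG (𝓖.mul g h) :=
  mfderivWithin (IG.prod IG) IG (fun p : G × G => 𝓖.mul p.1 p.2)
    {p : G × G | 𝓖.s p.1 = 𝓖.t p.2} (g, h) ((v, w) : EG × EG)

/-- Right translation `r_g : T_{1_y}(s⁻¹ y) → T_g G`, `y = t g`, given by `r_g v = dm (v, 0_g)`.
(Tangent spaces at the equal points `1_{t g} g` and `g` are the same space.) -/
def rightTranslate (𝓖 : LieGroupoid IG G IM M) (g : G) (y : M)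
    (v : TangentSpace IG (𝓖.u y)) : TangentSpace IG g :=
  (𝓖.tangentMul (𝓖.u y) g v (0 : EG) : EG)

/-- Left translation `l_g : T_{1_x}(t⁻¹ x) → T_g G`, `x = s g`, given by `l_g w = dm (0_g, w)`. -/
def leftTranslate (𝓖 : LieGroupoid IG G IM M) (g : G) (x : M)
    (w : TangentSpace IG (𝓖.u x)) : TangentSpace IG g :=
  (𝓖.tangentMul g (𝓖.u x) (0 : EG) w : EG)

/-- The differential of the inversion at the unit `1_x`, as an endomorphism of `T_{1_x} G`
(recall `1_x⁻¹ = 1_x`). -/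
def dInv (𝓖 : LieGroupoid IG G IM M) (x : M) (v : TangentSpace IG (𝓖.u x)) :
    TangentSpace IG (𝓖.u x) :=
  (mfderiv IG IG 𝓖.inv (𝓖.u x) v : EG)

/-- `v ∈ T_{1_x} G` belongs to the fibre at `x` of the Lie algebroid `A_G = ker ds |_M`. -/
def MemAlgebroid (𝓖 : LieGroupoid IG G IM M) (x : M) (v : TangentSpace IG (𝓖.u x)) : Prop :=
  mfderiv IG IM 𝓖.s (𝓖.u x) v = 0

/-- A multiplicative vector field on `G ⇉ M`: a vector field `Y` on `G` which is a groupoid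
morphism from `G ⇉ M` to the tangent groupoid `TG ⇉ TM`, over some vector field `y` on `M`. -/
def IsMultiplicative (𝓖 : LieGroupoid IG G IM M) (Y : ∀ g : G, TangentSpace IG g) : Prop :=
  ∃ y : ∀ x : M, TangentSpace IM x,
    (∀ g, mfderiv IG IM 𝓖.s g (Y g) = y (𝓖.s g)) ∧
    (∀ g, mfderiv IG IM 𝓖.t g (Y g) = y (𝓖.t g)) ∧
    (∀ x, Y (𝓖.u x) = mfderiv IM IG 𝓖.u x (y x)) ∧
    ∀ g h, 𝓖.s g = 𝓖.t h → Y (𝓖.mul g h) = 𝓖.tangentMul g h (Y g) (Y h)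

/-- A bisection: a smooth section `σ` of the source map such that `t ∘ σ` is a diffeomorphism. -/
def IsBisection (𝓖 : LieGroupoid IG G IM M) (σ : M → G) : Prop :=
  ContMDiff IM IG ∞ σ ∧ (∀ x, 𝓖.s (σ x) = x) ∧
    ∃ e : Diffeomorph IM IM M M ∞, ∀ x, e x = 𝓖.t (σ x)

/-- Conjugation by a bisection, `I_σ(g) = σ(t g) g σ(s g)⁻¹`. -/
def conj (𝓖 : LieGroupoid IG G IM M) (σ : M → G) (g : G) : G :=
  𝓖.mul (𝓖.mul (σ (𝓖.t g)) g) (𝓖.inv (σ (𝓖.s g)))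

end LieGroupoid

variable {EH HH EN HN : Type*}
  [NormedAddCommGroup EH] [NormedSpace ℝ EH] [TopologicalSpace HH]
  [NormedAddCommGroup EN] [NormedSpace ℝ EN] [TopologicalSpace HN]
  {IH : ModelWithCorners ℝ EH HH} {H : Type*} [TopologicalSpace H] [ChartedSpace HH H]
  {IN : ModelWithCorners ℝ EN HN} {N : Type*} [TopologicalSpace N] [ChartedSpace HN N]
  {IG : ModelWithCorners ℝ EG HG} {G : Type*} [TopologicalSpace G] [ChartedSpace HG G]
  {IM : ModelWithCorners ℝ EM HM} {M : Type*} [TopologicalSpace M] [ChartedSpace HM M]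

namespace LieGroupoid

/-- `(Φ, φ)` is a morphism of Lie groupoids from `H ⇉ N` to `G ⇉ M`. -/
structure IsMorphism (𝓗 : LieGroupoid IH H IN N) (𝓖 : LieGroupoid IG G IM M)
    (Φ : H → G) (φ : N → M) : Prop where
  contMDiff : ContMDiff IH IG ∞ Φ
  contMDiff_base : ContMDiff IN IM ∞ φ
  map_s : ∀ h, 𝓖.s (Φ h) = φ (𝓗.s h)
  map_t : ∀ h, 𝓖.t (Φ h) = φ (𝓗.t h)
  map_u : ∀ x, Φ (𝓗.u x) = 𝓖.u (φ x)
  map_mul : ∀ g h, 𝓗.s g = 𝓗.t h → Φ (𝓗.mul g h) = 𝓖.mul (Φ g) (Φ h)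

/-- `F` is an automorphism of the Lie groupoid `H ⇉ N`: a morphism with an inverse morphism. -/
def IsAutomorphism (𝓗 : LieGroupoid IH H IN N) (F : H → H) : Prop :=
  ∃ (f : N → N) (F' : H → H) (f' : N → N), IsMorphism 𝓗 𝓗 F f ∧ IsMorphism 𝓗 𝓗 F' f' ∧
    Function.LeftInverse F' F ∧ Function.RightInverse F' F

/-- The differential `δ_Φ : Γ(φ^* A_G) → C¹_def(Φ)` of the deformation complex of a morphism:
`δ_Φ β (h) = r_{Φ h} (β (t h)) + l_{Φ h} (di (β (s h)))`. -/
def delta (𝓗 : LieGroupoid IH H IN N) (𝓖 : LieGroupoid IG G IM M) (Φ : H → G) (φ : N → M)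
    (β : ∀ x : N, TangentSpace IG (𝓖.u (φ x))) (h : H) : TangentSpace IG (Φ h) :=
  𝓖.rightTranslate (Φ h) (φ (𝓗.t h)) (β (𝓗.t h)) +
    𝓖.leftTranslate (Φ h) (φ (𝓗.s h)) (𝓖.dInv (φ (𝓗.s h)) (β (𝓗.s h)))

end LieGroupoid

/-! ## `k`-parameter deformations -/

/-- An open interval containing zero. -/
def IsOpenIntervalAtZero (J : Set ℝ) : Prop := IsOpen J ∧ J.OrdConnected ∧ (0 : ℝ) ∈ J

/-- The set `J^k` of parameters `(ε₁, …, ε_k)`. -/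
def cube (k : ℕ) (J : Set ℝ) : Set (Fin k → ℝ) := Set.pi univ fun _ => J

/-- The partial derivative `∂Φ_ε(x) / ∂ε_i`, a tangent vector at `Φ_ε(x)`, of a family of maps
`Φ_ε = Φ (·, ε)`. -/
def paramDeriv {k : ℕ} {X : Type*} (IG : ModelWithCorners ℝ EG HG) (Φ : X × (Fin k → ℝ) → G)
    (i : Fin k) (ε : Fin k → ℝ) (x : X) : TangentSpace IG (Φ (x, ε)) :=
  mfderiv 𝓘(ℝ, Fin k → ℝ) IG (fun e => Φ (x, e)) ε (Pi.single i 1 : Fin k → ℝ)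

/-- The map `Φ : X × ℝ^k → Y` is smooth on `X × J^k`. -/
def SmoothFamily {k : ℕ} (IH : ModelWithCorners ℝ EH HH) (IG : ModelWithCorners ℝ EG HG)
    (J : Set ℝ) (Φ : H × (Fin k → ℝ) → G) : Prop :=
  ContMDiffOn (IH.prod 𝓘(ℝ, Fin k → ℝ)) IG ∞ Φ (univ ×ˢ cube k J)

/-- The family of vector fields `Y_ε` on `H`, `ε ∈ J^k`, is smooth. -/
def SmoothVectorFields {k : ℕ} (IH : ModelWithCorners ℝ EH HH) [IsManifold IH ∞ H] (J : Set ℝ)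
    (Y : (Fin k → ℝ) → ∀ h : H, TangentSpace IH h) : Prop :=
  ContMDiffOn (IH.prod 𝓘(ℝ, Fin k → ℝ)) IH.tangent ∞
    (fun p : H × (Fin k → ℝ) => (⟨p.1, Y p.2 p.1⟩ : TangentBundle IH H)) (univ ×ˢ cube k J)

namespace LieGroupoid

/-- `α_ε`, `ε ∈ J^k`, is a smooth family of sections of the Lie algebroid `A_G`.  As `A_G` is an
embedded submanifold of `TG`, smoothness can be tested in `TG`. -/
def SmoothAlgebroidSections {k : ℕ} [IsManifold IG ∞ G] (𝓖 : LieGroupoid IG G IM M) (J : Set ℝ)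
    (α : (Fin k → ℝ) → ∀ x : M, TangentSpace IG (𝓖.u x)) : Prop :=
  (∀ ε ∈ cube k J, ∀ x, 𝓖.MemAlgebroid x (α ε x)) ∧
    ContMDiffOn (IM.prod 𝓘(ℝ, Fin k → ℝ)) IG.tangent ∞
      (fun p : M × (Fin k → ℝ) => (⟨𝓖.u p.1, α p.2 p.1⟩ : TangentBundle IG G))
      (univ ×ˢ cube k J)

/-- `Φ : H × I^k → G`, with base map `φ : N × I^k → M`, is a `k`-deformation of the morphism
`(Φ₀, φ₀)`.  Only the values on `H × I^k` and `N × I^k` matter. -/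
structure IsKDeformation {k : ℕ} (𝓗 : LieGroupoid IH H IN N) (𝓖 : LieGroupoid IG G IM M)
    (I : Set ℝ) (Φ₀ : H → G) (φ₀ : N → M) (Φ : H × (Fin k → ℝ) → G)
    (φ : N × (Fin k → ℝ) → M) : Prop where
  smooth : SmoothFamily IH IG I Φ
  smooth_base : SmoothFamily IN IM I φ
  isMorphism : ∀ ε ∈ cube k I, IsMorphism 𝓗 𝓖 (fun h => Φ (h, ε)) (fun x => φ (x, ε))
  map_zero : ∀ h, Φ (h, 0) = Φ₀ h
  map_zero_base : ∀ x, φ (x, 0) = φ₀ x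

/-- `F_ε`, `ε ∈ J^k`, is a smooth family of automorphisms of `H ⇉ N`. -/
def SmoothAutomorphisms {k : ℕ} (𝓗 : LieGroupoid IH H IN N) (J : Set ℝ)
    (F : H × (Fin k → ℝ) → H) : Prop :=
  SmoothFamily IH IH J F ∧ ∀ ε ∈ cube k J, 𝓗.IsAutomorphism fun h => F (h, ε)

/-- `σ_ε`, `ε ∈ J^k`, is a smooth family of bisections of `G ⇉ M`. -/
def SmoothBisections {k : ℕ} (𝓖 : LieGroupoid IG G IM M) (J : Set ℝ)
    (σ : M × (Fin k → ℝ) → G) : Prop :=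
  SmoothFamily IM IG J σ ∧ ∀ ε ∈ cube k J, 𝓖.IsBisection fun x => σ (x, ε)

/-- The `k`-deformation `Φ` of `Φ₀` is strongly trivial up to automorphisms on the left:
`Φ_ε ∘ F_ε = I_{σ_ε} ∘ Φ₀` for all small `ε`. -/
def StronglyTrivialLeft {k : ℕ} (𝓗 : LieGroupoid IH H IN N) (𝓖 : LieGroupoid IG G IM M)
    (I : Set ℝ) (Φ₀ : H → G) (Φ : H × (Fin k → ℝ) → G) : Prop :=
  ∃ J ⊆ I, IsOpenIntervalAtZero J ∧
    ∃ (F : H × (Fin k → ℝ) → H) (σ : M × (Fin k → ℝ) → G),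
      𝓗.SmoothAutomorphisms J F ∧ 𝓖.SmoothBisections J σ ∧
      (∀ h, F (h, 0) = h) ∧ (∀ x, σ (x, 0) = 𝓖.u x) ∧
      ∀ ε ∈ cube k J, ∀ h, Φ (F (h, ε), ε) = 𝓖.conj (fun x => σ (x, ε)) (Φ₀ h)

/-- The canonical 1-deformations in `Φ` along the direction `e_i`, that is, the families in the
single variable `ε_i` obtained by freezing the other coordinates of `ε`, are strongly trivial up to
automorphisms on the left, smoothly in (and on a common interval for) the frozen coordinates. -/
def CanonicalStronglyTrivialLeft {k : ℕ} (𝓗 : LieGroupoid IH H IN N)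
    (𝓖 : LieGroupoid IG G IM M) (I : Set ℝ) (Φ : H × (Fin k → ℝ) → G) (i : Fin k) : Prop :=
  ∃ J ⊆ I, IsOpenIntervalAtZero J ∧
    ∃ (F : H × (Fin k → ℝ) → H) (σ : M × (Fin k → ℝ) → G),
      𝓗.SmoothAutomorphisms J F ∧ 𝓖.SmoothBisections J σ ∧
      (∀ ε ∈ cube k J, ε i = 0 → ∀ h, F (h, ε) = h) ∧
      (∀ ε ∈ cube k J, ε i = 0 → ∀ x, σ (x, ε) = 𝓖.u x) ∧
      ∀ ε ∈ cube k J, ∀ h,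
        Φ (F (h, ε), ε) = 𝓖.conj (fun x => σ (x, ε)) (Φ (h, Function.update ε i 0))

/-- The cohomological equations
`∂Φ_ε/∂ε_i = (Φ_ε)_* Y^i_ε + δ_{Φ_ε} (φ_ε^* α^i_ε)`, `i = 1, …, k`, for all small `ε`, with smooth
families `Y^i_ε` of multiplicative vector fields on `H` and `α^i_ε` of sections of `A_G`. -/
def SmoothPreimage {k : ℕ} [IsManifold IH ∞ H] [IsManifold IG ∞ G] (𝓗 : LieGroupoid IH H IN N)
    (𝓖 : LieGroupoid IG G IM M) (I : Set ℝ) (Φ : H × (Fin k → ℝ) → G)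
    (φ : N × (Fin k → ℝ) → M) : Prop :=
  ∃ J ⊆ I, IsOpenIntervalAtZero J ∧
    ∃ (Y : Fin k → (Fin k → ℝ) → ∀ h : H, TangentSpace IH h)
      (α : Fin k → (Fin k → ℝ) → ∀ x : M, TangentSpace IG (𝓖.u x)),
      (∀ i, SmoothVectorFields IH J (Y i)) ∧
      (∀ i, ∀ ε ∈ cube k J, 𝓗.IsMultiplicative (Y i ε)) ∧
      (∀ i, 𝓖.SmoothAlgebroidSections J (α i)) ∧
      ∀ i, ∀ ε ∈ cube k J, ∀ h : H,
        paramDeriv IG Φ i ε h =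
          mfderiv IH IG (fun h' => Φ (h', ε)) h (Y i ε h) +
            delta 𝓗 𝓖 (fun h' => Φ (h', ε)) (fun x => φ (x, ε))
              (fun x => α i ε (φ (x, ε))) h

end LieGroupoid

/-! ## Deformations of smooth maps -/

/-- `f : N × I^k → M` is a `k`-deformation of the map `f₀ : N → M`. -/
def IsMapKDeformation {k : ℕ} (IN : ModelWithCorners ℝ EN HN) (IM : ModelWithCorners ℝ EM HM)
    (I : Set ℝ) (f₀ : N → M) (f : N × (Fin k → ℝ) → M) : Prop :=
  SmoothFamily IN IM I f ∧ ∀ x, f (x, 0) = f₀ x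

/-- The `k`-deformation `f` of `f₀` is trivial: `f_ε ∘ F_ε = K_ε ∘ f₀` for all small `ε`, with
`k`-deformations `F` and `K` of the identity maps. -/
def TrivialMapDeformation {k : ℕ} (IN : ModelWithCorners ℝ EN HN) (IM : ModelWithCorners ℝ EM HM)
    (I : Set ℝ) (f₀ : N → M) (f : N × (Fin k → ℝ) → M) : Prop :=
  ∃ J ⊆ I, IsOpenIntervalAtZero J ∧
    ∃ (F : N × (Fin k → ℝ) → N) (K : M × (Fin k → ℝ) → M),
      IsMapKDeformation IN IN J id F ∧ IsMapKDeformation IM IM J id K ∧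
      ∀ ε ∈ cube k J, ∀ x, f (F (x, ε), ε) = K (f₀ x, ε)

/-- The equations `∂f_ε/∂ε_i = df_ε (ζ^i_ε) + f_ε^* η^i_ε`, `i = 1, …, k`, for all small `ε`, with
smooth families `ζ^i_ε` and `η^i_ε` of vector fields on the source and on the target. -/
def ThomLevineEquations {k : ℕ} (IN : ModelWithCorners ℝ EN HN) (IM : ModelWithCorners ℝ EM HM)
    [IsManifold IN ∞ N] [IsManifold IM ∞ M] (I : Set ℝ) (f : N × (Fin k → ℝ) → M) : Prop :=
  ∃ J ⊆ I, IsOpenIntervalAtZero J ∧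
    ∃ (ζ : Fin k → (Fin k → ℝ) → ∀ x : N, TangentSpace IN x)
      (η : Fin k → (Fin k → ℝ) → ∀ y : M, TangentSpace IM y),
      (∀ i, SmoothVectorFields IN J (ζ i)) ∧ (∀ i, SmoothVectorFields IM J (η i)) ∧
      ∀ i, ∀ ε ∈ cube k J, ∀ x : N,
        paramDeriv IM f i ε x =
          mfderiv IN IM (fun x' => f (x', ε)) x (ζ i ε x) + η i ε (f (x, ε))

/-! ## Pair groupoids -/

/-- The pair groupoid `M × M ⇉ M`, with `s (p, q) = q`, `t (p, q) = p`, `(p, q)(q, r) = (p, r)`. -/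
def pairGroupoid (IM : ModelWithCorners ℝ EM HM) (M : Type*) [TopologicalSpace M]
    [ChartedSpace HM M] : LieGroupoid (IM.prod IM) (M × M) IM M where
  s := Prod.snd
  t := Prod.fst
  u := fun x => (x, x)
  inv := fun p => (p.2, p.1)
  mul := fun p q => (p.1, q.2)
  s_mul := fun _ _ _ => rfl
  t_mul := fun _ _ _ => rfl
  mul_assoc := fun _ _ _ _ _ => rfl
  s_u := fun _ => rfl
  t_u := fun _ => rfl
  u_mul := fun _ => rfl
  mul_u := fun _ => rfl
  s_inv := fun _ => rfl
  t_inv := fun _ => rfl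
  inv_mul := fun _ => rfl
  mul_inv := fun _ => rfl
  contMDiff_s := contMDiff_snd
  contMDiff_t := contMDiff_fst
  contMDiff_u := contMDiff_id.prodMk contMDiff_id
  contMDiff_inv := contMDiff_snd.prodMk contMDiff_fst
  contMDiffOn_mul :=
    ((contMDiff_fst.comp contMDiff_fst).prodMk (contMDiff_snd.comp contMDiff_snd)).contMDiffOn
  submersion_s := fun g v => ⟨((0, v) : EM × EM), by rw [mfderiv_snd]; rfl⟩
  submersion_t := fun g v => ⟨((v, 0) : EM × EM), by rw [mfderiv_fst]; rfl⟩

/-- The family `f_ε × f_ε : N × N → M × M` of morphisms of pair groupoids. -/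
def pairFamily {k : ℕ} {N M : Type*} (f : N × (Fin k → ℝ) → M) :
    (N × N) × (Fin k → ℝ) → M × M :=
  fun p => (f (p.1.1, p.2), f (p.1.2, p.2))

end LieGroupoids

end

/-! Condition 3 is the infinitesimal form of condition 1 (and of 2), and two constructions pass
between them.

From 1 or 2 to 3 (`exists_cohomological_solution`): suppose Φ_ε ∘ F_ε = I_{σ_ε} ∘ Ψ, where Ψ does
not depend on ε_i. Then Φ at ε + τe_i arises from Φ_ε by precomposition with F_ε ∘ F_{ε+τe_i}⁻¹ and
conjugation with the arrows σ_{ε+τe_i} σ_ε⁻¹. Both start at the identity for τ = 0; the velocity of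
the first is a multiplicative vector field Y, that of the second a section α of the Lie algebroid,
and the product rule is the required equation. Condition 1 is the case Ψ = Φ₀, condition 2 the case
where Ψ is Φ with ε_i replaced by 0.

From 3 to 1 and 2 (`eq_conj_of_lineCurves`, `LieGroupoid.exists_strong_trivialisation`): fix a line
ε + tv of parameters. Let c be a curve in H with c' = -∑ v_i Y^i(c), and let σ_x be the integral
curve through the unit 1_x of the right-invariant field of ∑ v_i α^i. Along c the Y-terms cancel, so
g(t) = Φ_{ε+tv}(c(t)) satisfies g' = r_g α + l_g(di α). Hence g(t) σ_{s(g(0))}(t) and σ_{t(g(0))}(t)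
g(0) are integral curves of one right-invariant field with the same initial value. They agree, which
says g(t) = I_{σ(t)}(g(0)). At t = 1, lines from 0 to ε give condition 1 and lines from (ε with ε_i
= 0) to ε give condition 2. Only lines are integrated, so no compatibility between different
directions is needed.

The flows must exist up to time 1 and be smooth in all parameters. Since v is small, this is an
implicit function problem in C([-1,2], E) around constant curves (`exists_smooth_lineODE_solution`);
it is globalised in `exists_lineFlow` by compactness of H and, on the side of G, after cutting α off
outside a compact set containing the image of φ. Uniqueness in the possibly non-Hausdorff arrow
space follows from a division argument (`eqOn_of_isLineCurve_rightField`).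

For pair groupoids, multiplicative fields are ζ × ζ and algebroid sections are vector fields η, so
condition 3 becomes the Thom–Levine equations. A trivialisation of maps does not assume that F_ε and
K_ε are diffeomorphisms; `exists_inverse_near_identity` inverts them where needed, which leads from
triviality to the Thom–Levine equations. -/

noncomputable section

universe u

/-! ## The Nemytskii operator -/

section Nemytskii

variable {X : Type*} [TopologicalSpace X] [CompactSpace X]

/-- Pointwise application of a continuous bilinear map to continuous functions, as a continuous
bilinear map. -/
def ContinuousMap.bilinL (X : Type*) [TopologicalSpace X] [CompactSpace X] {W D F : Type*}
    [NormedAddCommGroup W] [NormedSpace ℝ W]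
    [NormedAddCommGroup D] [NormedSpace ℝ D] [NormedAddCommGroup F] [NormedSpace ℝ F]
    (B : W →L[ℝ] D →L[ℝ] F) : C(X, W) →L[ℝ] C(X, D) →L[ℝ] C(X, F) :=
  LinearMap.mkContinuous₂
    (LinearMap.mk₂ ℝ (fun (A : C(X, W)) (h : C(X, D)) =>
        (⟨fun x => B (A x) (h x), (B.continuous.comp A.continuous).clm_apply h.continuous⟩ :
          C(X, F)))
      (fun _ _ _ => by ext; simp) (fun _ _ _ => by ext; simp) (fun _ _ _ => by ext; simp)
      (fun _ _ _ => by ext; simp)) ‖B‖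
    (fun A h => by
      rw [ContinuousMap.norm_le _ (by positivity)]
      intro x
      exact (B (A x)).le_of_opNorm_le_of_le
        (B.le_of_opNorm_le_of_le le_rfl (A.norm_coe_le_norm x)) (h.norm_coe_le_norm x))

@[simp] theorem ContinuousMap.bilinL_apply {W D F : Type*}
    [NormedAddCommGroup W] [NormedSpace ℝ W]
    [NormedAddCommGroup D] [NormedSpace ℝ D] [NormedAddCommGroup F] [NormedSpace ℝ F]
    (B : W →L[ℝ] D →L[ℝ] F) (A : C(X, W)) (h : C(X, D)) (x : X) :
    ContinuousMap.bilinL X B A h x = B (A x) (h x) := rfl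

/-- The mean value inequality at each x, on the ball of radius ‖h‖ about η x, with a bound
independent of x. -/
theorem hasFDerivAt_postcomp {W D F : Type*} [NormedAddCommGroup W] [NormedSpace ℝ W]
    [NormedAddCommGroup D] [NormedSpace ℝ D] [NormedAddCommGroup F] [NormedSpace ℝ F]
    (B : W →L[ℝ] D →L[ℝ] F) (f : C(D, F)) (f' : C(D, W))
    (hf : ∀ x, HasFDerivAt f (B (f' x)) x) (η : C(X, D)) :
    HasFDerivAt (fun η : C(X, D) => f.comp η) (ContinuousMap.bilinL X B (f'.comp η)) η := by
  rw [hasFDerivAt_iff_isLittleO_nhds_zero, Asymptotics.isLittleO_iff]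
  intro c hc
  have hcont : Continuous fun h : C(X, D) => f'.comp (η + h) :=
    f'.continuous_postcomp.comp (continuous_const.add continuous_id)
  have hcont' : Continuous fun h : C(X, D) => ‖B‖ * ‖f'.comp (η + h) - f'.comp η‖ :=
    continuous_const.mul (hcont.sub continuous_const).norm
  have h0 : ∀ᶠ h : C(X, D) in 𝓝 0, ‖B‖ * ‖f'.comp (η + h) - f'.comp η‖ < c :=
    hcont'.continuousAt.eventually_lt continuousAt_const (by simpa using hc)
  obtain ⟨δ, hδ, hball⟩ := Metric.eventually_nhds_iff_ball.mp h0
  filter_upwards [Metric.ball_mem_nhds (0 : C(X, D)) hδ] with h hh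
  rw [ContinuousMap.norm_le _ (by positivity)]
  intro x
  -- Continuity of η ↦ f' ∘ η in the sup norm, tested on the constant perturbation z - η x, replaces
  -- uniform continuity of f'.
  have hseg : ∀ z ∈ Metric.closedBall (η x) ‖h‖, ‖B (f' z) - B (f' (η x))‖ ≤ c := by
    intro z hz
    have hmem : ContinuousMap.const X (z - η x) ∈ Metric.ball (0 : C(X, D)) δ := by
      rw [mem_ball_zero_iff] at hh ⊢
      refine lt_of_le_of_lt ?_ hh
      rw [ContinuousMap.norm_le _ (norm_nonneg _)]
      intro y
      simpa [dist_eq_norm] using hz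
    rw [← map_sub]
    have := B.le_of_opNorm_le_of_le le_rfl ((f'.comp (η + ContinuousMap.const X (z - η x)) -
      f'.comp η).norm_coe_le_norm x)
    have := this.trans (hball _ hmem).le
    simpa using this
  have key := (convex_closedBall (η x) ‖h‖).norm_image_sub_le_of_norm_hasFDerivWithin_le'
    (f := f) (f' := fun z => B (f' z)) (φ := B (f' (η x))) (C := c)
    (fun z hz => (hf z).hasFDerivWithinAt) hseg
    (Metric.mem_closedBall_self (norm_nonneg _)) (y := η x + h x)
    (by simpa [dist_eq_norm] using h.norm_coe_le_norm x)
  refine le_trans (by simpa using key) ?_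
  simpa using mul_le_mul_of_nonneg_left (h.norm_coe_le_norm x) hc.le

/-- The derivative of postcomposition with f is a bounded linear function of postcomposition with
f', so one order is gained. -/
theorem contDiff_succ_postcomp {W D F : Type*} [NormedAddCommGroup W] [NormedSpace ℝ W]
    [NormedAddCommGroup D] [NormedSpace ℝ D] [NormedAddCommGroup F] [NormedSpace ℝ F]
    (B : W →L[ℝ] D →L[ℝ] F) (f : C(D, F)) (f' : C(D, W))
    (hf : ∀ x, HasFDerivAt f (B (f' x)) x) {n : ℕ}
    (hn : ContDiff ℝ n (fun η : C(X, D) => f'.comp η)) :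
    ContDiff ℝ (n + 1) (fun η : C(X, D) => f.comp η) :=
  contDiff_succ_iff_hasFDerivAt.mpr ⟨_, (ContinuousMap.bilinL X B).contDiff.comp hn,
    fun η => hasFDerivAt_postcomp B f f' hf η⟩

/-- F is generalised because the inductive step passes from F to `D →L[ℝ] F`; a common universe for
D and F keeps that space in `Type u`. -/
theorem contDiff_postcomp_nat {D : Type u} [NormedAddCommGroup D] [NormedSpace ℝ D] (n : ℕ) :
    ∀ {F : Type u} [NormedAddCommGroup F] [NormedSpace ℝ F] (f : C(D, F)),
      ContDiff ℝ n f → ContDiff ℝ n (fun η : C(X, D) => f.comp η) := by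
  induction n with
  | zero =>
    intro F _ _ f hf
    exact contDiff_zero.mpr f.continuous_postcomp
  | succ n ih =>
    intro F _ _ f hf
    push_cast at hf ⊢
    obtain ⟨f', hf', hd⟩ := contDiff_succ_iff_hasFDerivAt.mp hf
    exact contDiff_succ_postcomp (ContinuousLinearMap.id ℝ (D →L[ℝ] F)) f ⟨f', hf'.continuous⟩ hd
      (ih _ hf')

/-- Composition with a smooth map is a smooth operation on spaces of continuous functions. -/
theorem contDiff_postcomp {D F : Type u} [NormedAddCommGroup D] [NormedSpace ℝ D]
    [NormedAddCommGroup F] [NormedSpace ℝ F] (f : C(D, F)) (hf : ContDiff ℝ ∞ f) :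
    ContDiff ℝ ∞ (fun η : C(X, D) => f.comp η) :=
  contDiff_infty.mpr fun n => contDiff_postcomp_nat n f (contDiff_infty.mp hf n)

end Nemytskii

/-! ## The implicit function theorem near a point -/

/-- The implicit function of a smooth equation is smooth near the base point. -/
theorem exists_implicit_smooth {A B C : Type*} [NormedAddCommGroup A] [NormedSpace ℝ A]
    [CompleteSpace A] [NormedAddCommGroup B] [NormedSpace ℝ B] [CompleteSpace B]
    [NormedAddCommGroup C] [NormedSpace ℝ C] [CompleteSpace C] {F : A × B → C} {u : A × B}
    (hF : ∀ᶠ v in 𝓝 u, ContDiffAt ℝ ∞ F v)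
    (hinv : (fderiv ℝ F u ∘L .inr ℝ A B).IsInvertible) :
    ∃ ψ : A → B, ψ u.1 = u.2 ∧ (∀ᶠ x in 𝓝 u.1, F (x, ψ x) = F u) ∧
      (∀ᶠ v in 𝓝 u, F v = F u → ψ v.1 = v.2) ∧ ∀ᶠ x in 𝓝 u.1, ContDiffAt ℝ ∞ ψ x := by
  have hn : (∞ : WithTop ℕ∞) ≠ 0 := by simp
  have hu := hF.self_of_nhds
  set ψ := hu.implicitFunction hn hinv with hψ
  have h0 : ψ u.1 = u.2 := hu.implicitFunction_apply_self hn hinv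
  have h1 := hu.eventually_apply_implicitFunction hn hinv
  have h2 := hu.eventually_apply_eq_iff_implicitFunction hn hinv
  have h3 : ContDiffAt ℝ ∞ ψ u.1 := hu.contDiffAt_implicitFunction hn hinv
  refine ⟨ψ, h0, h1, h2.mono fun v hv => hv.mp, ?_⟩
  have hgr : ContinuousAt (fun x => (x, ψ x)) u.1 :=
    continuousAt_id.prodMk h3.continuousAt
  have hgr' : Filter.Tendsto (fun x => (x, ψ x)) (𝓝 u.1) (𝓝 u) := by
    have := hgr.tendsto
    rwa [h0] at this
  have hcont : ∀ᶠ x in 𝓝 u.1, ContinuousAt ψ x :=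
    ((h3.of_le (m := 1) (by simp)).eventually (by simp)).mono fun x hx => hx.continuousAt
  -- `ContDiffAt` of order ∞ at one point gives neighbourhoods that may shrink with the order.
  -- Smoothness at nearby points is obtained by applying the theorem again at (x, ψ x), where
  -- invertibility persists.
  have hinv' : ∀ᶠ v in 𝓝 u, (fderiv ℝ F v ∘L .inr ℝ A B).IsInvertible := by
    obtain ⟨e, he⟩ := hinv
    have hc : ContinuousAt (fun v => fderiv ℝ F v ∘L .inr ℝ A B) u := by
      have : ContinuousAt (fderiv ℝ F) u := (hu.fderiv_right (m := 0) (by simp)).continuousAt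
      exact this.clm_comp continuousAt_const
    have := ContinuousLinearEquiv.nhds e
    rw [he] at this
    exact (hc.eventually this).mono fun v hv => hv
  filter_upwards [h1, hgr'.eventually hF, hgr'.eventually hinv', hcont, h1.eventually_nhds]
    with x hx1 hx2 hx3 hx4 hx5
  have k2 := hx2.eventually_apply_eq_iff_implicitFunction hn hx3
  have k3 := hx2.contDiffAt_implicitFunction hn hx3
  refine k3.congr_of_eventuallyEq ?_
  -- Local uniqueness of the implicit function at (x, ψ x) identifies it with ψ near x.
  have : Filter.Tendsto (fun y => (y, ψ y)) (𝓝 x) (𝓝 (x, ψ x)) :=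
    continuousAt_id.prodMk hx4
  filter_upwards [this.eventually k2, hx5] with y hy hy'
  exact (hy.mp (hy'.trans hx1.symm)).symm

/-! ## Linear ordinary differential equations along lines of parameters -/

section LineODE

/-- The time interval on which curves are considered. -/
abbrev timeIcc : Set ℝ := Icc (-1) 2

/-- The open time interval on which curves are considered. -/
abbrev timeIoo : Set ℝ := Ioo (-1) 2

theorem neg_one_le_two : (-1 : ℝ) ≤ 2 := by norm_num

variable (E : Type*) [NormedAddCommGroup E] [NormedSpace ℝ E]

/-- The linear map `v ↦ φ • v` into continuous functions. -/
def smulFunL {V : Type*} [NormedAddCommGroup V] [NormedSpace ℝ V] (φ : C(timeIcc, ℝ)) :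
    V →L[ℝ] C(timeIcc, V) :=
  LinearMap.mkContinuous
    { toFun := fun v => ⟨fun t => φ t • v, φ.continuous.smul continuous_const⟩
      map_add' := fun _ _ => by ext; simp
      map_smul' := fun c v => by ext t; simp [smul_comm c (φ t) v] } ‖φ‖
    (fun v => by
      rw [ContinuousMap.norm_le _ (by positivity)]
      intro t
      exact (norm_smul_le _ _).trans
        (mul_le_mul_of_nonneg_right (φ.norm_coe_le_norm t) (norm_nonneg v)))

@[simp] theorem smulFunL_apply {V : Type*} [NormedAddCommGroup V] [NormedSpace ℝ V]
    (φ : C(timeIcc, ℝ)) (v : V) (t : timeIcc) : smulFunL φ v t = φ t • v := rfl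

/-- The primitive vanishing at time zero, as an operator on continuous functions. -/
def primitiveL [CompleteSpace E] : C(timeIcc, E) →L[ℝ] C(timeIcc, E) :=
  LinearMap.mkContinuous
    { toFun := fun η => ⟨fun t => ∫ r in (0 : ℝ)..t, η (projIcc (-1) 2 neg_one_le_two r),
        (intervalIntegral.continuous_primitive (fun a b =>
          (η.continuous.comp (continuous_projIcc (h := neg_one_le_two))).intervalIntegrable a b) 0).comp
          continuous_subtype_val⟩
      map_add' := fun η ξ => by
        ext t
        exact intervalIntegral.integral_add
          ((η.continuous.comp (continuous_projIcc (h := neg_one_le_two))).intervalIntegrable _ _)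
          ((ξ.continuous.comp (continuous_projIcc (h := neg_one_le_two))).intervalIntegrable _ _)
      map_smul' := fun c η => by
        ext t
        exact intervalIntegral.integral_smul c _ } 2
    (fun η => by
      rw [ContinuousMap.norm_le _ (by positivity)]
      intro t
      have h := intervalIntegral.norm_integral_le_of_norm_le_const (a := (0 : ℝ)) (b := t)
        (f := fun r => η (projIcc (-1) 2 neg_one_le_two r)) (C := ‖η‖)
        (fun r _ => η.norm_coe_le_norm _)
      have ht : |(t : ℝ) - 0| ≤ 2 := by
        rw [sub_zero, abs_le]
        exact ⟨by linarith [t.2.1], t.2.2⟩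
      calc _ ≤ ‖η‖ * |(t : ℝ) - 0| := h
        _ ≤ ‖η‖ * 2 := by gcongr
        _ = 2 * ‖η‖ := mul_comm _ _)

@[simp] theorem primitiveL_apply [CompleteSpace E] (η : C(timeIcc, E)) (t : timeIcc) :
    primitiveL E η t = ∫ r in (0 : ℝ)..t, η (projIcc (-1) 2 neg_one_le_two r) := rfl

/-- The bilinear map `(w, v) ↦ ∑ i, v i • w i`. -/
def sumSMulL (k : ℕ) : (Fin k → E) →L[ℝ] (Fin k → ℝ) →L[ℝ] E :=
  ∑ i, (ContinuousLinearMap.lsmul ℝ ℝ : ℝ →L[ℝ] E →L[ℝ] E).flip.bilinearComp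
    (ContinuousLinearMap.proj i) (ContinuousLinearMap.proj i)

@[simp] theorem sumSMulL_apply (k : ℕ) (w : Fin k → E) (v : Fin k → ℝ) :
    sumSMulL E k w v = ∑ i, v i • w i := by
  simp [sumSMulL]

variable {E}

/-- Solutions, for small `v`, of the equation `γ' = ∑ i, v i • f i (ε + t v, γ)` on a fixed time
interval depend smoothly on the initial value and on the parameters. -/
theorem exists_smooth_lineODE_solution {E : Type u} [NormedAddCommGroup E] [NormedSpace ℝ E]
    [CompleteSpace E] {k : ℕ} (f : (Fin k → ℝ) × E → Fin k → E) (hf : ContDiff ℝ ∞ f) (e₀ : E)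
    (ε₀ : Fin k → ℝ) :
    ∃ γ : E × (Fin k → ℝ) × (Fin k → ℝ) → ℝ → E,
      (∀ U ∈ 𝓝 e₀, ∀ᶠ p in 𝓝 (e₀, ε₀, (0 : Fin k → ℝ)), ∀ t, γ p t ∈ U) ∧
      ∀ᶠ p in 𝓝 (e₀, ε₀, (0 : Fin k → ℝ)), γ p 0 = p.1 ∧
        (∀ t, ContDiffAt ℝ ∞ (fun q => γ q t) p) ∧
        ∀ t ∈ timeIoo, HasDerivAt (γ p) (∑ i, p.2.2 i • f (p.2.1 + t • p.2.2, γ p t) i) t := by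
  let P := E × (Fin k → ℝ) × (Fin k → ℝ)
  let one : C(timeIcc, ℝ) := 1
  let tm : C(timeIcc, ℝ) := ⟨fun t => t, continuous_subtype_val⟩
  let D := (Fin k → ℝ) × E
  -- The path t ↦ (ε + tv, η t), depending linearly on (ε, v, η).
  let pair : P × C(timeIcc, E) → C(timeIcc, D) := fun q =>
    ((ContinuousLinearMap.inl ℝ (Fin k → ℝ) E).compLeftContinuous ℝ timeIcc
      (smulFunL one q.1.2.1 + smulFunL tm q.1.2.2)) +
    (ContinuousLinearMap.inr ℝ (Fin k → ℝ) E).compLeftContinuous ℝ timeIcc q.2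
  have hpair : ContDiff ℝ ∞ pair := by
    refine ContDiff.add ?_ ?_
    · refine (ContinuousLinearMap.contDiff _).comp (ContDiff.add ?_ ?_)
      · exact (ContinuousLinearMap.contDiff _).comp (contDiff_fst.comp (contDiff_snd.comp contDiff_fst))
      · exact (ContinuousLinearMap.contDiff _).comp (contDiff_snd.comp (contDiff_snd.comp contDiff_fst))
    · exact (ContinuousLinearMap.contDiff _).comp contDiff_snd
  have hpair_apply : ∀ q (t : timeIcc), pair q t = (q.1.2.1 + (t : ℝ) • q.1.2.2, q.2 t) := by
    intro q t
    simp [pair, one, tm]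
  let fc : C(D, Fin k → E) := ⟨f, hf.continuous⟩
  let rhs : P × C(timeIcc, E) → C(timeIcc, E) := fun q =>
    ContinuousMap.bilinL timeIcc (sumSMulL E k) (fc.comp (pair q)) (smulFunL one q.1.2.2)
  have hrhs : ContDiff ℝ ∞ rhs := by
    refine ContDiff.clm_apply ?_ ?_
    · exact (ContinuousLinearMap.contDiff _).comp ((contDiff_postcomp fc hf).comp hpair)
    · exact (ContinuousLinearMap.contDiff _).comp (contDiff_snd.comp (contDiff_snd.comp contDiff_fst))
  -- The integral equation η = e + ∫₀ᵗ ∑ v_i f_i(ε + rv, η(r)) dr, written as Ψ = 0.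
  let Ψ : P × C(timeIcc, E) → C(timeIcc, E) := fun q =>
    q.2 - smulFunL one q.1.1 - primitiveL E (rhs q)
  have hΨ : ContDiff ℝ ∞ Ψ :=
    (contDiff_snd.sub ((ContinuousLinearMap.contDiff _).comp (contDiff_fst.comp contDiff_fst))).sub
      ((ContinuousLinearMap.contDiff _).comp hrhs)
  let u : P × C(timeIcc, E) := ((e₀, ε₀, 0), smulFunL one e₀)
  have hu : Ψ u = 0 := by
    ext t
    simp [Ψ, rhs, u]
  -- At v = 0 the integrand vanishes for every η, so Ψ is a translation in η. This is why smallness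
  -- of v suffices on a time interval of fixed length.
  have hder : fderiv ℝ Ψ u ∘L .inr ℝ P C(timeIcc, E) = ContinuousLinearMap.id ℝ _ := by
    have h1 : HasFDerivAt Ψ (fderiv ℝ Ψ u) u := (hΨ.differentiable (by simp)).differentiableAt.hasFDerivAt
    have h2 : HasFDerivAt (fun η : C(timeIcc, E) => (u.1, η)) (.inr ℝ P C(timeIcc, E)) u.2 :=
      hasFDerivAt_prodMk_right _ _
    have h3 : HasFDerivAt (fun η : C(timeIcc, E) => Ψ (u.1, η))
        (fderiv ℝ Ψ u ∘L .inr ℝ P C(timeIcc, E)) u.2 := HasFDerivAt.comp u.2 h1 h2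
    have h4 : (fun η : C(timeIcc, E) => Ψ (u.1, η)) = fun η => η - smulFunL one e₀ := by
      funext η
      ext t
      simp [Ψ, rhs, u]
    rw [h4] at h3
    exact h3.unique ((hasFDerivAt_id _).sub_const _)
  obtain ⟨ψ, hψ0, hψ1, -, hψ3⟩ := exists_implicit_smooth (F := Ψ) (u := u)
    (Filter.Eventually.of_forall fun v => hΨ.contDiffAt)
    (by rw [hder]; exact ⟨ContinuousLinearEquiv.refl ℝ _, rfl⟩)
  -- Outside [-1,2] the curve is constant, so the statements without derivatives hold for all t.
  refine ⟨fun p t => ψ p (projIcc (-1) 2 neg_one_le_two t), ?_, ?_⟩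
  · intro U hU
    obtain ⟨δ, hδ, hball⟩ := Metric.mem_nhds_iff.mp hU
    have hc : ContinuousAt ψ u.1 := hψ3.self_of_nhds.continuousAt
    filter_upwards [hc.eventually (Metric.ball_mem_nhds _ hδ)] with p hp t
    refine hball ?_
    replace hp : ‖ψ p - u.2‖ < δ := by rw [← dist_eq_norm, ← hψ0]; exact hp
    rw [mem_ball_iff_norm]
    refine lt_of_le_of_lt ?_ hp
    simpa [u, one] using
      (ψ p - smulFunL one e₀).norm_coe_le_norm (projIcc (-1) 2 neg_one_le_two t)
  · filter_upwards [hψ1, hψ3] with p hp1 hp3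
    have hint : ∀ t : timeIcc, ψ p t = p.1 + ∫ r in (0 : ℝ)..t,
        rhs (p, ψ p) (projIcc (-1) 2 neg_one_le_two r) := by
      intro t
      rw [hu] at hp1
      have := DFunLike.congr_fun hp1 t
      simp only [Ψ, ContinuousMap.sub_apply, smulFunL_apply, one, ContinuousMap.one_apply, one_smul,
        primitiveL_apply, ContinuousMap.zero_apply] at this
      rw [sub_sub, sub_eq_zero] at this
      exact this
    refine ⟨?_, fun t => ?_, fun t ht => ?_⟩
    · rw [projIcc_of_mem neg_one_le_two (show (0 : ℝ) ∈ Icc (-1) 2 by constructor <;> norm_num), hint]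
      simp
    · let ev : C(timeIcc, E) →L[ℝ] E := ContinuousMap.evalCLM ℝ (projIcc (-1) 2 neg_one_le_two t)
      have hev : ContDiff ℝ ∞ ev := ev.contDiff
      have hp3' : ContDiffAt ℝ ∞ ψ p := hp3
      exact hev.contDiffAt.comp p hp3'
    · have hc : Continuous fun r => rhs (p, ψ p) (projIcc (-1) 2 neg_one_le_two r) :=
        (rhs (p, ψ p)).continuous.comp continuous_projIcc
      have hd := (intervalIntegral.integral_hasDerivAt_right (hc.intervalIntegrable 0 t)
        (hc.stronglyMeasurableAtFilter _ _) hc.continuousAt).const_add p.1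
      have hval : rhs (p, ψ p) (projIcc (-1) 2 neg_one_le_two t) =
          ∑ i, p.2.2 i • f (p.2.1 + t • p.2.2, ψ p (projIcc (-1) 2 neg_one_le_two t)) i := by
        simp only [rhs, ContinuousMap.bilinL_apply, sumSMulL_apply, ContinuousMap.comp_apply,
          hpair_apply, smulFunL_apply, one, ContinuousMap.one_apply, one_smul]
        rw [projIcc_of_mem neg_one_le_two (Ioo_subset_Icc_self ht)]
        rfl
      rw [hval] at hd
      refine hd.congr_of_eventuallyEq ?_
      filter_upwards [isOpen_Ioo.mem_nhds ht] with s hs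
      rw [hint, projIcc_of_mem neg_one_le_two (Ioo_subset_Icc_self hs)]

end LineODE

/-! ## Velocities of curves -/

section Velocity

variable {E HM : Type*} [NormedAddCommGroup E] [NormedSpace ℝ E] [TopologicalSpace HM]
  {I : ModelWithCorners ℝ E HM} {M : Type*} [TopologicalSpace M] [ChartedSpace HM M]
  {E' HM' : Type*} [NormedAddCommGroup E'] [NormedSpace ℝ E'] [TopologicalSpace HM']
  {I' : ModelWithCorners ℝ E' HM'} {M' : Type*} [TopologicalSpace M'] [ChartedSpace HM' M']

/-- The curve `γ` has velocity `v` at time `t`; here `v` is regarded as a vector of the model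
space, as all tangent spaces are copies of it. -/
def HasVelocity (I : ModelWithCorners ℝ E HM) (γ : ℝ → M) (v : E) (t : ℝ) : Prop :=
  HasMFDerivAt 𝓘(ℝ, ℝ) I γ t ((1 : ℝ →L[ℝ] ℝ).smulRight (v : TangentSpace I (γ t)))

namespace HasVelocity

theorem of_hasMFDerivAt {γ : ℝ → M} {v : E} {t : ℝ} {L : ℝ →L[ℝ] TangentSpace I (γ t)}
    (h : HasMFDerivAt 𝓘(ℝ, ℝ) I γ t L) (hv : L (1 : ℝ) = v) : HasVelocity I γ v t := by
  have : L = (1 : ℝ →L[ℝ] ℝ).smulRight (v : TangentSpace I (γ t)) := by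
    ext
    rw [hv]
    exact (one_smul ℝ v).symm
  rw [this] at h
  exact h

theorem continuousAt {γ : ℝ → M} {v : E} {t : ℝ} (h : HasVelocity I γ v t) : ContinuousAt γ t :=
  HasMFDerivAt.continuousAt h

theorem congr_of_eventuallyEq {γ γ' : ℝ → M} {v : E} {t : ℝ} (h : HasVelocity I γ v t)
    (h' : γ' =ᶠ[𝓝 t] γ) : HasVelocity I γ' v t := by
  have h1 := HasMFDerivAt.congr_of_eventuallyEq (h : HasMFDerivAt 𝓘(ℝ, ℝ) I γ t _) h'
  exact of_hasMFDerivAt h1 (one_smul ℝ v)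

theorem unique {γ : ℝ → M} {v w : E} {t : ℝ} (h : HasVelocity I γ v t)
    (h' : HasVelocity I γ w t) : v = w := by
  have h1 := congrArg (fun L => L (1 : ℝ)) (hasMFDerivAt_unique h h')
  have h2 : (1 : ℝ) • v = (1 : ℝ) • w := h1
  simpa using h2

theorem comp {γ : ℝ → M} {v : E} {t : ℝ} (h : HasVelocity I γ v t) {f : M → M'}
    {f' : TangentSpace I (γ t) →L[ℝ] TangentSpace I' (f (γ t))}
    (hf : HasMFDerivAt I I' f (γ t) f') : HasVelocity I' (fun s => f (γ s)) (f' v) t := by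
  have h1 : HasMFDerivAt 𝓘(ℝ, ℝ) I' (f ∘ γ) t _ := HasMFDerivAt.comp t hf h
  refine of_hasMFDerivAt h1 ?_
  exact congrArg f' (one_smul ℝ v)

theorem comp_within {γ : ℝ → M} {v : E} {t : ℝ} (h : HasVelocity I γ v t) {f : M → M'} {s : Set M}
    {f' : TangentSpace I (γ t) →L[ℝ] TangentSpace I' (f (γ t))}
    (hf : HasMFDerivWithinAt I I' f s (γ t) f') (hs : ∀ᶠ r in 𝓝 t, γ r ∈ s) :
    HasVelocity I' (fun s => f (γ s)) (f' v) t := by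
  have h1 : HasMFDerivWithinAt 𝓘(ℝ, ℝ) I' (f ∘ γ) (γ ⁻¹' s) t _ :=
    HasMFDerivWithinAt.comp t hf (HasMFDerivAt.hasMFDerivWithinAt h) subset_rfl
  have h2 := h1.hasMFDerivAt hs
  refine of_hasMFDerivAt h2 ?_
  exact congrArg f' (one_smul ℝ v)

theorem prodMk {γ : ℝ → M} {v : E} {t : ℝ} (h : HasVelocity I γ v t) {γ' : ℝ → M'} {v' : E'}
    (h' : HasVelocity I' γ' v' t) :
    HasVelocity (I.prod I') (fun s => (γ s, γ' s)) ((v, v') : E × E') t := by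
  have h1 := HasMFDerivAt.prodMk h h'
  unfold HasVelocity
  convert! h1 using 1

theorem iff_hasDerivAt {γ : ℝ → E} {v : E} {t : ℝ} :
    HasVelocity 𝓘(ℝ, E) γ v t ↔ HasDerivAt γ v t :=
  hasMFDerivAt_iff_hasFDerivAt.trans Iff.rfl

theorem const (x : M) (t : ℝ) : HasVelocity I (fun _ => x) 0 t := by
  have := hasMFDerivAt_const (I := 𝓘(ℝ, ℝ)) (I' := I) x t
  exact of_hasMFDerivAt this rfl

theorem scomp {γ : ℝ → M} {v : E} {g : ℝ → ℝ} {t c : ℝ} (h : HasVelocity I γ v (g t))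
    (hg : HasDerivAt g c t) : HasVelocity I (fun s => γ (g s)) (c • v) t := by
  have := (iff_hasDerivAt.mpr hg).comp h
  exact this

end HasVelocity

theorem MDifferentiableAt.hasVelocity {γ : ℝ → M} {t : ℝ} (h : MDifferentiableAt 𝓘(ℝ, ℝ) I γ t) :
    HasVelocity I γ (mfderiv 𝓘(ℝ, ℝ) I γ t (1 : ℝ)) t :=
  .of_hasMFDerivAt h.hasMFDerivAt rfl

/-- The derivative of a map between manifolds, as a map between the model spaces. -/
def tder (I : ModelWithCorners ℝ E HM) (I' : ModelWithCorners ℝ E' HM') (f : M → M') (x : M) :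
    E →L[ℝ] E' :=
  mfderiv I I' f x

theorem HasVelocity.map {γ : ℝ → M} {v : E} {t : ℝ} (h : HasVelocity I γ v t) {f : M → M'}
    (hf : MDifferentiableAt I I' f (γ t)) :
    HasVelocity I' (fun s => f (γ s)) (tder I I' f (γ t) v) t :=
  h.comp hf.hasMFDerivAt

/-- The velocity along the diagonal of a map of two real variables is the sum of the partial
velocities. -/
theorem HasVelocity.diag {W : ℝ × ℝ → M} {t : ℝ} (hW : MDifferentiableAt 𝓘(ℝ, ℝ × ℝ) I W (t, t))
    {v w : E} (hv : HasVelocity I (fun s => W (s, t)) v t)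
    (hw : HasVelocity I (fun s => W (t, s)) w t) :
    HasVelocity I (fun s => W (s, s)) (v + w) t := by
  have h1 : HasVelocity 𝓘(ℝ, ℝ × ℝ) (fun s : ℝ => (s, t)) (1, 0) t :=
    iff_hasDerivAt.mpr ((hasDerivAt_id t).prodMk (hasDerivAt_const t t))
  have h2 : HasVelocity 𝓘(ℝ, ℝ × ℝ) (fun s : ℝ => (t, s)) (0, 1) t :=
    iff_hasDerivAt.mpr ((hasDerivAt_const t t).prodMk (hasDerivAt_id t))
  have h3 : HasVelocity 𝓘(ℝ, ℝ × ℝ) (fun s : ℝ => (s, s)) (1, 1) t :=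
    iff_hasDerivAt.mpr ((hasDerivAt_id t).prodMk (hasDerivAt_id t))
  have k1 := hv.unique (h1.comp hW.hasMFDerivAt)
  have k2 := hw.unique (h2.comp hW.hasMFDerivAt)
  have k3 := h3.comp hW.hasMFDerivAt
  have k4 : v + w = mfderiv 𝓘(ℝ, ℝ × ℝ) I W (t, t) (1, 1) := by
    rw [k1, k2]
    have : ((1, 1) : ℝ × ℝ) = (1, 0) + (0, 1) := by simp
    rw [this]
    exact ((mfderiv 𝓘(ℝ, ℝ × ℝ) I W (t, t)).map_add _ _).symm
  rw [k4]
  exact k3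

end Velocity

/-! ### Integral curves along lines of parameters: charts and uniqueness -/

section LineCurves


variable {E : Type u} {HM : Type*} [NormedAddCommGroup E] [NormedSpace ℝ E] [TopologicalSpace HM]
  {I : ModelWithCorners ℝ E HM} {M : Type*} [TopologicalSpace M] [ChartedSpace HM M]
  {k : ℕ}

theorem isOpen_cube {J : Set ℝ} (hJ : IsOpen J) : IsOpen (cube k J) :=
  isOpen_set_pi finite_univ fun _ _ => hJ

section Charts

variable [IsManifold I ∞ M]

theorem HasVelocity.hasDerivAt_extChartAt {γ : ℝ → M} {v : E} {t : ℝ} (h : HasVelocity I γ v t)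
    {z : M} (hz : γ t ∈ (extChartAt I z).source) :
    HasDerivAt (fun s => extChartAt I z (γ s))
      (tder I 𝓘(ℝ, E) (extChartAt I z) (γ t) v) t := by
  have : IsManifold I 1 M := .of_le (n := ∞) (by simp)
  rw [extChartAt_source] at hz
  exact iff_hasDerivAt.mp (h.map (mdifferentiableAt_extChartAt hz))

theorem hasVelocity_extChartAt_symm [I.Boundaryless] {η : ℝ → E} {v w : E} {t : ℝ}
    (h : HasDerivAt η w t) {z : M} (hz : η t ∈ (extChartAt I z).target)
    (hv : tder I 𝓘(ℝ, E) (extChartAt I z) ((extChartAt I z).symm (η t)) v = w) :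
    HasVelocity I (fun s => (extChartAt I z).symm (η s)) v t := by
  have : IsManifold I 1 M := .of_le (n := ∞) (by simp)
  have h1 := mdifferentiableWithinAt_extChartAt_symm hz
  have h3 := mfderivWithin_extChartAt_symm_comp_mfderiv_extChartAt hz
  rw [I.range_eq_univ] at h1 h3
  have h2 := (HasVelocity.iff_hasDerivAt.mpr h).comp_within h1.hasMFDerivWithinAt
    (Filter.Eventually.of_forall fun _ => mem_univ _)
  have h4 := congrArg (fun L => L v) h3
  have h5 : mfderivWithin 𝓘(ℝ, E) I (extChartAt I z).symm univ (η t) w = v := by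
    rw [← hv]
    exact h4
  rw [h5] at h2
  exact h2

/-- Smoothness into the tangent bundle is tested in trivialisations; this turns the test into one on
the chart derivative. -/
theorem trivializationAt_tangent_snd {z x : M} (hx : x ∈ (extChartAt I z).source)
    (v : TangentSpace I x) :
    (trivializationAt E (TangentSpace I) z (⟨x, v⟩ : TangentBundle I M)).2 =
      tder I 𝓘(ℝ, E) (extChartAt I z) x v := by
  have : IsManifold I 1 M := .of_le (n := ∞) (by simp)
  rw [extChartAt_source] at hx
  have h1 : (trivializationAt E (TangentSpace I) z (⟨x, v⟩ : TangentBundle I M)).2 =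
      (trivializationAt E (TangentSpace I) z).continuousLinearMapAt ℝ x v :=
    (congrFun ((trivializationAt E (TangentSpace I) z).coe_linearMapAt_of_mem
      (R := ℝ) (b := x) hx) v).symm
  exact h1.trans (congrArg (fun L : TangentSpace I x →L[ℝ] E => L v)
    (TangentBundle.continuousLinearMapAt_trivializationAt hx))

/-- Smoothness of a vector field along a map, in a chart. -/
theorem contMDiffAt_tangent_iff {EX HX X : Type*} [NormedAddCommGroup EX] [NormedSpace ℝ EX]
    [TopologicalSpace HX] {IX : ModelWithCorners ℝ EX HX} [TopologicalSpace X] [ChartedSpace HX X]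
    {f : X → M} {V : X → E} {x₀ : X} {z : M}
    (hz : f x₀ ∈ (extChartAt I z).source) :
    ContMDiffAt IX I.tangent ∞ (fun x => (⟨f x, V x⟩ : TangentBundle I M)) x₀ ↔
      ContMDiffAt IX I ∞ f x₀ ∧ ContMDiffAt IX 𝓘(ℝ, E) ∞
        (fun x => tder I 𝓘(ℝ, E) (extChartAt I z) (f x) (V x)) x₀ := by
  have hz' : f x₀ ∈ (chartAt HM z).source := by rwa [extChartAt_source] at hz
  rw [ModelWithCorners.tangent, (trivializationAt E (TangentSpace I) z).contMDiffAt_iff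
    (f := fun x => (⟨f x, V x⟩ : TangentBundle I M))
    ((trivializationAt E (TangentSpace I) z).mem_source.mpr hz')]
  refine and_congr_right fun hf => ?_
  have hev : ∀ᶠ x in 𝓝 x₀, f x ∈ (extChartAt I z).source :=
    hf.continuousAt.preimage_mem_nhds ((isOpen_extChartAt_source z).mem_nhds hz)
  refine Filter.EventuallyEq.contMDiffAt_iff ?_
  filter_upwards [hev] with x hx
  exact trivializationAt_tangent_snd hx (V x)

/-- A family of vector fields read in the chart at `z`. -/
def chartFields (Y : Fin k → (Fin k → ℝ) → M → E) (z : M) :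
    (Fin k → ℝ) × E → Fin k → E :=
  fun p i => tder I 𝓘(ℝ, E) (extChartAt I z) ((extChartAt I z).symm p.2)
    (Y i p.1 ((extChartAt I z).symm p.2))

theorem contDiffAt_chartFields [I.Boundaryless] {J : Set ℝ} (hJ : IsOpen J)
    {Y : Fin k → (Fin k → ℝ) → M → E}
    (hY : ∀ i, SmoothVectorFields I J (Y i)) (z : M) {ε : Fin k → ℝ} (hε : ε ∈ cube k J) {e : E}
    (he : e ∈ (extChartAt I z).target) : ContDiffAt ℝ ∞ (chartFields (I := I) Y z) (ε, e) := by
  rw [contDiffAt_pi]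
  intro i
  have h1 : ContMDiffAt (I.prod 𝓘(ℝ, Fin k → ℝ)) I.tangent ∞
      (fun p : M × (Fin k → ℝ) => (⟨p.1, Y i p.2 p.1⟩ : TangentBundle I M))
      ((extChartAt I z).symm e, ε) :=
    (hY i).contMDiffAt ((isOpen_univ.prod (isOpen_cube hJ)).mem_nhds ⟨mem_univ _, hε⟩)
  have he' := (extChartAt I z).map_target he
  have h2 := ((contMDiffAt_tangent_iff (f := fun p : M × (Fin k → ℝ) => p.1) (z := z) he').mp h1).2
  have h3 : ContMDiffAt 𝓘(ℝ, (Fin k → ℝ) × E) (I.prod 𝓘(ℝ, Fin k → ℝ)) ∞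
      (fun p : (Fin k → ℝ) × E => ((extChartAt I z).symm p.2, p.1)) (ε, e) := by
    refine ContMDiffAt.prodMk ?_ contDiff_fst.contMDiff.contMDiffAt
    have h4 : ContMDiffAt 𝓘(ℝ, E) I ∞ (extChartAt I z).symm e :=
      (contMDiffOn_extChartAt_symm z).contMDiffAt
        ((isOpen_extChartAt_target z).mem_nhds he)
    exact ContMDiffAt.comp (ε, e) (f := fun p : (Fin k → ℝ) × E => p.2) h4
      contDiff_snd.contMDiff.contMDiffAt
  exact (ContMDiffAt.comp (ε, e) h2 h3).contDiffAt

/-- The time-dependent vector field `∑ i, v i • Y i (ε + t v)`. -/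
def lineField (Y : Fin k → (Fin k → ℝ) → M → E) (ε v : Fin k → ℝ) (t : ℝ)
    (x : M) : E :=
  ∑ i, v i • Y i (ε + t • v) x

/-- `γ` is a solution on `timeIoo` of the equation `γ' = ∑ i, v i • Y i (ε + t v)`. -/
def IsLineCurve (I : ModelWithCorners ℝ E HM) (Y : Fin k → (Fin k → ℝ) → M → E) (ε v : Fin k → ℝ)
    (γ : ℝ → M) : Prop :=
  ∀ t ∈ timeIoo, HasVelocity I γ (lineField Y ε v t (γ t)) t

omit [IsManifold I ∞ M] in
theorem tder_extChartAt_lineField (Y : Fin k → (Fin k → ℝ) → M → E)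
    (ε v : Fin k → ℝ) (t : ℝ) {z x : M} (hx : x ∈ (extChartAt I z).source) :
    tder I 𝓘(ℝ, E) (extChartAt I z) x (lineField Y ε v t x) =
      ∑ i, v i • chartFields (I := I) Y z (ε + t • v, extChartAt I z x) i := by
  have h1 : ∀ i, chartFields (I := I) Y z (ε + t • v, extChartAt I z x) i =
      tder I 𝓘(ℝ, E) (extChartAt I z) x (Y i (ε + t • v) x) := by
    intro i
    simp only [chartFields, (extChartAt I z).left_inv hx]
  simp only [h1, lineField, map_sum, map_smul]

/-- In a chart both curves solve one ordinary differential equation with a C¹ right-hand side, which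
is locally Lipschitz. -/
theorem IsLineCurve.eventuallyEq [I.Boundaryless] {J : Set ℝ} (hJ : IsOpen J)
    {Y : Fin k → (Fin k → ℝ) → M → E}
    (hY : ∀ i, SmoothVectorFields I J (Y i)) {ε v : Fin k → ℝ} {γ γ' : ℝ → M}
    (hγ : IsLineCurve I Y ε v γ) (hγ' : IsLineCurve I Y ε v γ') {t₀ : ℝ} (ht₀ : t₀ ∈ timeIoo)
    (hε : ε + t₀ • v ∈ cube k J) (h : γ t₀ = γ' t₀) : γ =ᶠ[𝓝 t₀] γ' := by
  set z := γ t₀ with hz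
  have hzs : z ∈ (extChartAt I z).source := mem_extChartAt_source z
  let f := chartFields (I := I) Y z
  have hf : ContDiffAt ℝ ∞ f (ε + t₀ • v, extChartAt I z z) :=
    contDiffAt_chartFields hJ hY z hε (mem_extChartAt_target z)
  let g : ℝ × E → E := fun p => ∑ i, v i • f (ε + p.1 • v, p.2) i
  have hg : ContDiffAt ℝ 1 g (t₀, extChartAt I z z) := by
    have h1 : ContDiffAt ℝ 1 (fun p : ℝ × E => f (ε + p.1 • v, p.2)) (t₀, extChartAt I z z) :=
      ContDiffAt.comp (t₀, extChartAt I z z) (hf.of_le (by simp))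
        ((contDiffAt_const.add (contDiffAt_fst.smul contDiffAt_const)).prodMk contDiffAt_snd)
    exact ContDiffAt.sum fun i _ => contDiffAt_const.smul (contDiffAt_pi.mp h1 i)
  obtain ⟨K, s, hs, hlip⟩ := hg.exists_lipschitzOnWith
  obtain ⟨A, hA, B, hB, hAB⟩ := mem_nhds_prod_iff.mp hs
  -- The joint Lipschitz constant in (t, e) serves all times near t₀.
  have hlip' : ∀ᶠ t in 𝓝 t₀, LipschitzOnWith K (fun e => g (t, e)) B := by
    filter_upwards [hA] with t ht
    intro e he e' he'
    have := hlip (x := (t, e)) (hAB ⟨ht, he⟩) (y := (t, e')) (hAB ⟨ht, he'⟩)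
    simpa [Prod.edist_eq] using this
  have key : ∀ {c : ℝ → M}, IsLineCurve I Y ε v c → c t₀ = z →
      ∀ᶠ t in 𝓝 t₀, (HasDerivAt (fun s => extChartAt I z (c s)) (g (t, extChartAt I z (c t))) t ∧
        extChartAt I z (c t) ∈ B) ∧ c t ∈ (extChartAt I z).source := by
    intro c hc hcz
    have hcont : ContinuousAt c t₀ := (hc t₀ ht₀).continuousAt
    have h1 : ∀ᶠ t in 𝓝 t₀, c t ∈ (extChartAt I z).source :=
      hcont.preimage_mem_nhds ((isOpen_extChartAt_source z).mem_nhds (by rw [hcz]; exact hzs))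
    have h2 : ∀ᶠ t in 𝓝 t₀, extChartAt I z (c t) ∈ B := by
      have : ContinuousAt (fun t => extChartAt I z (c t)) t₀ := by
        refine ContinuousAt.comp' ?_ hcont
        rw [hcz]
        exact continuousAt_extChartAt z
      exact this.preimage_mem_nhds (by rw [hcz]; exact hB)
    filter_upwards [h1, h2, isOpen_Ioo.mem_nhds ht₀] with t ht1 ht2 ht3
    refine ⟨⟨?_, ht2⟩, ht1⟩
    have := (hc t ht3).hasDerivAt_extChartAt ht1
    rw [tder_extChartAt_lineField Y ε v t ht1] at this
    exact this
  have e1 := key hγ rfl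
  have e2 := key hγ' h.symm
  have := ODE_solution_unique_of_eventually (v := fun t e => g (t, e)) (s := fun _ => B) hlip'
    (e1.mono fun _ h => h.1) (e2.mono fun _ h => h.1)
    (show extChartAt I z (γ t₀) = extChartAt I z (γ' t₀) by rw [← h])
  filter_upwards [this, e1, e2] with t ht h1 h2
  exact (extChartAt I z).injOn h1.2 h2.2 ht

/-- Uniqueness of solutions, provided that the set of times where they agree is closed. -/
theorem IsLineCurve.eqOn_of_isClosed [I.Boundaryless] {J : Set ℝ} (hJ : IsOpen J)
    {Y : Fin k → (Fin k → ℝ) → M → E}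
    (hY : ∀ i, SmoothVectorFields I J (Y i)) {ε v : Fin k → ℝ} {γ γ' : ℝ → M}
    (hγ : IsLineCurve I Y ε v γ) (hγ' : IsLineCurve I Y ε v γ')
    (hε : ∀ t ∈ timeIoo, ε + t • v ∈ cube k J) (h : γ 0 = γ' 0)
    (hcl : ∀ t ∈ timeIoo, (∃ᶠ s in 𝓝 t, γ s = γ' s) → γ t = γ' t) :
    EqOn γ γ' timeIoo := by
  have h0 : (0 : ℝ) ∈ timeIoo := by constructor <;> norm_num
  -- The set of agreement is open by local uniqueness and relatively closed by `hcl`, and the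
  -- interval is connected.
  have hsub : timeIoo ⊆ {t | t ∈ timeIoo ∧ γ t = γ' t} := by
    refine isPreconnected_Ioo.subset_of_closure_inter_subset ?_ ⟨0, h0, h0, h⟩ ?_
    · rw [isOpen_iff_mem_nhds]
      rintro t ⟨ht, hteq⟩
      filter_upwards [isOpen_Ioo.mem_nhds ht,
        hγ.eventuallyEq hJ hY hγ' ht (hε t ht) hteq] with s h1 h2
      exact ⟨h1, h2⟩
    · rintro t ⟨ht, htI⟩
      exact ⟨htI, hcl t htI ((mem_closure_iff_frequently.mp ht).mono fun _ h => h.2)⟩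
  exact fun t ht => (hsub ht).2

omit [IsManifold I ∞ M] in
theorem IsLineCurve.continuousAt {Y : Fin k → (Fin k → ℝ) → M → E}
    {ε v : Fin k → ℝ} {γ : ℝ → M} (hγ : IsLineCurve I Y ε v γ) {t : ℝ} (ht : t ∈ timeIoo) :
    ContinuousAt γ t :=
  (hγ t ht).continuousAt

/-- In a Hausdorff space curves that differ at t differ near t. The previous version keeps this as a
hypothesis so as to cover the arrow space of 𝓖. -/
theorem IsLineCurve.eqOn [T2Space M] [I.Boundaryless] {J : Set ℝ} (hJ : IsOpen J)
    {Y : Fin k → (Fin k → ℝ) → M → E}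
    (hY : ∀ i, SmoothVectorFields I J (Y i)) {ε v : Fin k → ℝ} {γ γ' : ℝ → M}
    (hγ : IsLineCurve I Y ε v γ) (hγ' : IsLineCurve I Y ε v γ')
    (hε : ∀ t ∈ timeIoo, ε + t • v ∈ cube k J) (h : γ 0 = γ' 0) :
    EqOn γ γ' timeIoo := by
  refine hγ.eqOn_of_isClosed hJ hY hγ' hε h fun t ht hfr => ?_
  by_contra hne
  exact hfr (((hγ.continuousAt ht).ne_iff_eventually_ne (hγ'.continuousAt ht)).mp hne)

end Charts

end LineCurves

/-! ### Existence and smoothness of flows along small lines of parameters -/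

section LineFlow


variable {E : Type u} {HM : Type*} [NormedAddCommGroup E] [NormedSpace ℝ E] [FiniteDimensional ℝ E]
  [TopologicalSpace HM]
  {I : ModelWithCorners ℝ E HM} [I.Boundaryless] {M : Type*} [TopologicalSpace M]
  [ChartedSpace HM M] [IsManifold I ∞ M]
  {k : ℕ}

/-- The tube lemma for the compact interval `timeIcc`: short lines near 0 stay in U for all its
times. -/
theorem eventually_forall_line_mem {U : Set (Fin k → ℝ)} (hU : U ∈ 𝓝 0) :
    ∀ᶠ q : (Fin k → ℝ) × (Fin k → ℝ) in 𝓝 0, ∀ t ∈ timeIcc, q.1 + t • q.2 ∈ U := by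
  refine isCompact_Icc.eventually_forall_of_forall_eventually fun t _ => ?_
  have : ContinuousAt (fun p : ((Fin k → ℝ) × (Fin k → ℝ)) × ℝ => p.1.1 + p.2 • p.1.2) (0, t) := by
    fun_prop
  refine this.preimage_mem_nhds ?_
  simpa using hU

/-- Multiplication by a bump function makes a locally smooth function smooth. -/
theorem exists_contDiff_eq_near {D F : Type*} [NormedAddCommGroup D] [NormedSpace ℝ D]
    [FiniteDimensional ℝ D] [NormedAddCommGroup F] [NormedSpace ℝ F] {f : D → F} {U : Set D}
    (hU : IsOpen U) (hf : ∀ x ∈ U, ContDiffAt ℝ ∞ f x) {x₀ : D} (hx₀ : x₀ ∈ U) :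
    ∃ g : D → F, ContDiff ℝ ∞ g ∧ ∃ r > 0, Metric.ball x₀ r ⊆ U ∧
      ∀ x ∈ Metric.ball x₀ r, g x = f x := by
  obtain ⟨R, hR, hRU⟩ := Metric.nhds_basis_closedBall.mem_iff.mp (hU.mem_nhds hx₀)
  let χ : ContDiffBump x₀ := ⟨R / 2, R, by positivity, by linarith⟩
  refine ⟨fun x => χ x • f x, ?_, R / 2, by positivity, ?_, fun x hx => ?_⟩
  · rw [contDiff_iff_contDiffAt]
    intro x
    by_cases hx : x ∈ U
    · exact χ.contDiffAt.smul (hf x hx)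
    · have hx' : x ∉ tsupport χ := by
        rw [χ.tsupport_eq]
        exact fun h => hx (hRU h)
      refine contDiffAt_const (c := (0 : F)) |>.congr_of_eventuallyEq ?_
      filter_upwards [notMem_tsupport_iff_eventuallyEq.mp hx'] with y hy
      simp [hy]
  · exact (Metric.ball_subset_closedBall.trans
      (Metric.closedBall_subset_closedBall (by linarith))).trans hRU
  · simp [χ.one_of_mem_closedBall (Metric.ball_subset_closedBall hx)]

/-- Local existence and smooth dependence on initial values and parameters. -/
theorem exists_local_lineFlow {J : Set ℝ} (hJ : IsOpen J) (h0 : (0 : ℝ) ∈ J)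
    {Y : Fin k → (Fin k → ℝ) → M → E} (hY : ∀ i, SmoothVectorFields I J (Y i)) (z : M) :
    ∃ T : M × ((Fin k → ℝ) × (Fin k → ℝ)) → ℝ → M,
      ∀ᶠ q in 𝓝 (z, (0 : (Fin k → ℝ) × (Fin k → ℝ))), T q 0 = q.1 ∧
        IsLineCurve I Y q.2.1 q.2.2 (T q) ∧
        ∀ t, ContMDiffAt (I.prod 𝓘(ℝ, (Fin k → ℝ) × (Fin k → ℝ))) I ∞ (fun p => T p t) q := by
  let φ := extChartAt I z
  have hcube0 : (0 : Fin k → ℝ) ∈ cube k J := fun _ _ => h0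
  -- The fields in the chart are replaced by globally smooth ones. The solutions stay in the ball
  -- where nothing was changed, hence solve the original equation.
  obtain ⟨f, hf, r, hr, hball, hfr⟩ := exists_contDiff_eq_near (f := chartFields (I := I) Y z)
    (U := cube k J ×ˢ φ.target) ((isOpen_cube hJ).prod (isOpen_extChartAt_target z))
    (fun p hp => contDiffAt_chartFields hJ hY z hp.1 hp.2) (x₀ := (0, φ z))
    ⟨hcube0, mem_extChartAt_target z⟩
  obtain ⟨γ, hγ1, hγ2⟩ := exists_smooth_lineODE_solution f hf (φ z) 0
  let c : M × ((Fin k → ℝ) × (Fin k → ℝ)) → E × (Fin k → ℝ) × (Fin k → ℝ) := fun q => (φ q.1, q.2)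
  have hc : Filter.Tendsto c (𝓝 (z, 0)) (𝓝 (φ z, 0, 0)) := by
    have h1 : ContinuousAt c (z, 0) :=
      ((continuousAt_extChartAt (I := I) z).comp' continuousAt_fst).prodMk continuousAt_snd
    exact h1
  refine ⟨fun q t => φ.symm (γ (c q) t), ?_⟩
  have e1 := hc.eventually (hγ1 _ (Metric.ball_mem_nhds (φ z) hr))
  have e2 := hc.eventually hγ2
  have e3 : ∀ᶠ q : M × ((Fin k → ℝ) × (Fin k → ℝ)) in 𝓝 (z, 0), ∀ t ∈ timeIcc,
      q.2.1 + t • q.2.2 ∈ Metric.ball (0 : Fin k → ℝ) r := by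
    rw [nhds_prod_eq]
    exact (eventually_forall_line_mem (Metric.ball_mem_nhds _ hr)).prod_inr _
  have e4 : ∀ᶠ q : M × ((Fin k → ℝ) × (Fin k → ℝ)) in 𝓝 (z, 0), q.1 ∈ φ.source := by
    rw [nhds_prod_eq]
    exact Filter.Eventually.prod_inl (extChartAt_source_mem_nhds z) _
  have htar : ∀ e ∈ Metric.ball (φ z) r, e ∈ φ.target := by
    intro e he
    exact (hball (show ((0 : Fin k → ℝ), e) ∈ _ by
      rw [← ball_prod_same]; exact ⟨Metric.mem_ball_self hr, he⟩)).2
  filter_upwards [e1, e2, e3, e4] with q h1 h2 h3 h4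
  refine ⟨?_, fun t ht => ?_, fun t => ?_⟩
  · show φ.symm (γ (c q) 0) = q.1
    rw [h2.1]
    exact φ.left_inv h4
  · refine hasVelocity_extChartAt_symm (h2.2.2 t ht) (htar _ (h1 t)) ?_
    rw [tder_extChartAt_lineField Y _ _ t (φ.map_target (htar _ (h1 t)))]
    refine Finset.sum_congr rfl fun i _ => ?_
    rw [φ.right_inv (htar _ (h1 t)), hfr]
    rw [← ball_prod_same]
    exact ⟨h3 t (Ioo_subset_Icc_self ht), h1 t⟩
  · have k1 : ContMDiffAt (I.prod 𝓘(ℝ, (Fin k → ℝ) × (Fin k → ℝ)))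
        𝓘(ℝ, E × (Fin k → ℝ) × (Fin k → ℝ)) ∞ c q := by
      refine ContMDiffAt.prodMk_space ?_ contMDiffAt_snd
      exact ((contMDiffOn_extChartAt (x := z)).contMDiffAt
        ((chartAt HM z).open_source.mem_nhds (by rwa [← extChartAt_source (I := I)]))).comp q
        contMDiffAt_fst
    have k2 : ContMDiffAt 𝓘(ℝ, E × (Fin k → ℝ) × (Fin k → ℝ)) 𝓘(ℝ, E) ∞ (fun p => γ p t) (c q) :=
      (h2.2.1 t).contMDiffAt
    have k3 : ContMDiffAt 𝓘(ℝ, E) I ∞ φ.symm (γ (c q) t) :=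
      (contMDiffOn_extChartAt_symm z).contMDiffAt
        ((isOpen_extChartAt_target z).mem_nhds (htar _ (h1 t)))
    exact k3.comp q (f := fun p => γ (c p) t) (k2.comp q k1)

/-- Existence, on a fixed time interval and for small parameters, of all solutions with initial
values in the image of `ι`, and their smooth dependence on all data, if the vector fields vanish at
the initial values outside of a compact set. -/
theorem exists_lineFlow {EX HX X : Type*} [NormedAddCommGroup EX] [NormedSpace ℝ EX]
    [TopologicalSpace HX] {IX : ModelWithCorners ℝ EX HX} [TopologicalSpace X] [ChartedSpace HX X]
    {J : Set ℝ} (hJ : IsOpen J) (h0 : (0 : ℝ) ∈ J)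
    {Y : Fin k → (Fin k → ℝ) → M → E} (hY : ∀ i, SmoothVectorFields I J (Y i))
    {ι : X → M} (hι : ContMDiff IX I ∞ ι) {C : Set X} (hC : IsCompact C) (hC' : IsClosed C)
    (hvan : ∀ i, ∀ ε ∈ cube k J, ∀ x ∉ C, Y i ε (ι x) = 0)
    (huniq : ∀ x, ∀ ε v : Fin k → ℝ, (∀ t ∈ timeIoo, ε + t • v ∈ cube k J) → ∀ γ γ' : ℝ → M,
      IsLineCurve I Y ε v γ → IsLineCurve I Y ε v γ' → γ 0 = ι x → γ' 0 = ι x →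
        EqOn γ γ' timeIoo) :
    ∃ r > 0, ∃ T : X × ((Fin k → ℝ) × (Fin k → ℝ)) → ℝ → M,
      ∀ q ∈ Metric.ball (0 : (Fin k → ℝ) × (Fin k → ℝ)) r,
        (∀ t ∈ timeIoo, q.1 + t • q.2 ∈ cube k J) ∧
        ∀ x, T (x, q) 0 = ι x ∧ IsLineCurve I Y q.1 q.2 (T (x, q)) ∧
          ∀ t ∈ timeIoo, ContMDiffAt (IX.prod 𝓘(ℝ, (Fin k → ℝ) × (Fin k → ℝ))) I ∞
            (fun p => T p t) (x, q) := by
  let P := (Fin k → ℝ) × (Fin k → ℝ)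
  -- A smooth family of solutions exists near (x, q). Near C this holds for all q in one
  -- neighbourhood of 0, by compactness.
  let Good : X → P → Prop := fun x q => ∃ T : X × P → ℝ → M, ∀ᶠ p in 𝓝 (x, q),
    T p 0 = ι p.1 ∧ IsLineCurve I Y p.2.1 p.2.2 (T p) ∧
      ∀ t, ContMDiffAt (IX.prod 𝓘(ℝ, P)) I ∞ (fun p => T p t) p
  have hline : ∀ᶠ q : P in 𝓝 0, ∀ t ∈ timeIcc, q.1 + t • q.2 ∈ cube k J :=
    eventually_forall_line_mem ((isOpen_cube hJ).mem_nhds fun _ _ => h0)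
  have hgoodC : ∀ᶠ q in 𝓝 (0 : P), ∀ x ∈ C, Good x q := by
    refine hC.eventually_forall_of_forall_eventually fun x _ => ?_
    obtain ⟨T, hT⟩ := exists_local_lineFlow hJ h0 hY (ι x)
    have hcont : Filter.Tendsto (fun p : X × P => (ι p.1, p.2)) (𝓝 (x, 0)) (𝓝 (ι x, 0)) := by
      have : ContinuousAt (fun p : X × P => (ι p.1, p.2)) (x, 0) :=
        (hι.continuous.continuousAt.comp' continuousAt_fst).prodMk continuousAt_snd
      exact this
    have h1 : ∀ᶠ p in 𝓝 (x, (0 : P)), Good p.1 p.2 := by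
      filter_upwards [(hcont.eventually hT).eventually_nhds] with p hp
      refine ⟨fun p' => T (ι p'.1, p'.2), ?_⟩
      filter_upwards [hp] with p' hp'
      refine ⟨hp'.1, hp'.2.1, fun t => ?_⟩
      have h2 : ContMDiffAt (IX.prod 𝓘(ℝ, P)) (I.prod 𝓘(ℝ, P)) ∞
          (fun p : X × P => (ι p.1, p.2)) p' :=
        (hι.contMDiffAt.comp p' contMDiffAt_fst).prodMk contMDiffAt_snd
      exact (hp'.2.2 t).comp p' h2
    have hswap : Filter.Tendsto (Prod.swap : P × X → X × P) (𝓝 (0, x)) (𝓝 (x, 0)) :=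
      continuous_swap.tendsto _
    exact hswap.eventually h1
  obtain ⟨r, hr, hball⟩ := Metric.eventually_nhds_iff_ball.mp (hline.and hgoodC)
  have hgood : ∀ q ∈ Metric.ball (0 : P) r, ∀ x, Good x q := by
    intro q hq x
    by_cases hx : x ∈ C
    · exact (hball q hq).2 x hx
    -- Off C the fields vanish at the initial values, so constant curves are solutions.
    · refine ⟨fun p _ => ι p.1, ?_⟩
      have h1 : ∀ᶠ p : X × P in 𝓝 (x, q), p.1 ∉ C ∧ p.2 ∈ Metric.ball (0 : P) r := by
        rw [nhds_prod_eq]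
        exact Filter.Eventually.prod_mk (hC'.isOpen_compl.mem_nhds hx)
          (Metric.isOpen_ball.mem_nhds hq)
      filter_upwards [h1] with p hp
      refine ⟨rfl, fun t ht => ?_, fun t => hι.contMDiffAt.comp p contMDiffAt_fst⟩
      have : lineField Y p.2.1 p.2.2 t (ι p.1) = 0 := by
        refine Finset.sum_eq_zero fun i _ => ?_
        rw [hvan i _ ((hball _ hp.2).1 t (Ioo_subset_Icc_self ht)) _ hp.1, smul_zero]
      rw [this]
      exact HasVelocity.const _ _
  have hgood' : ∀ q x, ∃ T : X × P → ℝ → M, q ∈ Metric.ball (0 : P) r → ∀ᶠ p in 𝓝 (x, q),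
      T p 0 = ι p.1 ∧ IsLineCurve I Y p.2.1 p.2.2 (T p) ∧
        ∀ t, ContMDiffAt (IX.prod 𝓘(ℝ, P)) I ∞ (fun p => T p t) p := by
    intro q x
    by_cases hq : q ∈ Metric.ball (0 : P) r
    · exact (hgood q hq x).imp fun T h _ => h
    · exact ⟨fun p _ => ι p.1, fun h => absurd h hq⟩
  choose T hT using hgood'
  -- Each point is assigned the solution of its own local family. Uniqueness shows that this agrees
  -- near (x, q) with the single family chosen at (x, q), which is smooth.
  refine ⟨r, hr, fun p => T p.2 p.1 p, fun q hq => ⟨fun t ht =>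
    (hball q hq).1 t (Ioo_subset_Icc_self ht), fun x => ?_⟩⟩
  refine ⟨(hT q x hq).self_of_nhds.1, (hT q x hq).self_of_nhds.2.1, fun t ht => ?_⟩
  refine ((hT q x hq).self_of_nhds.2.2 t).congr_of_eventuallyEq ?_
  have hq' : ∀ᶠ p : X × P in 𝓝 (x, q), p.2 ∈ Metric.ball (0 : P) r := by
    rw [nhds_prod_eq]
    exact Filter.Eventually.prod_inr (Metric.isOpen_ball.mem_nhds hq) _
  filter_upwards [hT q x hq, hq'] with p hp hpq
  have hp' := (hT p.2 p.1 hpq).self_of_nhds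
  exact huniq p.1 p.2.1 p.2.2 (fun t ht => (hball _ hpq).1 t (Ioo_subset_Icc_self ht)) _ _
    hp'.2.1 hp.2.1 hp'.1 hp.1 ht

end LineFlow

/-! ### The inverse function theorem with parameters on manifolds -/

section InverseFunction

variable {E HM : Type*} [NormedAddCommGroup E] [NormedSpace ℝ E] [TopologicalSpace HM]
  {I : ModelWithCorners ℝ E HM} {M : Type*} [TopologicalSpace M] [ChartedSpace HM M]
  {E' HM' : Type*} [NormedAddCommGroup E'] [NormedSpace ℝ E'] [TopologicalSpace HM']
  {I' : ModelWithCorners ℝ E' HM'} {M' : Type*} [TopologicalSpace M'] [ChartedSpace HM' M']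
  {E'' HM'' : Type*} [NormedAddCommGroup E''] [NormedSpace ℝ E''] [TopologicalSpace HM'']
  {I'' : ModelWithCorners ℝ E'' HM''} {M'' : Type*} [TopologicalSpace M''] [ChartedSpace HM'' M'']
  {P : Type*} [NormedAddCommGroup P] [NormedSpace ℝ P]

theorem tder_comp {g : M' → M''} {f : M → M'} {x : M} (hg : MDifferentiableAt I' I'' g (f x))
    (hf : MDifferentiableAt I I' f x) :
    tder I I'' (fun x => g (f x)) x = (tder I' I'' g (f x)).comp (tder I I' f x) :=
  mfderiv_comp x hg hf

theorem tder_congr {f g : M → M'} {x : M} (h : f =ᶠ[𝓝 x] g) : tder I I' f x = tder I I' g x :=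
  h.mfderiv_eq

theorem tder_id (x : M) : tder I I (fun x : M => x) x = ContinuousLinearMap.id ℝ E :=
  mfderiv_id

theorem ContMDiffAt.slice_left {X : Type*} [TopologicalSpace X] [ChartedSpace HM X]
    {f : X × P → M'} {x : X} {p : P} {n : WithTop ℕ∞}
    (h : ContMDiffAt (I.prod 𝓘(ℝ, P)) I' n f (x, p)) :
    ContMDiffAt I I' n (fun x => f (x, p)) x :=
  h.comp x (contMDiffAt_id.prodMk contMDiffAt_const)

theorem ContMDiffAt.slice_right {X : Type*} [TopologicalSpace X] [ChartedSpace HM X]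
    {f : X × P → M'} {x : X} {p : P} {n : WithTop ℕ∞}
    (h : ContMDiffAt (I.prod 𝓘(ℝ, P)) I' n f (x, p)) :
    ContMDiffAt 𝓘(ℝ, P) I' n (fun p => f (x, p)) p :=
  h.comp p (contMDiffAt_const.prodMk contMDiffAt_id)

variable [I.Boundaryless] [IsManifold I ∞ M]

/-- The inverse function theorem with parameters. -/
theorem exists_local_inverse_family [CompleteSpace E] [CompleteSpace P] {ρ : M × P → M} {x₀ : M}
    {p₀ : P} (hρ : ∀ᶠ q in 𝓝 (x₀, p₀), ContMDiffAt (I.prod 𝓘(ℝ, P)) I ∞ ρ q)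
    (hbij : Function.Bijective (tder I I (fun x => ρ (x, p₀)) x₀)) :
    ∃ κ : M × P → M, κ (ρ (x₀, p₀), p₀) = x₀ ∧
      (∀ᶠ q in 𝓝 (ρ (x₀, p₀), p₀), ContMDiffAt (I.prod 𝓘(ℝ, P)) I ∞ κ q) ∧
      (∀ᶠ q in 𝓝 (ρ (x₀, p₀), p₀), ρ (κ q, q.2) = q.1) ∧
      ∀ᶠ q in 𝓝 (x₀, p₀), κ (ρ q, q.2) = q.1 := by
  set y₀ := ρ (x₀, p₀) with hy₀
  let φ := extChartAt I x₀
  let χ := extChartAt I y₀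
  have hφ0 : φ.symm (φ x₀) = x₀ := φ.left_inv (mem_extChartAt_source x₀)
  -- In charts, the equation ρ(x, p) = y with (y, p) as parameters and x as unknown.
  let F : (E × P) × E → E := fun v => χ (ρ (φ.symm v.2, v.1.2)) - v.1.1
  let u : (E × P) × E := ((χ y₀, p₀), φ x₀)
  have hcont : ContinuousAt ρ (x₀, p₀) := hρ.self_of_nhds.continuousAt
  have hcs : ContinuousAt φ.symm (φ x₀) := continuousAt_extChartAt_symm x₀
  have hpt : Filter.Tendsto (fun v : (E × P) × E => (φ.symm v.2, v.1.2)) (𝓝 u) (𝓝 (x₀, p₀)) := by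
    have : ContinuousAt (fun v : (E × P) × E => (φ.symm v.2, v.1.2)) u := by
      refine ContinuousAt.prodMk ?_ (by fun_prop)
      exact ContinuousAt.comp' (f := fun v : (E × P) × E => v.2) (x := u) hcs continuousAt_snd
    rw [ContinuousAt] at this
    simpa only [u, hφ0] using this
  have hsrc : ∀ᶠ v in 𝓝 (x₀, p₀), ρ v ∈ χ.source :=
    hcont.preimage_mem_nhds (extChartAt_source_mem_nhds y₀)
  have htar : ∀ᶠ v : (E × P) × E in 𝓝 u, v.2 ∈ φ.target :=
    continuousAt_snd.preimage_mem_nhds (extChartAt_target_mem_nhds x₀)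
  have hFs : ∀ᶠ v in 𝓝 u, ContDiffAt ℝ ∞ F v := by
    filter_upwards [hpt.eventually hρ, hpt.eventually hsrc, htar] with v h1 h2 h3
    have k1 : ContMDiffAt 𝓘(ℝ, (E × P) × E) (I.prod 𝓘(ℝ, P)) ∞
        (fun v : (E × P) × E => (φ.symm v.2, v.1.2)) v := by
      refine ContMDiffAt.prodMk ?_ (contDiff_snd.comp contDiff_fst).contMDiff.contMDiffAt
      have h4 : ContMDiffAt 𝓘(ℝ, E) I ∞ φ.symm v.2 :=
        (contMDiffOn_extChartAt_symm x₀).contMDiffAt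
          ((isOpen_extChartAt_target x₀).mem_nhds h3)
      exact ContMDiffAt.comp v (f := fun p : (E × P) × E => p.2) h4
        contDiff_snd.contMDiff.contMDiffAt
    have k2 : ContMDiffAt I 𝓘(ℝ, E) ∞ χ (ρ (φ.symm v.2, v.1.2)) :=
      contMDiffOn_extChartAt.contMDiffAt
        ((chartAt HM y₀).open_source.mem_nhds (by rwa [← extChartAt_source (I := I)]))
    have k3 := (k2.comp v (h1.comp v k1)).contDiffAt
    exact k3.sub (contDiff_fst.comp contDiff_fst).contDiffAt
  have hFu : F u = 0 := by
    simp only [F, u, hφ0, ← hy₀, sub_self]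
  -- The charts used are the preferred ones at x₀ and y₀, in which `mfderiv` is defined, so no
  -- coordinate change appears.
  have hder : fderiv ℝ F u ∘L .inr ℝ (E × P) E = tder I I (fun x => ρ (x, p₀)) x₀ := by
    have h1 : HasFDerivAt F (fderiv ℝ F u) u :=
      (hFs.self_of_nhds.differentiableAt (by simp)).hasFDerivAt
    have h2 : HasFDerivAt (fun e : E => (u.1, e)) (.inr ℝ (E × P) E) u.2 :=
      hasFDerivAt_prodMk_right _ _
    have h3 : HasFDerivAt (fun e : E => F (u.1, e)) (fderiv ℝ F u ∘L .inr ℝ (E × P) E) u.2 :=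
      HasFDerivAt.comp u.2 h1 h2
    have h4 : MDifferentiableAt I I (fun x => ρ (x, p₀)) x₀ :=
      (hρ.self_of_nhds.slice_left).mdifferentiableAt (by simp)
    have h5 : HasFDerivWithinAt (writtenInExtChartAt I I x₀ fun x => ρ (x, p₀))
        (tder I I (fun x => ρ (x, p₀)) x₀) (range I) (φ x₀) := h4.hasMFDerivAt.2
    rw [I.range_eq_univ, hasFDerivWithinAt_univ] at h5
    have h6 := h5.sub_const (χ y₀)
    exact h3.unique h6
  have hinv : (fderiv ℝ F u ∘L .inr ℝ (E × P) E).IsInvertible := by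
    rw [hder]
    exact ⟨ContinuousLinearEquiv.ofBijective _ (LinearMap.ker_eq_bot.mpr hbij.1)
      (LinearMap.range_eq_top.mpr hbij.2), by ext; rfl⟩
  obtain ⟨ψ, hψ0, hψ1, hψ2, hψ3⟩ := exists_implicit_smooth hFs hinv
  have hch : Filter.Tendsto (fun q : M × P => (χ q.1, q.2)) (𝓝 (y₀, p₀)) (𝓝 u.1) := by
    have h1 : ContinuousAt χ y₀ := continuousAt_extChartAt y₀
    have h2 : ContinuousAt (fun q : M × P => (χ q.1, q.2)) (y₀, p₀) :=
      (ContinuousAt.comp' (f := fun q : M × P => q.1) (x := (y₀, p₀)) h1 continuousAt_fst).prodMk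
        continuousAt_snd
    exact h2
  have hψc : Filter.Tendsto ψ (𝓝 u.1) (𝓝 (φ x₀)) := by
    have := hψ3.self_of_nhds.continuousAt.tendsto
    rwa [hψ0] at this
  have hysrc : ∀ᶠ q : M × P in 𝓝 (y₀, p₀), q.1 ∈ χ.source :=
    continuousAt_fst.preimage_mem_nhds (extChartAt_source_mem_nhds y₀)
  have hψtar : ∀ᶠ a in 𝓝 u.1, ψ a ∈ φ.target := hψc (extChartAt_target_mem_nhds x₀)
  refine ⟨fun q => φ.symm (ψ (χ q.1, q.2)), ?_, ?_, ?_, ?_⟩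
  · show φ.symm (ψ u.1) = x₀
    rw [hψ0]
    exact hφ0
  · filter_upwards [hch.eventually hψ3, hch.eventually hψtar, hysrc] with q h1 h2 h3
    have k1 : ContMDiffAt (I.prod 𝓘(ℝ, P)) 𝓘(ℝ, E × P) ∞ (fun q : M × P => (χ q.1, q.2)) q := by
      refine ContMDiffAt.prodMk_space ?_ contMDiffAt_snd
      exact ((contMDiffOn_extChartAt (x := y₀)).contMDiffAt
        ((chartAt HM y₀).open_source.mem_nhds (by rwa [← extChartAt_source (I := I)]))).comp q
        contMDiffAt_fst
    have k2 : ContMDiffAt 𝓘(ℝ, E × P) 𝓘(ℝ, E) ∞ ψ (χ q.1, q.2) := h1.contMDiffAt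
    have k3 : ContMDiffAt 𝓘(ℝ, E) I ∞ φ.symm (ψ (χ q.1, q.2)) :=
      (contMDiffOn_extChartAt_symm x₀).contMDiffAt ((isOpen_extChartAt_target x₀).mem_nhds h2)
    exact k3.comp q (f := fun q : M × P => ψ (χ q.1, q.2)) (k2.comp q k1)
  · have hgr : Filter.Tendsto (fun a => (a, ψ a)) (𝓝 u.1) (𝓝 u) := by
      have h1 : Filter.Tendsto (fun a => (a, ψ a)) (𝓝 u.1) (𝓝 (u.1, φ x₀)) :=
        Filter.Tendsto.prodMk_nhds Filter.tendsto_id hψc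
      exact h1
    filter_upwards [hch.eventually hψ1, hysrc,
      hch.eventually (hgr.eventually (hpt.eventually hsrc))] with q h1 h2 h3
    rw [hFu, sub_eq_zero] at h1
    exact χ.injOn h3 h2 h1
  · have hv : Filter.Tendsto (fun q : M × P => ((χ (ρ q), q.2), φ q.1)) (𝓝 (x₀, p₀)) (𝓝 u) := by
      have h1 : ContinuousAt (fun q : M × P => ((χ (ρ q), q.2), φ q.1)) (x₀, p₀) :=
        (((continuousAt_extChartAt (I := I) y₀).comp' hcont).prodMk continuousAt_snd).prodMk
          ((continuousAt_extChartAt (I := I) x₀).comp' continuousAt_fst)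
      exact h1
    have hxs : ∀ᶠ q : M × P in 𝓝 (x₀, p₀), q.1 ∈ φ.source :=
      continuousAt_fst.preimage_mem_nhds (extChartAt_source_mem_nhds x₀)
    filter_upwards [hv.eventually hψ2, hxs] with q h1 h2
    have h3 : F ((χ (ρ q), q.2), φ q.1) = F u := by
      rw [hFu]
      simp only [F, φ.left_inv h2, Prod.mk.eta, sub_self]
    have h4 : ψ (χ (ρ q), q.2) = φ q.1 := h1 h3
    show φ.symm (ψ (χ (ρ q), q.2)) = q.1
    rw [h4]
    exact φ.left_inv h2

/-- A local inverse, with parameters, of a smooth family is smooth. -/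
theorem contMDiffAt_inverse_family [CompleteSpace E] [CompleteSpace P] {ρ : M × P → M} {x₀ : M}
    {p₀ : P} (hρ : ∀ᶠ q in 𝓝 (x₀, p₀), ContMDiffAt (I.prod 𝓘(ℝ, P)) I ∞ ρ q)
    (hbij : Function.Bijective (tder I I (fun x => ρ (x, p₀)) x₀)) {κ : M × P → M} {S : Set M}
    (hS : S ∈ 𝓝 x₀)
    (hκ : ∀ᶠ q in 𝓝 (ρ (x₀, p₀), p₀), ∀ x ∈ S, ρ (x, q.2) = q.1 → κ q = x) :
    ContMDiffAt (I.prod 𝓘(ℝ, P)) I ∞ κ (ρ (x₀, p₀), p₀) := by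
  obtain ⟨κ', h0, h1, h2, -⟩ := exists_local_inverse_family hρ hbij
  refine h1.self_of_nhds.congr_of_eventuallyEq ?_
  have h3 : ∀ᶠ q in 𝓝 (ρ (x₀, p₀), p₀), κ' q ∈ S :=
    h1.self_of_nhds.continuousAt.preimage_mem_nhds (by rw [h0]; exact hS)
  filter_upwards [hκ, h2, h3] with q k1 k2 k3
  exact k1 _ k3 k2

/-- Bijectivity of the differential is an open condition. -/
theorem eventually_bijective_tder [FiniteDimensional ℝ E] [CompleteSpace P] {ρ : M × P → M}
    {x₀ : M} {p₀ : P} (hρ : ∀ᶠ q in 𝓝 (x₀, p₀), ContMDiffAt (I.prod 𝓘(ℝ, P)) I ∞ ρ q)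
    (hbij : Function.Bijective (tder I I (fun x => ρ (x, p₀)) x₀)) :
    ∀ᶠ q in 𝓝 (x₀, p₀), Function.Bijective (tder I I (fun x => ρ (x, q.2)) q.1) := by
  have : CompleteSpace E := FiniteDimensional.complete ℝ E
  obtain ⟨κ, h0, h1, -, h3⟩ := exists_local_inverse_family hρ hbij
  have ht : Filter.Tendsto (fun q : M × P => (ρ q, q.2)) (𝓝 (x₀, p₀)) (𝓝 (ρ (x₀, p₀), p₀)) :=
    Filter.Tendsto.prodMk_nhds hρ.self_of_nhds.continuousAt continuousAt_snd
  filter_upwards [hρ, ht.eventually h1, h3.eventually_nhds] with q k1 k2 k3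
  have d1 : MDifferentiableAt I I (fun x => ρ (x, q.2)) q.1 :=
    (ContMDiffAt.slice_left (x := q.1) (p := q.2) k1).mdifferentiableAt (by simp)
  have d2 : MDifferentiableAt I I (fun x => κ (x, q.2)) (ρ q) :=
    (ContMDiffAt.slice_left (x := ρ q) (p := q.2) k2).mdifferentiableAt (by simp)
  have hc : (fun x => κ (ρ (x, q.2), q.2)) =ᶠ[𝓝 q.1] fun x => x := by
    have : Filter.Tendsto (fun x : M => (x, q.2)) (𝓝 q.1) (𝓝 q) :=
      Continuous.tendsto (by fun_prop) q.1
    exact this.eventually k3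
  have hcomp := tder_comp (I := I) (I' := I) (I'' := I) (x := q.1) (g := fun x => κ (x, q.2))
    (f := fun x => ρ (x, q.2)) d2 d1
  rw [tder_congr hc, tder_id] at hcomp
  -- The local left inverse gives injectivity at nearby points, and the dimension is finite.
  have hinj : Function.Injective (tder I I (fun x => ρ (x, q.2)) q.1) := by
    refine Function.LeftInverse.injective (g := tder I I (fun x => κ (x, q.2)) (ρ q)) fun v => ?_
    exact (congrArg (fun L => L v) hcomp).symm
  exact ⟨hinj, (LinearMap.injective_iff_surjective
    (f := (tder I I (fun x => ρ (x, q.2)) q.1 : E →ₗ[ℝ] E))).mp hinj⟩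

omit [I.Boundaryless] [IsManifold I ∞ M] in
theorem bijective_tder_of_inverse {f g : M → M} {x : M} (hf : MDifferentiableAt I I f x)
    (hg : MDifferentiableAt I I g (f x)) (hgf : ∀ y, g (f y) = y) (hfg : ∀ y, f (g y) = y) :
    Function.Bijective (tder I I f x) := by
  have h1 := tder_comp (I := I) (I' := I) (I'' := I) (x := x) hg hf
  simp only [hgf] at h1
  rw [tder_id] at h1
  have h2 := tder_comp (I := I) (I' := I) (I'' := I) (x := f x) (g := f) (f := g)
    (by rw [hgf]; exact hf) hg
  simp only [hfg] at h2
  rw [tder_id, hgf] at h2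
  exact ⟨Function.LeftInverse.injective (g := tder I I g (f x))
      fun v => (congrArg (fun L => L v) h1).symm,
    Function.RightInverse.surjective (g := tder I I g (f x))
      fun v => (congrArg (fun L => L v) h2).symm⟩

end InverseFunction

/-! ### Smooth families of maps and their inverses -/

section Families

variable {E HM : Type*} [NormedAddCommGroup E] [NormedSpace ℝ E] [TopologicalSpace HM]
  {I : ModelWithCorners ℝ E HM} {M : Type*} [TopologicalSpace M] [ChartedSpace HM M]
  {E' HM' : Type*} [NormedAddCommGroup E'] [NormedSpace ℝ E'] [TopologicalSpace HM']
  {I' : ModelWithCorners ℝ E' HM'} {M' : Type*} [TopologicalSpace M'] [ChartedSpace HM' M']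
  {k : ℕ} {J : Set ℝ}

theorem SmoothFamily.contMDiffAt {Φ : M × (Fin k → ℝ) → M'} (h : SmoothFamily I I' J Φ)
    (hJ : IsOpen J) {ε : Fin k → ℝ} (hε : ε ∈ cube k J) (x : M) :
    ContMDiffAt (I.prod 𝓘(ℝ, Fin k → ℝ)) I' ∞ Φ (x, ε) :=
  ContMDiffOn.contMDiffAt h ((isOpen_univ.prod (isOpen_cube hJ)).mem_nhds ⟨mem_univ _, hε⟩)

theorem SmoothFamily.of_contMDiffAt {Φ : M × (Fin k → ℝ) → M'}
    (h : ∀ ε ∈ cube k J, ∀ x, ContMDiffAt (I.prod 𝓘(ℝ, Fin k → ℝ)) I' ∞ Φ (x, ε)) :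
    SmoothFamily I I' J Φ :=
  fun p hp => (h p.2 hp.2 p.1).contMDiffWithinAt

theorem SmoothFamily.slice {Φ : M × (Fin k → ℝ) → M'} (h : SmoothFamily I I' J Φ)
    (hJ : IsOpen J) {ε : Fin k → ℝ} (hε : ε ∈ cube k J) : ContMDiff I I' ∞ fun x => Φ (x, ε) :=
  fun x => (h.contMDiffAt hJ hε x).slice_left

theorem SmoothFamily.mono {Φ : M × (Fin k → ℝ) → M'} (h : SmoothFamily I I' J Φ) {J' : Set ℝ}
    (hJ' : J' ⊆ J) : SmoothFamily I I' J' Φ :=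
  ContMDiffOn.mono h (prod_mono subset_rfl (pi_mono fun _ _ => hJ'))

variable [I.Boundaryless] [IsManifold I ∞ M]

/-- The inverses of a smooth family of diffeomorphisms are a smooth family. -/
theorem SmoothFamily.inverse [CompleteSpace E] (hJ : IsOpen J) {ρ g : M × (Fin k → ℝ) → M}
    (hρ : SmoothFamily I I J ρ) (hg : ∀ ε ∈ cube k J, ContMDiff I I ∞ fun x => g (x, ε))
    (hgρ : ∀ ε ∈ cube k J, ∀ x, g (ρ (x, ε), ε) = x)
    (hρg : ∀ ε ∈ cube k J, ∀ x, ρ (g (x, ε), ε) = x) : SmoothFamily I I J g := by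
  refine .of_contMDiffAt fun ε hε y => ?_
  have hev : ∀ᶠ q : M × (Fin k → ℝ) in 𝓝 (y, ε), q.2 ∈ cube k J :=
    continuousAt_snd.preimage_mem_nhds ((isOpen_cube hJ).mem_nhds hε)
  have hev' : ∀ᶠ q : M × (Fin k → ℝ) in 𝓝 (g (y, ε), ε), q.2 ∈ cube k J :=
    continuousAt_snd.preimage_mem_nhds ((isOpen_cube hJ).mem_nhds hε)
  have h1 : ∀ᶠ q in 𝓝 (g (y, ε), ε), ContMDiffAt (I.prod 𝓘(ℝ, Fin k → ℝ)) I ∞ ρ q :=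
    hev'.mono fun q hq => hρ.contMDiffAt hJ hq q.1
  have h2 := bijective_tder_of_inverse (I := I) (f := fun x => ρ (x, ε)) (g := fun x => g (x, ε))
    (x := g (y, ε)) ((hρ.slice hJ hε).mdifferentiableAt (by simp))
    ((hg ε hε).mdifferentiableAt (by simp)) (hgρ ε hε) (hρg ε hε)
  have h3 := contMDiffAt_inverse_family h1 h2 (κ := g) (S := univ) Filter.univ_mem
  rw [hρg ε hε] at h3
  refine h3 (hev.mono fun q hq x _ hx => ?_)
  rw [← Prod.mk.eta (p := q), ← hx]
  exact hgρ _ hq x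

end Families

/-! ### Velocities of families, and families of maps starting at the identity -/

section NearIdentity

variable {E HM : Type*} [NormedAddCommGroup E] [NormedSpace ℝ E] [TopologicalSpace HM]
  {I : ModelWithCorners ℝ E HM} {M : Type*} [TopologicalSpace M] [ChartedSpace HM M]
  {k : ℕ} {J : Set ℝ}

/-- The partial derivative in the direction of a constant vector of a parameter space is a smooth
vector field along the map. -/
theorem contMDiffAt_paramVelocity [IsManifold I ∞ M] {EX HX X : Type*} [NormedAddCommGroup EX]
    [NormedSpace ℝ EX] [TopologicalSpace HX] {IX : ModelWithCorners ℝ EX HX} [TopologicalSpace X]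
    [ChartedSpace HX X] [IsManifold IX ∞ X] {P : Type*} [NormedAddCommGroup P]
    [NormedSpace ℝ P] {A : X × P → M} {p : X → P} {x₀ : X}
    (hA : ContMDiffAt (IX.prod 𝓘(ℝ, P)) I ∞ A (x₀, p x₀)) (hp : ContMDiffAt IX 𝓘(ℝ, P) ∞ p x₀)
    (w : P) :
    ContMDiffAt IX I.tangent ∞
      (fun x => (⟨A (x, p x), tder 𝓘(ℝ, P) I (fun e => A (x, e)) (p x) w⟩ : TangentBundle I M))
      x₀ := by
  have : IsManifold I 1 M := .of_le (n := ∞) (by simp)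
  have : IsManifold IX 1 X := .of_le (n := ∞) (by simp)
  have hcomp : ContMDiffAt IX I ∞ (fun x => A (x, p x)) x₀ :=
    hA.comp x₀ (contMDiffAt_id.prodMk hp)
  refine (contMDiffAt_tangent_iff (f := fun x => A (x, p x))
    (V := fun x => tder 𝓘(ℝ, P) I (fun e => A (x, e)) (p x) w) (z := A (x₀, p x₀))
    (mem_extChartAt_source _)).mpr ⟨hcomp, ?_⟩
  have h1 := ContMDiffAt.mfderiv (I := 𝓘(ℝ, P)) (I' := I) (J := IX) (x₀ := x₀)
    (fun x e => A (x, e)) p (m := ∞) (n := ∞) hA hp (by simp)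
  have h2 : ContMDiffAt IX 𝓘(ℝ, E) ∞ (fun x => inTangentCoordinates 𝓘(ℝ, P) I p
      (fun x => A (x, p x)) (fun x => mfderiv 𝓘(ℝ, P) I (fun e => A (x, e)) (p x)) x₀ x w) x₀ :=
    h1.clm_apply contMDiffAt_const
  refine h2.congr_of_eventuallyEq ?_
  have hev : ∀ᶠ x in 𝓝 x₀, A (x, p x) ∈ (chartAt HM (A (x₀, p x₀))).source :=
    hcomp.continuousAt.preimage_mem_nhds (chart_source_mem_nhds HM _)
  filter_upwards [hev] with x hx
  have h5 := inTangentCoordinates_eq_mfderiv_comp (I := 𝓘(ℝ, P)) (I' := I) (f := p)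
    (g := fun x => A (x, p x)) (ϕ := fun x => mfderiv 𝓘(ℝ, P) I (fun e => A (x, e)) (p x))
    (x₀ := x₀) (x := x) (mem_univ _) hx
  have h6 := congrArg (fun L : P →L[ℝ] E => L w) h5
  -- The parameter space is a vector space, so its tangent coordinate change is the identity and
  -- only the chart of M remains.
  have h3 : mfderivWithin 𝓘(ℝ, P) 𝓘(ℝ, P) (extChartAt 𝓘(ℝ, P) (p x₀)).symm (range 𝓘(ℝ, P))
      (extChartAt 𝓘(ℝ, P) (p x₀) (p x)) = ContinuousLinearMap.id ℝ P := by
    simp only [mfld_simps]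
    exact mfderiv_id
  have h4 := congrArg (fun L : P →L[ℝ] P => L w) h3
  refine Eq.trans ?_ h6.symm
  exact congrArg (fun u => tder I 𝓘(ℝ, E) (extChartAt I (A (x₀, p x₀))) (A (x, p x))
    (tder 𝓘(ℝ, P) I (fun e => A (x, e)) (p x) u)) h4.symm

/-- A family of maps starting at the identity is invertible near a compact set for small
parameters, and the inverse is smooth. -/
theorem exists_inverse_near_identity [FiniteDimensional ℝ E] [I.Boundaryless] [IsManifold I ∞ M]
    [T2Space M] (hJ : IsOpen J) (h0 : (0 : ℝ) ∈ J) {K : M × (Fin k → ℝ) → M}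
    (hK : SmoothFamily I I J K) (hK0 : ∀ x, K (x, 0) = x) {C : Set M} (hC : IsCompact C) :
    ∃ V : Set M, IsOpen V ∧ C ⊆ V ∧ ∃ r > 0, Metric.ball (0 : Fin k → ℝ) r ⊆ cube k J ∧
      ∃ κ : M × (Fin k → ℝ) → M, ∀ ε ∈ Metric.ball (0 : Fin k → ℝ) r,
        (∀ y ∈ V, ContMDiffAt (I.prod 𝓘(ℝ, Fin k → ℝ)) I ∞ κ (y, ε)) ∧
        (∀ y ∈ V, K (κ (y, ε), ε) = y) ∧ ∀ x ∈ C, κ (K (x, ε), ε) = x := by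
  have : LocallyCompactSpace HM := I.locallyCompactSpace
  have : LocallyCompactSpace M := ChartedSpace.locallyCompactSpace HM M
  have : CompleteSpace E := FiniteDimensional.complete ℝ E
  -- Injectivity and invertible differentials will hold on C', while every point of the smaller C₁
  -- is attained from the interior of C'.
  obtain ⟨C', hC', hCC'⟩ := exists_compact_superset hC
  obtain ⟨C₁, hC₁, hCC₁, hC₁C'⟩ := exists_compact_between hC isOpen_interior hCC'
  have hcube : cube k J ∈ 𝓝 (0 : Fin k → ℝ) := (isOpen_cube hJ).mem_nhds fun _ _ => h0
  have hs : ∀ x, ∀ᶠ q in 𝓝 (x, (0 : Fin k → ℝ)),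
      ContMDiffAt (I.prod 𝓘(ℝ, Fin k → ℝ)) I ∞ K q := by
    intro x
    have hev : ∀ᶠ q : M × (Fin k → ℝ) in 𝓝 (x, 0), q.2 ∈ cube k J :=
      continuousAt_snd.preimage_mem_nhds hcube
    exact hev.mono fun q hq => hK.contMDiffAt hJ hq q.1
  have hbij : ∀ x, Function.Bijective (tder I I (fun x => K (x, (0 : Fin k → ℝ))) x) := by
    intro x
    simp only [hK0, tder_id]
    exact Function.bijective_id
  have hloc : ∀ x, ∃ κ : M × (Fin k → ℝ) → M, κ (x, 0) = x ∧
      (∀ᶠ q in 𝓝 (x, (0 : Fin k → ℝ)), ContMDiffAt (I.prod 𝓘(ℝ, Fin k → ℝ)) I ∞ κ q) ∧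
      (∀ᶠ q in 𝓝 (x, (0 : Fin k → ℝ)), K (κ q, q.2) = q.1) ∧
      ∀ᶠ q in 𝓝 (x, (0 : Fin k → ℝ)), κ (K q, q.2) = q.1 := by
    intro x
    have := exists_local_inverse_family (hs x) (hbij x)
    simpa only [hK0] using this
  have hswap : ∀ x : M, Filter.Tendsto (Prod.swap : (Fin k → ℝ) × M → M × (Fin k → ℝ))
      (𝓝 (0, x)) (𝓝 (x, 0)) := fun x => continuous_swap.tendsto _
  -- Near the diagonal of C' × C' the local left inverse gives injectivity; away from it, distinct
  -- points keep distinct images because M is Hausdorff. Compactness joins the two.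
  have e1 : ∀ᶠ ε in 𝓝 (0 : Fin k → ℝ), ∀ c ∈ C' ×ˢ C', K (c.1, ε) = K (c.2, ε) → c.1 = c.2 := by
    refine (hC'.prod hC').eventually_forall_of_forall_eventually fun c _ => ?_
    have ht1 : Filter.Tendsto (fun p : (Fin k → ℝ) × M × M => (p.2.1, p.1)) (𝓝 (0, c))
        (𝓝 (c.1, 0)) := Continuous.tendsto (by fun_prop) _
    have ht2 : Filter.Tendsto (fun p : (Fin k → ℝ) × M × M => (p.2.2, p.1)) (𝓝 (0, c))
        (𝓝 (c.2, 0)) := Continuous.tendsto (by fun_prop) _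
    by_cases hc : c.1 = c.2
    · obtain ⟨κ, -, -, -, h⟩ := hloc c.1
      rw [← hc] at ht2
      filter_upwards [ht1.eventually h, ht2.eventually h] with p h1 h2 h3
      rw [← h1, ← h2]
      show κ (K (p.2.1, p.1), p.1) = κ (K (p.2.2, p.1), p.1)
      rw [h3]
    · have k1 : Filter.Tendsto (fun p : (Fin k → ℝ) × M × M => K (p.2.1, p.1)) (𝓝 (0, c))
          (𝓝 c.1) := by
        have := (hs c.1).self_of_nhds.continuousAt.tendsto.comp ht1
        rwa [hK0] at this
      have k2 : Filter.Tendsto (fun p : (Fin k → ℝ) × M × M => K (p.2.2, p.1)) (𝓝 (0, c))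
          (𝓝 c.2) := by
        have := (hs c.2).self_of_nhds.continuousAt.tendsto.comp ht2
        rwa [hK0] at this
      have k3 := (k1.prodMk_nhds k2).eventually (isClosed_diagonal.isOpen_compl.mem_nhds hc)
      exact k3.mono fun p hp h => absurd h hp
  have e2 : ∀ᶠ ε in 𝓝 (0 : Fin k → ℝ), ∀ x ∈ C',
      Function.Bijective (tder I I (fun x => K (x, ε)) x) := by
    refine hC'.eventually_forall_of_forall_eventually fun x _ => ?_
    exact (hswap x).eventually (eventually_bijective_tder (hs x) (hbij x))
  have e3 : ∀ᶠ ε in 𝓝 (0 : Fin k → ℝ), ∀ y ∈ C₁, ∃ x ∈ interior C', K (x, ε) = y := by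
    refine hC₁.eventually_forall_of_forall_eventually fun y hy => ?_
    obtain ⟨κ, h1, h2, h3, -⟩ := hloc y
    have h4 : ∀ᶠ q in 𝓝 (y, (0 : Fin k → ℝ)), κ q ∈ interior C' :=
      h2.self_of_nhds.continuousAt.preimage_mem_nhds
        (by rw [h1]; exact isOpen_interior.mem_nhds (hC₁C' hy))
    have h5 : ∀ᶠ q in 𝓝 (y, (0 : Fin k → ℝ)), ∃ x ∈ interior C', K (x, q.2) = q.1 :=
      (h3.and h4).mono fun q hq => ⟨κ q, hq.2, hq.1⟩
    exact (hswap y).eventually h5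
  obtain ⟨r, hr, hball⟩ := Metric.eventually_nhds_iff_ball.mp (((e1.and e2).and e3).and hcube)
  classical
  -- The preimage in the interior of C', unique by `e1` for small parameters; the default q.1 is not
  -- used on V or on images of C.
  let κ : M × (Fin k → ℝ) → M := fun q =>
    if h : ∃ x ∈ interior C', K (x, q.2) = q.1 then h.choose else q.1
  have hκ : ∀ q : M × (Fin k → ℝ), q.2 ∈ Metric.ball (0 : Fin k → ℝ) r → ∀ x ∈ interior C',
      K (x, q.2) = q.1 → κ q = x := by
    intro q hq x hx hxq
    have h : ∃ x ∈ interior C', K (x, q.2) = q.1 := ⟨x, hx, hxq⟩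
    have h1 : κ q = h.choose := dif_pos h
    rw [h1]
    exact (hball _ hq).1.1.1 (h.choose, x)
      ⟨interior_subset h.choose_spec.1, interior_subset hx⟩ (h.choose_spec.2.trans hxq.symm)
  refine ⟨interior C₁, isOpen_interior, hCC₁, r, hr, fun ε hε => (hball ε hε).2, κ,
    fun ε hε => ⟨fun y hy => ?_, fun y hy => ?_, fun x hx => hκ _ hε x (hCC' hx) rfl⟩⟩
  · obtain ⟨x, hx, rfl⟩ := (hball ε hε).1.2 y (interior_subset hy)
    have hx1 : ∀ᶠ q in 𝓝 (x, ε), ContMDiffAt (I.prod 𝓘(ℝ, Fin k → ℝ)) I ∞ K q := by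
      have hev : ∀ᶠ q : M × (Fin k → ℝ) in 𝓝 (x, ε), q.2 ∈ cube k J :=
        continuousAt_snd.preimage_mem_nhds ((isOpen_cube hJ).mem_nhds (hball ε hε).2)
      exact hev.mono fun q hq => hK.contMDiffAt hJ hq q.1
    refine contMDiffAt_inverse_family hx1 ((hball ε hε).1.1.2 x (interior_subset hx))
      (isOpen_interior.mem_nhds hx) ?_
    have hev : ∀ᶠ q : M × (Fin k → ℝ) in 𝓝 (K (x, ε), ε), q.2 ∈ Metric.ball (0 : Fin k → ℝ) r :=
      continuousAt_snd.preimage_mem_nhds (Metric.isOpen_ball.mem_nhds hε)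
    exact hev.mono fun q hq => hκ q hq
  · obtain ⟨x, hx, hxy⟩ := (hball ε hε).1.2 y (interior_subset hy)
    rw [hκ (y, ε) hε x hx hxy]
    exact hxy

end NearIdentity

/-! ### Differential calculus in a Lie groupoid -/

section GroupoidCalculus

variable {EG HG EM HM : Type*}
  [NormedAddCommGroup EG] [NormedSpace ℝ EG] [TopologicalSpace HG]
  [NormedAddCommGroup EM] [NormedSpace ℝ EM] [TopologicalSpace HM]
  {IG : ModelWithCorners ℝ EG HG} {G : Type*} [TopologicalSpace G] [ChartedSpace HG G]
  {IM : ModelWithCorners ℝ EM HM} {M : Type*} [TopologicalSpace M] [ChartedSpace HM M]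

theorem TangentBundle.mk_congr {x y : M} {v w : EM} (h : x = y) (h' : v = w) :
    (⟨x, v⟩ : TangentBundle IM M) = ⟨y, w⟩ := by
  subst h h'
  rfl

theorem HasVelocity.eq_zero_of_const {γ : ℝ → M} {v : EM} {t : ℝ} (h : HasVelocity IM γ v t)
    {x : M} (hx : ∀ᶠ s in 𝓝 t, γ s = x) : v = 0 :=
  h.unique ((HasVelocity.const x t).congr_of_eventuallyEq hx)

theorem HasVelocity.mfderiv_eq {γ : ℝ → M} {v : EM} {t : ℝ} (h : HasVelocity IM γ v t) :
    tder 𝓘(ℝ, ℝ) IM γ t 1 = v :=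
  (MDifferentiableAt.hasVelocity (HasMFDerivAt.mdifferentiableAt h)).unique h

namespace LieGroupoid

variable (𝓖 : LieGroupoid IG G IM M)

theorem mdifferentiableAt_s (g : G) : MDifferentiableAt IG IM 𝓖.s g :=
  𝓖.contMDiff_s.mdifferentiableAt (by simp)

theorem mdifferentiableAt_t (g : G) : MDifferentiableAt IG IM 𝓖.t g :=
  𝓖.contMDiff_t.mdifferentiableAt (by simp)

theorem mdifferentiableAt_u (x : M) : MDifferentiableAt IM IG 𝓖.u x :=
  𝓖.contMDiff_u.mdifferentiableAt (by simp)

theorem mdifferentiableAt_inv (g : G) : MDifferentiableAt IG IG 𝓖.inv g :=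
  𝓖.contMDiff_inv.mdifferentiableAt (by simp)

theorem inv_u (x : M) : 𝓖.inv (𝓖.u x) = 𝓖.u x := by
  have h1 := 𝓖.inv_mul (𝓖.u x)
  have h2 := 𝓖.mul_u (𝓖.inv (𝓖.u x))
  rw [𝓖.s_inv, 𝓖.t_u] at h2
  rw [h2, 𝓖.s_u] at h1
  exact h1

theorem inv_mul_cancel_left {g h : G} (hgh : 𝓖.s g = 𝓖.t h) :
    𝓖.mul (𝓖.inv g) (𝓖.mul g h) = h := by
  rw [← 𝓖.mul_assoc _ _ _ (𝓖.s_inv g) hgh, 𝓖.inv_mul, hgh, 𝓖.u_mul]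

theorem mul_inv_cancel_right {g h : G} (hgh : 𝓖.s g = 𝓖.t h) :
    𝓖.mul (𝓖.mul g h) (𝓖.inv h) = g := by
  rw [𝓖.mul_assoc _ _ _ hgh (𝓖.t_inv h).symm, 𝓖.mul_inv, ← hgh, 𝓖.mul_u]

theorem contMDiffAt_mul {EX HX X : Type*} [NormedAddCommGroup EX] [NormedSpace ℝ EX]
    [TopologicalSpace HX] {IX : ModelWithCorners ℝ EX HX} [TopologicalSpace X] [ChartedSpace HX X]
    {f g : X → G} {x : X} (hf : ContMDiffAt IX IG ∞ f x) (hg : ContMDiffAt IX IG ∞ g x)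
    (h : ∀ᶠ x in 𝓝 x, 𝓖.s (f x) = 𝓖.t (g x)) :
    ContMDiffAt IX IG ∞ (fun x => 𝓖.mul (f x) (g x)) x := by
  have h1 := 𝓖.contMDiffOn_mul (f x, g x) h.self_of_nhds
  have h2 : ContMDiffWithinAt IX (IG.prod IG) ∞ (fun x => (f x, g x))
      {x | 𝓖.s (f x) = 𝓖.t (g x)} x := (hf.prodMk hg).contMDiffWithinAt
  have h3 := ContMDiffWithinAt.comp x h1 h2 fun _ hx => hx
  exact h3.contMDiffAt h

/-- The differential of the multiplication, as a map between the model spaces. -/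
def dMul (g h : G) : EG × EG →L[ℝ] EG :=
  mfderivWithin (IG.prod IG) IG (fun p : G × G => 𝓖.mul p.1 p.2)
    {p : G × G | 𝓖.s p.1 = 𝓖.t p.2} (g, h)

/-- Curves of composable pairs compute `dMul`. Identities for `dMul` and the translations are then
obtained by differentiating identities between arrows. -/
theorem hasVelocity_mul {γ γ' : ℝ → G} {v w : EG} {τ : ℝ} {g h : G} (hg : γ τ = g)
    (hh : γ' τ = h) (hv : HasVelocity IG γ v τ) (hw : HasVelocity IG γ' w τ)
    (hst : ∀ᶠ r in 𝓝 τ, 𝓖.s (γ r) = 𝓖.t (γ' r)) :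
    HasVelocity IG (fun r => 𝓖.mul (γ r) (γ' r)) (𝓖.dMul g h (v, w)) τ := by
  subst hg hh
  have h1 : MDifferentiableWithinAt (IG.prod IG) IG (fun p : G × G => 𝓖.mul p.1 p.2)
      {p : G × G | 𝓖.s p.1 = 𝓖.t p.2} (γ τ, γ' τ) :=
    (𝓖.contMDiffOn_mul (γ τ, γ' τ) hst.self_of_nhds).mdifferentiableWithinAt (by simp)
  exact (hv.prodMk hw).comp_within h1.hasMFDerivWithinAt hst

theorem dMul_add (g h : G) (v w : EG) :
    𝓖.dMul g h (v, w) = 𝓖.dMul g h (v, 0) + 𝓖.dMul g h (0, w) := by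
  rw [← map_add]
  simp

/-- Used with v killed by ds and v' matching w, so that both summands are tangent to composable
pairs. -/
theorem dMul_add_left (g h : G) (v v' w : EG) :
    𝓖.dMul g h (v + v', w) = 𝓖.dMul g h (v, 0) + 𝓖.dMul g h (v', w) := by
  rw [← map_add]
  simp

/-- The vector `r_g v` is the velocity of the product of `g` with a curve of velocity `v`. -/
theorem hasVelocity_rightTranslate {c : ℝ → G} {g : G} {v : EG} (h0 : c 0 = 𝓖.u (𝓖.t g))
    (hc : HasVelocity IG c v 0) (hs : ∀ᶠ τ in 𝓝 0, 𝓖.s (c τ) = 𝓖.t g) :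
    HasVelocity IG (fun τ => 𝓖.mul (c τ) g) (𝓖.rightTranslate g (𝓖.t g) v) 0 :=
  𝓖.hasVelocity_mul h0 rfl hc (HasVelocity.const g 0) hs

theorem hasVelocity_inv {c : ℝ → G} {y : M} {v : EG} (h0 : c 0 = 𝓖.u y)
    (hc : HasVelocity IG c v 0) :
    HasVelocity IG (fun τ => 𝓖.inv (c τ)) (𝓖.dInv y v) 0 := by
  have h1 := hc.map (𝓖.mdifferentiableAt_inv _)
  rw [h0] at h1
  exact h1

/-- The vector `l_g (di v)` is the velocity of the product of `g` with the inverse of a curve of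
velocity `v`. -/
theorem hasVelocity_leftTranslate {c : ℝ → G} {g : G} {v : EG} (h0 : c 0 = 𝓖.u (𝓖.s g))
    (hc : HasVelocity IG c v 0) (hs : ∀ᶠ τ in 𝓝 0, 𝓖.s (c τ) = 𝓖.s g) :
    HasVelocity IG (fun τ => 𝓖.mul g (𝓖.inv (c τ)))
      (𝓖.leftTranslate g (𝓖.s g) (𝓖.dInv (𝓖.s g) v)) 0 := by
  refine 𝓖.hasVelocity_mul rfl ?_ (HasVelocity.const g 0) (𝓖.hasVelocity_inv h0 hc) ?_
  · show 𝓖.inv (c 0) = _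
    rw [h0, 𝓖.inv_u]
  · filter_upwards [hs] with τ h
    rw [𝓖.t_inv, h]

section Exponential

variable [IG.Boundaryless] [IsManifold IG ∞ G] [IM.Boundaryless] [IsManifold IM ∞ M]
  [CompleteSpace EG] [CompleteSpace EM]

/-- Local families of arrows starting at the points of the base, with prescribed velocities in the
Lie algebroid. -/
theorem exists_source_fibre_curves (y₀ : M) :
    ∃ A : M × EG → G, (∀ᶠ q in 𝓝 (y₀, (0 : EG)), ContMDiffAt (IM.prod 𝓘(ℝ, EG)) IG ∞ A q) ∧
      (∀ᶠ q in 𝓝 (y₀, (0 : EG)), 𝓖.s (A q) = q.1) ∧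
      ∀ᶠ y in 𝓝 y₀, A (y, 0) = 𝓖.u y ∧ ∀ v : EG, tder IG IM 𝓖.s (𝓖.u y) v = 0 →
        HasVelocity IG
          (fun τ : ℝ => A (y, τ • tder IG 𝓘(ℝ, EG) (extChartAt IG (𝓖.u y₀)) (𝓖.u y) v)) v 0 := by
  let ψ := extChartAt IG (𝓖.u y₀)
  -- Straight segments in a chart issuing from the units. They have the right velocity but leave the
  -- source fibre; moving the base point by a local inverse κ of s ∘ a corrects this.
  let a : M × EG → G := fun q => ψ.symm (ψ (𝓖.u q.1) + q.2)
  have hsrc : ∀ᶠ y in 𝓝 y₀, 𝓖.u y ∈ ψ.source :=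
    𝓖.contMDiff_u.continuous.continuousAt.preimage_mem_nhds (extChartAt_source_mem_nhds (𝓖.u y₀))
  have ha0 : ∀ᶠ y in 𝓝 y₀, a (y, 0) = 𝓖.u y := by
    filter_upwards [hsrc] with y hy
    show ψ.symm (ψ (𝓖.u y) + 0) = 𝓖.u y
    rw [add_zero]
    exact ψ.left_inv hy
  have hin : ∀ q : M × EG, 𝓖.u q.1 ∈ ψ.source →
      ContMDiffAt (IM.prod 𝓘(ℝ, EG)) 𝓘(ℝ, EG) ∞ (fun q : M × EG => ψ (𝓖.u q.1) + q.2) q := by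
    intro q hq
    have h1 : ContMDiffAt IG 𝓘(ℝ, EG) ∞ ψ (𝓖.u q.1) :=
      contMDiffOn_extChartAt.contMDiffAt
        ((chartAt HG _).open_source.mem_nhds (by rwa [← extChartAt_source (I := IG)]))
    have h2 : ContMDiffAt (IM.prod 𝓘(ℝ, EG)) IG ∞ (fun q : M × EG => 𝓖.u q.1) q :=
      𝓖.contMDiff_u.contMDiffAt.comp q contMDiffAt_fst
    exact (h1.comp q h2).add contMDiffAt_snd
  have hsrc' : ∀ᶠ q : M × EG in 𝓝 (y₀, 0), 𝓖.u q.1 ∈ ψ.source :=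
    (continuousAt_fst (p := (y₀, (0 : EG)))).eventually hsrc
  have htar : ∀ᶠ q : M × EG in 𝓝 (y₀, 0), ψ (𝓖.u q.1) + q.2 ∈ ψ.target := by
    refine (hin (y₀, 0) hsrc.self_of_nhds).continuousAt.preimage_mem_nhds ?_
    show ψ.target ∈ 𝓝 (ψ (𝓖.u y₀) + 0)
    rw [add_zero]
    exact extChartAt_target_mem_nhds _
  have ha : ∀ q : M × EG, 𝓖.u q.1 ∈ ψ.source → ψ (𝓖.u q.1) + q.2 ∈ ψ.target →
      ContMDiffAt (IM.prod 𝓘(ℝ, EG)) IG ∞ a q := by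
    intro q h1 h2
    have h3 : ContMDiffAt 𝓘(ℝ, EG) IG ∞ ψ.symm (ψ (𝓖.u q.1) + q.2) :=
      (contMDiffOn_extChartAt_symm _).contMDiffAt ((isOpen_extChartAt_target _).mem_nhds h2)
    exact h3.comp q (hin q h1)
  let ρ : M × EG → M := fun q => 𝓖.s (a q)
  have hρ : ∀ᶠ q in 𝓝 (y₀, (0 : EG)), ContMDiffAt (IM.prod 𝓘(ℝ, EG)) IM ∞ ρ q := by
    filter_upwards [hsrc', htar] with q h1 h2
    exact 𝓖.contMDiff_s.contMDiffAt.comp q (ha q h1 h2)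
  have hρ0 : ∀ᶠ y in 𝓝 y₀, ρ (y, 0) = y := by
    filter_upwards [ha0] with y hy
    show 𝓖.s (a (y, 0)) = y
    rw [hy, 𝓖.s_u]
  have hbij : Function.Bijective (tder IM IM (fun x => ρ (x, (0 : EG))) y₀) := by
    rw [tder_congr hρ0, tder_id]
    exact Function.bijective_id
  obtain ⟨κ, -, hκ1, hκ2, hκ3⟩ := exists_local_inverse_family hρ hbij
  rw [hρ0.self_of_nhds] at hκ1 hκ2
  have hκ0 : ∀ᶠ y in 𝓝 y₀, κ (y, 0) = y := by
    have ht : Filter.Tendsto (fun y : M => (y, (0 : EG))) (𝓝 y₀) (𝓝 (y₀, 0)) :=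
      Continuous.tendsto (by fun_prop) _
    filter_upwards [ht.eventually hκ3, hρ0] with y h1 h2
    have h3 : κ (ρ (y, 0), 0) = y := h1
    rwa [h2] at h3
  have hpair : Filter.Tendsto (fun q : M × EG => (κ q, q.2)) (𝓝 (y₀, 0)) (𝓝 (y₀, 0)) := by
    have h1 := hκ1.self_of_nhds.continuousAt.tendsto
    rw [hκ0.self_of_nhds] at h1
    exact h1.prodMk_nhds continuousAt_snd
  refine ⟨fun q => a (κ q, q.2), ?_, ?_, ?_⟩
  · filter_upwards [hκ1, hpair.eventually hsrc', hpair.eventually htar] with q h1 h2 h3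
    exact (ha _ h2 h3).comp q (h1.prodMk contMDiffAt_snd)
  · exact hκ2
  · have ht : Filter.Tendsto (fun y : M => (y, (0 : EG))) (𝓝 y₀) (𝓝 (y₀, 0)) :=
      Continuous.tendsto (by fun_prop) _
    filter_upwards [ha0.eventually_nhds, hκ0, ht.eventually hκ1, ht.eventually hκ2.eventually_nhds,
      hsrc] with y h1 h2 h3 h4 h5
    have e1 : a (κ (y, 0), 0) = 𝓖.u y := by rw [h2, h1.self_of_nhds]
    refine ⟨e1, fun v hv => ?_⟩
    set w : EG := tder IG 𝓘(ℝ, EG) (extChartAt IG (𝓖.u y₀)) (𝓖.u y) v with hw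
    have hline : HasVelocity 𝓘(ℝ, EG) (fun τ : ℝ => τ • w) w 0 := by
      refine HasVelocity.iff_hasDerivAt.mpr ?_
      simpa using (hasDerivAt_id (0 : ℝ)).smul_const w
    have hlinet : Filter.Tendsto (fun τ : ℝ => (y, τ • w)) (𝓝 0) (𝓝 (y, 0)) := by
      have : ContinuousAt (fun τ : ℝ => (y, τ • w)) 0 := by fun_prop
      rw [ContinuousAt, zero_smul] at this
      exact this
    have hκv : HasVelocity IM (fun τ : ℝ => κ (y, τ • w))
        (tder 𝓘(ℝ, EG) IM (fun e => κ (y, e)) 0 w) 0 := by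
      have h6 : MDifferentiableAt 𝓘(ℝ, EG) IM (fun e => κ (y, e)) ((0 : ℝ) • w) := by
        rw [zero_smul]
        exact h3.slice_right.mdifferentiableAt (by simp)
      have h7 := hline.map h6
      rw [zero_smul] at h7
      exact h7
    set kv : EM := tder 𝓘(ℝ, EG) IM (fun e => κ (y, e)) 0 w
    have hκc : Filter.Tendsto (fun τ : ℝ => κ (y, τ • w)) (𝓝 0) (𝓝 y) := by
      have := hκv.continuousAt.tendsto
      rwa [zero_smul, h2] at this
    have hW1 : HasVelocity IG (fun τ : ℝ => a (κ (y, τ • w), (0 : ℝ) • w))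
        (tder IM IG 𝓖.u y kv) 0 := by
      have h6 := hκv.map (𝓖.mdifferentiableAt_u (κ (y, (0 : ℝ) • w)))
      rw [zero_smul, h2] at h6
      refine h6.congr_of_eventuallyEq ?_
      filter_upwards [hκc.eventually h1] with τ hτ
      rw [zero_smul]
      exact hτ
    have hW2 : HasVelocity IG (fun τ : ℝ => a (κ (y, (0 : ℝ) • w), τ • w)) v 0 := by
      rw [zero_smul, h2]
      have h6 : HasDerivAt (fun τ : ℝ => ψ (𝓖.u y) + τ • w) w 0 := by
        simpa using ((hasDerivAt_id (0 : ℝ)).smul_const w).const_add (ψ (𝓖.u y))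
      refine hasVelocity_extChartAt_symm h6 (z := 𝓖.u y₀) ?_ ?_
      · rw [zero_smul, add_zero]
        exact ψ.map_source h5
      · rw [zero_smul, add_zero, hw]
        have h7 : (extChartAt IG (𝓖.u y₀)).symm (ψ (𝓖.u y)) = 𝓖.u y := ψ.left_inv h5
        rw [h7]
    have hWd : MDifferentiableAt 𝓘(ℝ, ℝ × ℝ) IG
        (fun p : ℝ × ℝ => a (κ (y, p.1 • w), p.2 • w)) (0, 0) := by
      have h6 : ContMDiffAt 𝓘(ℝ, ℝ × ℝ) IM ∞ (fun p : ℝ × ℝ => κ (y, p.1 • w)) (0, 0) := by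
        have h7 : ContMDiffAt 𝓘(ℝ, EG) IM ∞ (fun e => κ (y, e)) ((0 : ℝ) • w) := by
          rw [zero_smul]
          exact h3.slice_right
        have h8 : ContMDiffAt 𝓘(ℝ, ℝ × ℝ) 𝓘(ℝ, EG) ∞ (fun p : ℝ × ℝ => p.1 • w) (0, 0) :=
          (contDiff_fst.smul contDiff_const).contMDiff.contMDiffAt
        exact ContMDiffAt.comp ((0, 0) : ℝ × ℝ) (g := fun e => κ (y, e))
          (f := fun p : ℝ × ℝ => p.1 • w) h7 h8
      have h9 : ContMDiffAt 𝓘(ℝ, ℝ × ℝ) 𝓘(ℝ, EG) ∞ (fun p : ℝ × ℝ => p.2 • w) (0, 0) :=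
        (contDiff_snd.smul contDiff_const).contMDiff.contMDiffAt
      have h10 : ContMDiffAt (IM.prod 𝓘(ℝ, EG)) IG ∞ a (κ (y, (0 : ℝ) • w), (0 : ℝ) • w) := by
        rw [zero_smul, h2]
        refine ha _ h5 ?_
        rw [add_zero]
        exact ψ.map_source h5
      exact (h10.comp ((0, 0) : ℝ × ℝ) (h6.prodMk h9)).mdifferentiableAt (by simp)
    have hW := HasVelocity.diag hWd hW1 hW2
    have e2 : a (κ (y, (0 : ℝ) • w), (0 : ℝ) • w) = 𝓖.u y := by rw [zero_smul, e1]
    -- The total velocity is du(kv) + v. Its image under ds is kv, because ds(v) = 0, and it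
    -- vanishes because the corrected curve has constant source. So the correction does not change
    -- the velocity.
    have hk : kv = 0 := by
      have h6 := hW.map (𝓖.mdifferentiableAt_s _)
      have h7 := h6.eq_zero_of_const (x := y) (hlinet.eventually h4)
      rw [e2, map_add, hv, add_zero] at h7
      have h8 := tder_comp (I := IM) (I' := IG) (I'' := IM) (x := y) (g := 𝓖.s) (f := 𝓖.u)
        (𝓖.mdifferentiableAt_s _) (𝓖.mdifferentiableAt_u _)
      simp only [𝓖.s_u] at h8
      rw [tder_id] at h8
      exact (congrArg (fun L : EM →L[ℝ] EM => L kv) h8).trans h7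
    rw [hk, map_zero, zero_add] at hW
    exact hW

theorem exists_source_fibre_curve {y : M} {v : EG} (hv : tder IG IM 𝓖.s (𝓖.u y) v = 0) :
    ∃ c : ℝ → G, c 0 = 𝓖.u y ∧ HasVelocity IG c v 0 ∧ ∀ᶠ τ in 𝓝 0, 𝓖.s (c τ) = y := by
  obtain ⟨A, -, h1, h2⟩ := 𝓖.exists_source_fibre_curves y
  refine ⟨_, ?_, h2.self_of_nhds.2 v hv, ?_⟩
  · rw [zero_smul]
    exact h2.self_of_nhds.1
  · have : ContinuousAt (fun τ : ℝ =>
        (y, τ • tder IG 𝓘(ℝ, EG) (extChartAt IG (𝓖.u y)) (𝓖.u y) v)) 0 := by fun_prop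
    rw [ContinuousAt, zero_smul] at this
    exact this.eventually h1

section Translations

variable {g h : G} {v : EG}

/-- For a curve c in the source fibre with velocity v, differentiate s(cg) = s(g). The next three
lemmas differentiate t(cg) = t(c), s(gc⁻¹) = t(c) and t(gc⁻¹) = t(g). -/
theorem tder_s_rightTranslate (hv : tder IG IM 𝓖.s (𝓖.u (𝓖.t g)) v = 0) :
    tder IG IM 𝓖.s g (𝓖.rightTranslate g (𝓖.t g) v) = 0 := by
  obtain ⟨c, h0, hc, hs⟩ := 𝓖.exists_source_fibre_curve hv
  have h1 := (𝓖.hasVelocity_rightTranslate h0 hc hs).map (𝓖.mdifferentiableAt_s _)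
  rw [h0, 𝓖.u_mul] at h1
  refine h1.eq_zero_of_const (x := 𝓖.s g) ?_
  filter_upwards [hs] with τ h
  exact 𝓖.s_mul _ _ h

theorem tder_t_rightTranslate (hv : tder IG IM 𝓖.s (𝓖.u (𝓖.t g)) v = 0) :
    tder IG IM 𝓖.t g (𝓖.rightTranslate g (𝓖.t g) v) = tder IG IM 𝓖.t (𝓖.u (𝓖.t g)) v := by
  obtain ⟨c, h0, hc, hs⟩ := 𝓖.exists_source_fibre_curve hv
  have h1 := (𝓖.hasVelocity_rightTranslate h0 hc hs).map (𝓖.mdifferentiableAt_t _)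
  have h2 := hc.map (𝓖.mdifferentiableAt_t _)
  rw [h0, 𝓖.u_mul] at h1
  rw [h0] at h2
  refine h1.unique (h2.congr_of_eventuallyEq ?_)
  filter_upwards [hs] with τ h
  exact 𝓖.t_mul _ _ h

theorem tder_s_leftTranslate (hv : tder IG IM 𝓖.s (𝓖.u (𝓖.s g)) v = 0) :
    tder IG IM 𝓖.s g (𝓖.leftTranslate g (𝓖.s g) (𝓖.dInv (𝓖.s g) v)) =
      tder IG IM 𝓖.t (𝓖.u (𝓖.s g)) v := by
  obtain ⟨c, h0, hc, hs⟩ := 𝓖.exists_source_fibre_curve hv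
  have h1 := (𝓖.hasVelocity_leftTranslate h0 hc hs).map (𝓖.mdifferentiableAt_s _)
  have h2 := hc.map (𝓖.mdifferentiableAt_t _)
  rw [h0, 𝓖.inv_u, 𝓖.mul_u] at h1
  rw [h0] at h2
  refine h1.unique (h2.congr_of_eventuallyEq ?_)
  filter_upwards [hs] with τ h
  rw [𝓖.s_mul _ _ (by rw [𝓖.t_inv, h]), 𝓖.s_inv]

theorem tder_t_leftTranslate (hv : tder IG IM 𝓖.s (𝓖.u (𝓖.s g)) v = 0) :
    tder IG IM 𝓖.t g (𝓖.leftTranslate g (𝓖.s g) (𝓖.dInv (𝓖.s g) v)) = 0 := by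
  obtain ⟨c, h0, hc, hs⟩ := 𝓖.exists_source_fibre_curve hv
  have h1 := (𝓖.hasVelocity_leftTranslate h0 hc hs).map (𝓖.mdifferentiableAt_t _)
  rw [h0, 𝓖.inv_u, 𝓖.mul_u] at h1
  refine h1.eq_zero_of_const (x := 𝓖.t g) ?_
  filter_upwards [hs] with τ h
  exact 𝓖.t_mul _ _ (by rw [𝓖.t_inv, h])

/-- The derivative of (cg)h = c(gh). -/
theorem dMul_rightTranslate (hgh : 𝓖.s g = 𝓖.t h)
    (hv : tder IG IM 𝓖.s (𝓖.u (𝓖.t g)) v = 0) :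
    𝓖.dMul g h (𝓖.rightTranslate g (𝓖.t g) v, 0) =
      𝓖.rightTranslate (𝓖.mul g h) (𝓖.t (𝓖.mul g h)) v := by
  obtain ⟨c, h0, hc, hs⟩ := 𝓖.exists_source_fibre_curve hv
  have ht := 𝓖.t_mul g h hgh
  have h1 := 𝓖.hasVelocity_mul (g := g) (h := h) (by rw [h0, 𝓖.u_mul]) rfl
    (𝓖.hasVelocity_rightTranslate h0 hc hs) (HasVelocity.const h 0)
    (by filter_upwards [hs] with τ h'; rw [𝓖.s_mul _ _ h', hgh])
  have h2 := 𝓖.hasVelocity_rightTranslate (g := 𝓖.mul g h) (by rw [ht, h0]) hc (by rwa [ht])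
  refine h1.unique (h2.congr_of_eventuallyEq ?_)
  filter_upwards [hs] with τ h'
  exact 𝓖.mul_assoc _ _ _ h' hgh

/-- The derivative of (gc⁻¹)(ch) = gh, whose right-hand side is constant. -/
theorem dMul_leftTranslate_rightTranslate (hgh : 𝓖.s g = 𝓖.t h)
    (hv : tder IG IM 𝓖.s (𝓖.u (𝓖.s g)) v = 0) :
    𝓖.dMul g h (𝓖.leftTranslate g (𝓖.s g) (𝓖.dInv (𝓖.s g) v),
      𝓖.rightTranslate h (𝓖.t h) v) = 0 := by
  obtain ⟨c, h0, hc, hs⟩ := 𝓖.exists_source_fibre_curve hv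
  have h1 := 𝓖.hasVelocity_mul (g := g) (h := h) (by rw [h0, 𝓖.inv_u, 𝓖.mul_u])
    (by rw [h0, hgh, 𝓖.u_mul])
    (𝓖.hasVelocity_leftTranslate h0 hc hs)
    (𝓖.hasVelocity_rightTranslate (by rw [h0, hgh]) hc (by rwa [← hgh]))
    (by
      filter_upwards [hs] with τ h'
      rw [𝓖.s_mul _ _ (by rw [𝓖.t_inv, h']), 𝓖.s_inv, 𝓖.t_mul _ _ (by rw [h', hgh])])
  refine h1.eq_zero_of_const (x := 𝓖.mul g h) ?_
  filter_upwards [hs] with τ h'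
  have e1 : 𝓖.s (c τ) = 𝓖.t h := by rw [h', hgh]
  rw [𝓖.mul_assoc _ _ _ (by rw [𝓖.t_inv, h']) (by rw [𝓖.s_inv, 𝓖.t_mul _ _ e1]),
    𝓖.inv_mul_cancel_left e1]

end Translations

/-- Smooth families of sections of the Lie algebroid extend to smooth families of right-invariant
vector fields. -/
theorem smoothVectorFields_rightTranslate {k : ℕ} {J : Set ℝ} (hJ : IsOpen J)
    {α : (Fin k → ℝ) → M → EG} (hα : 𝓖.SmoothAlgebroidSections J α) :
    SmoothVectorFields IG J fun ε g => (𝓖.rightTranslate g (𝓖.t g) (α ε (𝓖.t g)) : EG) := by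
  rintro ⟨g₀, ε₀⟩ ⟨-, hε₀⟩
  refine ContMDiffAt.contMDiffWithinAt ?_
  obtain ⟨A, hA1, hA2, hA3⟩ := 𝓖.exists_source_fibre_curves (𝓖.t g₀)
  let ψ := extChartAt IG (𝓖.u (𝓖.t g₀))
  let w : G × (Fin k → ℝ) → EG := fun p =>
    tder IG 𝓘(ℝ, EG) ψ (𝓖.u (𝓖.t p.1)) (α p.2 (𝓖.t p.1))
  have hw : ContMDiffAt (IG.prod 𝓘(ℝ, Fin k → ℝ)) 𝓘(ℝ, EG) ∞ w (g₀, ε₀) := by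
    have h1 : ContMDiffAt (IM.prod 𝓘(ℝ, Fin k → ℝ)) IG.tangent ∞
        (fun p : M × (Fin k → ℝ) => (⟨𝓖.u p.1, α p.2 p.1⟩ : TangentBundle IG G)) (𝓖.t g₀, ε₀) :=
      hα.2.contMDiffAt ((isOpen_univ.prod (isOpen_cube hJ)).mem_nhds ⟨mem_univ _, hε₀⟩)
    have h2 := ((contMDiffAt_tangent_iff (f := fun p : M × (Fin k → ℝ) => 𝓖.u p.1)
      (z := 𝓖.u (𝓖.t g₀)) (mem_extChartAt_source _)).mp h1).2
    have h3 : ContMDiffAt (IG.prod 𝓘(ℝ, Fin k → ℝ)) (IM.prod 𝓘(ℝ, Fin k → ℝ)) ∞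
        (fun p : G × (Fin k → ℝ) => (𝓖.t p.1, p.2)) (g₀, ε₀) :=
      (𝓖.contMDiff_t.contMDiffAt.comp (g₀, ε₀) contMDiffAt_fst).prodMk contMDiffAt_snd
    exact ContMDiffAt.comp (g₀, ε₀) h2 h3
  let b : (G × (Fin k → ℝ)) × ℝ → M × EG := fun p => (𝓖.t p.1.1, p.2 • w p.1)
  have hb : ContMDiffAt ((IG.prod 𝓘(ℝ, Fin k → ℝ)).prod 𝓘(ℝ, ℝ)) (IM.prod 𝓘(ℝ, EG)) ∞ b
      ((g₀, ε₀), 0) := by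
    refine ContMDiffAt.prodMk ?_ ?_
    · exact 𝓖.contMDiff_t.contMDiffAt.comp _ (contMDiffAt_fst.comp _ contMDiffAt_fst)
    · exact contMDiffAt_snd.smul (hw.comp ((g₀, ε₀), (0 : ℝ)) contMDiffAt_fst)
  have hb0 : b ((g₀, ε₀), 0) = (𝓖.t g₀, 0) := by simp [b]
  have hbt : Filter.Tendsto b (𝓝 ((g₀, ε₀), 0)) (𝓝 (𝓖.t g₀, 0)) := by
    rw [← hb0]
    exact hb.continuousAt
  -- A curve in τ through g whose velocity at τ = 0 is the right-invariant field at g. It is smooth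
  -- in all variables, hence so is its velocity.
  let B : (G × (Fin k → ℝ)) × ℝ → G := fun p => 𝓖.mul (A (b p)) p.1.1
  have hcomp : ∀ᶠ p in 𝓝 ((g₀, ε₀), (0 : ℝ)), 𝓖.s (A (b p)) = 𝓖.t p.1.1 := hbt.eventually hA2
  have hB : ContMDiffAt ((IG.prod 𝓘(ℝ, Fin k → ℝ)).prod 𝓘(ℝ, ℝ)) IG ∞ B ((g₀, ε₀), 0) := by
    refine 𝓖.contMDiffAt_mul ?_ (contMDiffAt_fst.comp _ contMDiffAt_fst) hcomp
    have h1 : ContMDiffAt (IM.prod 𝓘(ℝ, EG)) IG ∞ A (b ((g₀, ε₀), 0)) := by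
      rw [hb0]
      exact hA1.self_of_nhds
    exact h1.comp ((g₀, ε₀), (0 : ℝ)) hb
  refine (contMDiffAt_paramVelocity (A := B) (p := fun _ => (0 : ℝ)) (x₀ := (g₀, ε₀)) hB
    contMDiffAt_const 1).congr_of_eventuallyEq ?_
  have ht : Filter.Tendsto (fun p : G × (Fin k → ℝ) => 𝓖.t p.1) (𝓝 (g₀, ε₀)) (𝓝 (𝓖.t g₀)) :=
    (𝓖.contMDiff_t.continuous.comp continuous_fst).tendsto (g₀, ε₀)
  have hs0 : Filter.Tendsto (fun p : G × (Fin k → ℝ) => (p, (0 : ℝ))) (𝓝 (g₀, ε₀))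
      (𝓝 ((g₀, ε₀), 0)) := Continuous.tendsto (by fun_prop) (g₀, ε₀)
  have hev : ∀ᶠ p : G × (Fin k → ℝ) in 𝓝 (g₀, ε₀), p.2 ∈ cube k J :=
    continuousAt_snd.preimage_mem_nhds ((isOpen_cube hJ).mem_nhds hε₀)
  filter_upwards [ht.eventually hA3, hs0.eventually hcomp.eventually_nhds, hev] with p h1 h2 h3
  obtain ⟨g, ε⟩ := p
  have h5 : Filter.Tendsto (fun τ : ℝ => ((g, ε), τ)) (𝓝 0) (𝓝 ((g, ε), 0)) :=
    Continuous.tendsto (by fun_prop) _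
  have h4 := 𝓖.hasVelocity_rightTranslate (g := g) (c := fun τ => A (b ((g, ε), τ))) (by
      show A (𝓖.t g, (0 : ℝ) • _) = _
      rw [zero_smul]
      exact h1.1)
    (h1.2 (α ε (𝓖.t g)) (hα.1 ε h3 (𝓖.t g))) (h5.eventually h2)
  refine TangentBundle.mk_congr ?_ h4.mfderiv_eq.symm
  show g = 𝓖.mul (A (𝓖.t g, (0 : ℝ) • _)) g
  have h6 : A (𝓖.t g, 0) = 𝓖.u (𝓖.t g) := h1.1
  rw [zero_smul, h6, 𝓖.u_mul]

end Exponential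

end LieGroupoid

end GroupoidCalculus

/-! ### Parameter intervals and straight lines -/

theorem IsOpenIntervalAtZero.inter {J J' : Set ℝ} (h : IsOpenIntervalAtZero J)
    (h' : IsOpenIntervalAtZero J') : IsOpenIntervalAtZero (J ∩ J') :=
  ⟨h.1.inter h'.1, h.2.1.inter h'.2.1, h.2.2, h'.2.2⟩

theorem IsOpenIntervalAtZero.iInter {ι : Type*} [Finite ι] {J : ι → Set ℝ}
    (h : ∀ i, IsOpenIntervalAtZero (J i)) : IsOpenIntervalAtZero (⋂ i, J i) :=
  ⟨isOpen_iInter_of_finite fun i => (h i).1, ordConnected_iInter fun i => (h i).2.1,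
    mem_iInter.mpr fun i => (h i).2.2⟩

theorem cube_mono {k : ℕ} {J J' : Set ℝ} (h : J ⊆ J') : cube k J ⊆ cube k J' :=
  pi_mono fun _ _ => h

section Lines

variable {E HM : Type*} [NormedAddCommGroup E] [NormedSpace ℝ E] [TopologicalSpace HM]
  {I : ModelWithCorners ℝ E HM} {M : Type*} [TopologicalSpace M] [ChartedSpace HM M]
  {P : Type*} [NormedAddCommGroup P] [NormedSpace ℝ P]

theorem hasVelocity_line {f : P → M} {p : P} (hf : MDifferentiableAt 𝓘(ℝ, P) I f p) (v : P) :
    HasVelocity I (fun τ : ℝ => f (p + τ • v)) (tder 𝓘(ℝ, P) I f p v) 0 := by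
  have h1 : HasVelocity 𝓘(ℝ, P) (fun τ : ℝ => p + τ • v) v 0 := by
    refine HasVelocity.iff_hasDerivAt.mpr ?_
    simpa using ((hasDerivAt_id (0 : ℝ)).smul_const v).const_add p
  have h2 := h1.map (f := f) (by rw [zero_smul, add_zero]; exact hf)
  rw [zero_smul, add_zero] at h2
  exact h2

theorem HasVelocity.congr_velocity {γ : ℝ → M} {v w : E} {t : ℝ} (h : HasVelocity I γ v t)
    (hvw : v = w) : HasVelocity I γ w t :=
  hvw ▸ h

theorem tendsto_line (p v : P) : Filter.Tendsto (fun τ : ℝ => p + τ • v) (𝓝 0) (𝓝 p) := by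
  have : ContinuousAt (fun τ : ℝ => p + τ • v) 0 := by fun_prop
  rw [ContinuousAt, zero_smul, add_zero] at this
  exact this

theorem contMDiff_line (p v : P) :
    ContMDiff 𝓘(ℝ, ℝ) 𝓘(ℝ, P) ∞ (fun τ : ℝ => p + τ • v) :=
  (contDiff_const.add (contDiff_id.smul contDiff_const)).contMDiff

end Lines

/-! ### From strong triviality to the cohomological equations -/

section Infinitesimal

variable {EG HG EM HM EH HH EN HN : Type*}
  [NormedAddCommGroup EG] [NormedSpace ℝ EG] [TopologicalSpace HG]
  [NormedAddCommGroup EM] [NormedSpace ℝ EM] [TopologicalSpace HM]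
  [NormedAddCommGroup EH] [NormedSpace ℝ EH] [TopologicalSpace HH]
  [NormedAddCommGroup EN] [NormedSpace ℝ EN] [TopologicalSpace HN]
  {IH : ModelWithCorners ℝ EH HH} {H : Type*} [TopologicalSpace H] [ChartedSpace HH H]
  {IN : ModelWithCorners ℝ EN HN} {N : Type*} [TopologicalSpace N] [ChartedSpace HN N]
  {IG : ModelWithCorners ℝ EG HG} {G : Type*} [TopologicalSpace G] [ChartedSpace HG G]
  {IM : ModelWithCorners ℝ EM HM} {M : Type*} [TopologicalSpace M] [ChartedSpace HM M]
  {𝓗 : LieGroupoid IH H IN N} {𝓖 : LieGroupoid IG G IM M} {k : ℕ} {J : Set ℝ}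

namespace LieGroupoid

variable (𝓖) in
theorem eq_inv_of_mul_eq_u {g h : G} (hgh : 𝓖.s g = 𝓖.t h) (h1 : 𝓖.mul g h = 𝓖.u (𝓖.t g)) :
    h = 𝓖.inv g := by
  have h2 := 𝓖.inv_mul_cancel_left hgh
  rw [h1, ← 𝓖.s_inv g, 𝓖.mul_u] at h2
  exact h2.symm

variable (𝓖) in
theorem inv_inv (g : G) : 𝓖.inv (𝓖.inv g) = g :=
  (𝓖.eq_inv_of_mul_eq_u (𝓖.s_inv g) (by rw [𝓖.inv_mul, 𝓖.t_inv])).symm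

variable (𝓖) in
theorem inv_mul_rev {g h : G} (hgh : 𝓖.s g = 𝓖.t h) :
    𝓖.inv (𝓖.mul g h) = 𝓖.mul (𝓖.inv h) (𝓖.inv g) := by
  have e1 : 𝓖.s (𝓖.inv h) = 𝓖.t (𝓖.inv g) := by rw [𝓖.s_inv, 𝓖.t_inv, hgh]
  refine (𝓖.eq_inv_of_mul_eq_u ?_ ?_).symm
  · rw [𝓖.s_mul _ _ hgh, 𝓖.t_mul _ _ e1, 𝓖.t_inv]
  · rw [← 𝓖.mul_assoc _ _ _ (by rw [𝓖.s_mul _ _ hgh, 𝓖.t_inv]) e1,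
      𝓖.mul_inv_cancel_right hgh, 𝓖.mul_inv, 𝓖.t_mul _ _ hgh]

theorem t_conj {σ : M → G} (hσ : ∀ x, 𝓖.s (σ x) = x) (g : G) :
    𝓖.t (𝓖.conj σ g) = 𝓖.t (σ (𝓖.t g)) := by
  unfold conj
  rw [𝓖.t_mul _ _ (by rw [𝓖.s_mul _ _ (hσ _), 𝓖.t_inv, hσ]), 𝓖.t_mul _ _ (hσ _)]

theorem s_conj {σ : M → G} (hσ : ∀ x, 𝓖.s (σ x) = x) (g : G) :
    𝓖.s (𝓖.conj σ g) = 𝓖.t (σ (𝓖.s g)) := by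
  unfold conj
  rw [𝓖.s_mul _ _ (by rw [𝓖.s_mul _ _ (hσ _), 𝓖.t_inv, hσ]), 𝓖.s_inv]

/-- The arrows σ'(x)σ(x)⁻¹ carry I_σ(g) to I_σ'(g). For σ' = σ_{ε+τe_i} and σ = σ_ε they start at
units, and their velocities form the section α. -/
theorem mul_conj_mul {σ σ' : M → G} (hσ : ∀ x, 𝓖.s (σ x) = x) (hσ' : ∀ x, 𝓖.s (σ' x) = x)
    (g : G) :
    𝓖.mul (𝓖.mul (𝓖.mul (σ' (𝓖.t g)) (𝓖.inv (σ (𝓖.t g)))) (𝓖.conj σ g))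
      (𝓖.inv (𝓖.mul (σ' (𝓖.s g)) (𝓖.inv (σ (𝓖.s g))))) = 𝓖.conj σ' g := by
  have a1 : ∀ x, 𝓖.s (σ' x) = 𝓖.t (𝓖.inv (σ x)) := fun x => by rw [𝓖.t_inv, hσ, hσ']
  have a2 : 𝓖.s (𝓖.mul (σ (𝓖.t g)) g) = 𝓖.t (𝓖.inv (σ (𝓖.s g))) := by
    rw [𝓖.s_mul _ _ (hσ _), 𝓖.t_inv, hσ]
  have a2' : 𝓖.s (𝓖.mul (σ' (𝓖.t g)) g) = 𝓖.t (𝓖.inv (σ (𝓖.s g))) := by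
    rw [𝓖.s_mul _ _ (hσ' _), 𝓖.t_inv, hσ]
  have a3 : 𝓖.t (𝓖.mul (σ (𝓖.t g)) g) = 𝓖.t (σ (𝓖.t g)) := 𝓖.t_mul _ _ (hσ _)
  have b1 : 𝓖.mul (𝓖.mul (σ' (𝓖.t g)) (𝓖.inv (σ (𝓖.t g)))) (𝓖.mul (σ (𝓖.t g)) g) =
      𝓖.mul (σ' (𝓖.t g)) g := by
    rw [𝓖.mul_assoc _ _ _ (a1 _) (by rw [𝓖.s_inv, a3]), 𝓖.inv_mul_cancel_left (hσ _)]
  have b2 : 𝓖.mul (𝓖.mul (σ' (𝓖.t g)) (𝓖.inv (σ (𝓖.t g)))) (𝓖.conj σ g) =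
      𝓖.mul (𝓖.mul (σ' (𝓖.t g)) g) (𝓖.inv (σ (𝓖.s g))) := by
    unfold conj
    rw [← 𝓖.mul_assoc _ _ _ (by rw [𝓖.s_mul _ _ (a1 _), 𝓖.s_inv, a3]) a2, b1]
  rw [b2, 𝓖.inv_mul_rev (a1 _), 𝓖.inv_inv,
    𝓖.mul_assoc _ _ _ a2' (by rw [𝓖.s_inv, 𝓖.t_mul _ _ (by rw [𝓖.t_inv, hσ, hσ'])]),
    𝓖.inv_mul_cancel_left (by rw [𝓖.t_inv, hσ, hσ'])]
  rfl

theorem IsMorphism.comp {F F' : H → H} {f f' : N → N} (h : IsMorphism 𝓗 𝓗 F f)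
    (h' : IsMorphism 𝓗 𝓗 F' f') : IsMorphism 𝓗 𝓗 (fun g => F (F' g)) (fun x => f (f' x)) where
  contMDiff := h.contMDiff.comp h'.contMDiff
  contMDiff_base := h.contMDiff_base.comp h'.contMDiff_base
  map_s g := by rw [h.map_s, h'.map_s]
  map_t g := by rw [h.map_t, h'.map_t]
  map_u x := by rw [h'.map_u, h.map_u]
  map_mul g g' hg := by
    rw [h'.map_mul _ _ hg, h.map_mul _ _ (by rw [h'.map_s, h'.map_t, hg])]

/-- The velocity field of a family of endomorphisms is multiplicative. -/
theorem isMultiplicative_of_hasVelocity {c : ℝ → H → H} {Y : H → EH}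
    (hc : ∀ᶠ τ in 𝓝 0, ∃ b, IsMorphism 𝓗 𝓗 (c τ) b) (h0 : ∀ h, c 0 h = h)
    (hY : ∀ h, HasVelocity IH (fun τ => c τ h) (Y h) 0) : 𝓗.IsMultiplicative Y := by
  have hs : ∀ h, HasVelocity IN (fun τ => 𝓗.s (c τ h)) (tder IH IN 𝓗.s h (Y h)) 0 := by
    intro h
    have := (hY h).map (𝓗.mdifferentiableAt_s _)
    rwa [h0] at this
  have ht : ∀ h, HasVelocity IN (fun τ => 𝓗.t (c τ h)) (tder IH IN 𝓗.t h (Y h)) 0 := by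
    intro h
    have := (hY h).map (𝓗.mdifferentiableAt_t _)
    rwa [h0] at this
  refine ⟨fun x => (tder IH IN 𝓗.s (𝓗.u x) (Y (𝓗.u x)) : EN), fun g => ?_, fun g => ?_,
    fun x => ?_, fun g h hgh => ?_⟩
  · refine (hs g).unique ((hs _).congr_of_eventuallyEq ?_)
    filter_upwards [hc] with τ ⟨b, hb⟩
    rw [hb.map_s, hb.map_s, 𝓗.s_u]
  · refine (ht g).unique ((hs _).congr_of_eventuallyEq ?_)
    filter_upwards [hc] with τ ⟨b, hb⟩
    rw [hb.map_t, hb.map_s, 𝓗.s_u]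
  · have h1 := (hs (𝓗.u x)).map (𝓗.mdifferentiableAt_u _)
    rw [h0, 𝓗.s_u] at h1
    refine (hY (𝓗.u x)).unique (h1.congr_of_eventuallyEq ?_)
    filter_upwards [hc] with τ ⟨b, hb⟩
    rw [hb.map_u, 𝓗.s_u]
  · have h1 := 𝓗.hasVelocity_mul (h0 g) (h0 h) (hY g) (hY h) (by
      filter_upwards [hc] with τ ⟨b, hb⟩
      rw [hb.map_s, hb.map_t, hgh])
    refine (hY (𝓗.mul g h)).unique (h1.congr_of_eventuallyEq ?_)
    filter_upwards [hc] with τ ⟨b, hb⟩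
    exact hb.map_mul _ _ hgh

/-- The derivative of γ(τ) 1_{s(g)} = γ(τ). -/
theorem dMul_u {γ : ℝ → G} {v : EG} {g : G} (hγ : HasVelocity IG γ v 0) (h0 : γ 0 = g)
    (hs : ∀ᶠ τ in 𝓝 0, 𝓖.s (γ τ) = 𝓖.s g) : 𝓖.dMul g (𝓖.u (𝓖.s g)) (v, 0) = v := by
  have h1 := 𝓖.hasVelocity_mul h0 rfl hγ (HasVelocity.const (𝓖.u (𝓖.s g)) 0)
    (by filter_upwards [hs] with τ h; rw [h, 𝓖.t_u])
  refine h1.unique (hγ.congr_of_eventuallyEq ?_)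
  filter_upwards [hs] with τ h
  rw [← h, 𝓖.mul_u]

/-- The inverses are given separately for each ε; their joint smoothness comes from the inverse
function theorem with parameters. The same applies to t ∘ σ_ε below. -/
theorem SmoothAutomorphisms.exists_inverse [IH.Boundaryless] [IsManifold IH ∞ H] [CompleteSpace EH]
    (hJ : IsOpen J) {F : H × (Fin k → ℝ) → H} (hF : 𝓗.SmoothAutomorphisms J F) :
    ∃ F' : H × (Fin k → ℝ) → H, SmoothFamily IH IH J F' ∧ ∀ ε ∈ cube k J,
      (∃ f', IsMorphism 𝓗 𝓗 (fun h => F' (h, ε)) f') ∧ (∀ h, F' (F (h, ε), ε) = h) ∧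
        ∀ h, F (F' (h, ε), ε) = h := by
  have i1 : Nonempty (H → H) := ⟨id⟩
  have i2 : Nonempty (N → N) := ⟨id⟩
  choose! f F' f' h1 h2 h3 h4 using hF.2
  exact ⟨fun p => F' p.2 p.1, hF.1.inverse hJ (fun ε hε => (h2 ε hε).contMDiff)
    (fun ε hε => h3 ε hε) (fun ε hε => h4 ε hε), fun ε hε => ⟨⟨_, h2 ε hε⟩, h3 ε hε, h4 ε hε⟩⟩

theorem SmoothBisections.exists_inverse [IM.Boundaryless] [IsManifold IM ∞ M] [CompleteSpace EM]
    (hJ : IsOpen J) {σ : M × (Fin k → ℝ) → G} (hσ : 𝓖.SmoothBisections J σ) :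
    ∃ z : M × (Fin k → ℝ) → M, SmoothFamily IM IM J z ∧ ∀ ε ∈ cube k J, ∀ x,
      z (𝓖.t (σ (x, ε)), ε) = x ∧ 𝓖.t (σ (z (x, ε), ε)) = x := by
  have i1 : Nonempty (Diffeomorph IM IM M M ∞) := ⟨Diffeomorph.refl IM M ∞⟩
  have h := fun ε hε => (hσ.2 ε hε).2.2
  choose! e he using h
  have h1 : ∀ ε ∈ cube k J, ∀ x, (e ε).symm (𝓖.t (σ (x, ε))) = x := fun ε hε x => by
    rw [← he ε hε, Diffeomorph.symm_apply_apply]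
  have h2 : ∀ ε ∈ cube k J, ∀ x, 𝓖.t (σ ((e ε).symm x, ε)) = x := fun ε hε x => by
    rw [← he ε hε, Diffeomorph.apply_symm_apply]
  have h3 : SmoothFamily IM IM J fun p : M × (Fin k → ℝ) => 𝓖.t (σ p) :=
    𝓖.contMDiff_t.comp_contMDiffOn hσ.1
  exact ⟨fun p => (e p.2).symm p.1, h3.inverse hJ (fun ε hε => (e ε).symm.contMDiff) h1 h2,
    fun ε hε x => ⟨h1 ε hε x, h2 ε hε x⟩⟩

variable [IH.Boundaryless] [IsManifold IH ∞ H] [CompleteSpace EH]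
  [IM.Boundaryless] [IsManifold IM ∞ M] [CompleteSpace EM] [IsManifold IG ∞ G]

/-- If `Φ_ε ∘ F_ε = I_{σ_ε} ∘ Ψ_ε`, where `Ψ_ε` does not depend on `ε_i`, then the derivative of
`Φ` in the direction `e_i` is a coboundary, smoothly. -/
theorem exists_cohomological_solution (hJ : IsOpen J) (i : Fin k) {Φ₀ : H → G} {φ₀ : N → M}
    {Φ : H × (Fin k → ℝ) → G}
    {φ : N × (Fin k → ℝ) → M} (hΦ : IsKDeformation 𝓗 𝓖 J Φ₀ φ₀ Φ φ) {F : H × (Fin k → ℝ) → H}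
    (hF : 𝓗.SmoothAutomorphisms J F) {σ : M × (Fin k → ℝ) → G} (hσ : 𝓖.SmoothBisections J σ)
    {Ψ : H → (Fin k → ℝ) → G} (hΨ : ∀ h ε (τ : ℝ), Ψ h (ε + τ • Pi.single i 1) = Ψ h ε)
    (heq : ∀ ε ∈ cube k J, ∀ h, Φ (F (h, ε), ε) = 𝓖.conj (fun x => σ (x, ε)) (Ψ h ε)) :
    ∃ (Y : (Fin k → ℝ) → H → EH) (α : (Fin k → ℝ) → M → EG),
      SmoothVectorFields IH J Y ∧ (∀ ε ∈ cube k J, 𝓗.IsMultiplicative (Y ε)) ∧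
      𝓖.SmoothAlgebroidSections J α ∧ ∀ ε ∈ cube k J, ∀ h : H,
        paramDeriv IG Φ i ε h = mfderiv IH IG (fun h' => Φ (h', ε)) h (Y ε h) +
            delta 𝓗 𝓖 (fun h' => Φ (h', ε)) (fun x => φ (x, ε))
              (fun x => α ε (φ (x, ε))) h := by
  obtain ⟨F', hF's, hF'⟩ := hF.exists_inverse hJ
  obtain ⟨z, hzs, hz⟩ := hσ.exists_inverse hJ
  have hsσ : ∀ ε ∈ cube k J, ∀ x, 𝓖.s (σ (x, ε)) = x := fun ε hε => (hσ.2 ε hε).2.1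
  let v : Fin k → ℝ := Pi.single i 1
  -- C is F_ε ∘ F_e⁻¹ and B is the arrow σ_e(x)σ_ε(x)⁻¹ with source y = t(σ_ε(x)). At e = ε they are
  -- the identity and the unit; Y and α are their derivatives in e at that point.
  let C : (H × (Fin k → ℝ)) × (Fin k → ℝ) → H := fun p => F (F' (p.1.1, p.2), p.1.2)
  let B : (M × (Fin k → ℝ)) × (Fin k → ℝ) → G := fun p =>
    𝓖.mul (σ (z p.1, p.2)) (𝓖.inv (σ (z p.1, p.1.2)))
  have hC : ∀ ε ∈ cube k J, ∀ e ∈ cube k J, ∀ h,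
      ContMDiffAt ((IH.prod 𝓘(ℝ, Fin k → ℝ)).prod 𝓘(ℝ, Fin k → ℝ)) IH ∞ C ((h, ε), e) := by
    intro ε hε e he h
    have k1 : ContMDiffAt ((IH.prod 𝓘(ℝ, Fin k → ℝ)).prod 𝓘(ℝ, Fin k → ℝ))
        (IH.prod 𝓘(ℝ, Fin k → ℝ)) ∞
        (fun p : (H × (Fin k → ℝ)) × (Fin k → ℝ) => p.1) ((h, ε), e) := contMDiffAt_fst
    have h1 : ContMDiffAt ((IH.prod 𝓘(ℝ, Fin k → ℝ)).prod 𝓘(ℝ, Fin k → ℝ)) IH ∞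
        (fun p : (H × (Fin k → ℝ)) × (Fin k → ℝ) => F' (p.1.1, p.2)) ((h, ε), e) :=
      (hF's.contMDiffAt hJ he h).comp ((h, ε), e) (k1.fst.prodMk contMDiffAt_snd)
    exact (hF.1.contMDiffAt hJ hε _).comp ((h, ε), e) (h1.prodMk k1.snd)
  have hBc : ∀ ε ∈ cube k J, ∀ e ∈ cube k J, ∀ y,
      𝓖.s (σ (z (y, ε), e)) = 𝓖.t (𝓖.inv (σ (z (y, ε), ε))) := by
    intro ε hε e he y
    rw [𝓖.t_inv, hsσ e he, hsσ ε hε]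
  have hB : ∀ ε ∈ cube k J, ∀ e ∈ cube k J, ∀ y,
      ContMDiffAt ((IM.prod 𝓘(ℝ, Fin k → ℝ)).prod 𝓘(ℝ, Fin k → ℝ)) IG ∞ B ((y, ε), e) := by
    intro ε hε e he y
    have k1 : ContMDiffAt ((IM.prod 𝓘(ℝ, Fin k → ℝ)).prod 𝓘(ℝ, Fin k → ℝ))
        (IM.prod 𝓘(ℝ, Fin k → ℝ)) ∞
        (fun p : (M × (Fin k → ℝ)) × (Fin k → ℝ) => p.1) ((y, ε), e) := contMDiffAt_fst
    have h1 : ContMDiffAt ((IM.prod 𝓘(ℝ, Fin k → ℝ)).prod 𝓘(ℝ, Fin k → ℝ)) IM ∞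
        (fun p : (M × (Fin k → ℝ)) × (Fin k → ℝ) => z p.1) ((y, ε), e) :=
      (hzs.contMDiffAt hJ hε y).comp ((y, ε), e) k1
    have h2 : ContMDiffAt ((IM.prod 𝓘(ℝ, Fin k → ℝ)).prod 𝓘(ℝ, Fin k → ℝ)) IG ∞
        (fun p : (M × (Fin k → ℝ)) × (Fin k → ℝ) => σ (z p.1, p.2)) ((y, ε), e) :=
      (hσ.1.contMDiffAt hJ he _).comp ((y, ε), e) (h1.prodMk contMDiffAt_snd)
    have h3 : ContMDiffAt ((IM.prod 𝓘(ℝ, Fin k → ℝ)).prod 𝓘(ℝ, Fin k → ℝ)) IG ∞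
        (fun p : (M × (Fin k → ℝ)) × (Fin k → ℝ) => σ (z p.1, p.1.2)) ((y, ε), e) :=
      (hσ.1.contMDiffAt hJ hε _).comp ((y, ε), e) (h1.prodMk k1.snd)
    refine 𝓖.contMDiffAt_mul h2 (𝓖.contMDiff_inv.contMDiffAt.comp _ h3) ?_
    have e1 : ∀ᶠ p : (M × (Fin k → ℝ)) × (Fin k → ℝ) in 𝓝 ((y, ε), e), p.1.2 ∈ cube k J :=
      (continuous_snd.comp continuous_fst).continuousAt.preimage_mem_nhds
        ((isOpen_cube hJ).mem_nhds hε)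
    have e2 : ∀ᶠ p : (M × (Fin k → ℝ)) × (Fin k → ℝ) in 𝓝 ((y, ε), e), p.2 ∈ cube k J :=
      continuousAt_snd.preimage_mem_nhds ((isOpen_cube hJ).mem_nhds he)
    filter_upwards [e1, e2] with p k1 k2
    exact hBc _ k1 _ k2 p.1.1
  have hC0 : ∀ ε ∈ cube k J, ∀ h, C ((h, ε), ε) = h := fun ε hε h => (hF' ε hε).2.2 h
  have hB0 : ∀ ε ∈ cube k J, ∀ y, B ((y, ε), ε) = 𝓖.u y := fun ε hε y => by
    show 𝓖.mul (σ (z (y, ε), ε)) (𝓖.inv (σ (z (y, ε), ε))) = _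
    rw [𝓖.mul_inv, (hz ε hε y).2]
  have hBs : ∀ ε ∈ cube k J, ∀ e ∈ cube k J, ∀ y, 𝓖.s (B ((y, ε), e)) = y := by
    intro ε hε e he y
    show 𝓖.s (𝓖.mul (σ (z (y, ε), e)) (𝓖.inv (σ (z (y, ε), ε)))) = y
    rw [𝓖.s_mul _ _ (hBc ε hε e he y), 𝓖.s_inv, (hz ε hε y).2]
  let Y : (Fin k → ℝ) → H → EH := fun ε h =>
    tder 𝓘(ℝ, Fin k → ℝ) IH (fun e => C ((h, ε), e)) ε v
  let α : (Fin k → ℝ) → M → EG := fun ε y =>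
    tder 𝓘(ℝ, Fin k → ℝ) IG (fun e => B ((y, ε), e)) ε v
  have hline : ∀ ε ∈ cube k J, ∀ᶠ τ : ℝ in 𝓝 0, ε + τ • v ∈ cube k J := fun ε hε =>
    (tendsto_line ε v).eventually ((isOpen_cube hJ).mem_nhds hε)
  have hYv : ∀ ε ∈ cube k J, ∀ h,
      HasVelocity IH (fun τ : ℝ => C ((h, ε), ε + τ • v)) (Y ε h) 0 := fun ε hε h =>
    hasVelocity_line ((hC ε hε ε hε h).slice_right.mdifferentiableAt (by simp)) v
  have hαv : ∀ ε ∈ cube k J, ∀ y,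
      HasVelocity IG (fun τ : ℝ => B ((y, ε), ε + τ • v)) (α ε y) 0 := fun ε hε y =>
    hasVelocity_line ((hB ε hε ε hε y).slice_right.mdifferentiableAt (by simp)) v
  have hB0' : ∀ ε ∈ cube k J, ∀ y, B ((y, ε), ε + (0 : ℝ) • v) = 𝓖.u y := fun ε hε y => by
    rw [zero_smul, add_zero, hB0 ε hε]
  refine ⟨Y, α, ?_, fun ε hε => ?_, ⟨fun ε hε y => ?_, ?_⟩, fun ε hε h => ?_⟩
  · rintro ⟨h, ε⟩ ⟨-, hε⟩
    refine ContMDiffAt.contMDiffWithinAt ?_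
    refine (contMDiffAt_paramVelocity (A := C) (p := fun q : H × (Fin k → ℝ) => q.2)
      (x₀ := (h, ε)) (hC ε hε ε hε h) contMDiffAt_snd v).congr_of_eventuallyEq ?_
    have e1 : ∀ᶠ p : H × (Fin k → ℝ) in 𝓝 (h, ε), p.2 ∈ cube k J :=
      continuousAt_snd.preimage_mem_nhds ((isOpen_cube hJ).mem_nhds hε)
    filter_upwards [e1] with p hp
    exact TangentBundle.mk_congr (hC0 _ hp p.1).symm rfl
  · refine isMultiplicative_of_hasVelocity (c := fun τ h => C ((h, ε), ε + τ • v)) ?_ (fun h => ?_)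
      (hYv ε hε)
    · filter_upwards [hline ε hε] with τ hτ
      obtain ⟨f, -, -, hf, -⟩ := hF.2 ε hε
      obtain ⟨f', hf'⟩ := (hF' _ hτ).1
      exact ⟨_, hf.comp hf'⟩
    · show C ((h, ε), ε + (0 : ℝ) • v) = h
      rw [zero_smul, add_zero, hC0 ε hε]
  · have h1 := (hαv ε hε y).map (𝓖.mdifferentiableAt_s _)
    rw [hB0' ε hε] at h1
    refine h1.eq_zero_of_const (x := y) ?_
    filter_upwards [hline ε hε] with τ hτ
    exact hBs ε hε _ hτ y
  · rintro ⟨y, ε⟩ ⟨-, hε⟩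
    refine ContMDiffAt.contMDiffWithinAt ?_
    refine (contMDiffAt_paramVelocity (A := B) (p := fun q : M × (Fin k → ℝ) => q.2)
      (x₀ := (y, ε)) (hB ε hε ε hε y) contMDiffAt_snd v).congr_of_eventuallyEq ?_
    have e1 : ∀ᶠ p : M × (Fin k → ℝ) in 𝓝 (y, ε), p.2 ∈ cube k J :=
      continuousAt_snd.preimage_mem_nhds ((isOpen_cube hJ).mem_nhds hε)
    filter_upwards [e1] with p hp
    exact TangentBundle.mk_congr (hB0 _ hp p.1).symm rfl
  · have hm := hΦ.isMorphism ε hε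
    let c : ℝ → H := fun τ => C ((h, ε), ε + τ • v)
    have hc0 : c 0 = h := by
      show C ((h, ε), ε + (0 : ℝ) • v) = h
      rw [zero_smul, add_zero, hC0 ε hε]
    let w : ℝ → G := fun τ => Φ (c τ, ε)
    set g : G := Φ (h, ε) with hg
    have hw0 : w 0 = g := by
      show Φ (c 0, ε) = _
      rw [hc0]
    -- The first variable moves the conjugating arrows, the second the argument of Φ_ε. On the
    -- diagonal W is Φ_{ε+τv}(h), and its partial velocities at the origin are δ(α) and dΦ_ε(Y).
    let W : ℝ × ℝ → G := fun p => 𝓖.mul (𝓖.mul (B ((𝓖.t (w p.2), ε), ε + p.1 • v)) (w p.2))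
      (𝓖.inv (B ((𝓖.s (w p.2), ε), ε + p.1 • v)))
    have hl1 : ∀ᶠ p : ℝ × ℝ in 𝓝 (0, 0), ε + p.1 • v ∈ cube k J :=
      (continuousAt_fst (p := ((0, 0) : ℝ × ℝ))).eventually (hline ε hε)
    have hc1 : ∀ᶠ p : ℝ × ℝ in 𝓝 (0, 0),
        𝓖.s (B ((𝓖.t (w p.2), ε), ε + p.1 • v)) = 𝓖.t (w p.2) :=
      hl1.mono fun p hp => hBs ε hε _ hp _
    have hc2 : ∀ᶠ p : ℝ × ℝ in 𝓝 (0, 0),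
        𝓖.s (𝓖.mul (B ((𝓖.t (w p.2), ε), ε + p.1 • v)) (w p.2)) =
          𝓖.t (𝓖.inv (B ((𝓖.s (w p.2), ε), ε + p.1 • v))) := by
      filter_upwards [hc1, hl1] with p h1 h2
      rw [𝓖.s_mul _ _ h1, 𝓖.t_inv, hBs ε hε _ h2]
    have hws : ContMDiffAt 𝓘(ℝ, ℝ) IG ∞ w 0 := by
      have h1 : ContMDiffAt 𝓘(ℝ, ℝ) IH ∞ c 0 := by
        have h2 : ContMDiffAt 𝓘(ℝ, Fin k → ℝ) IH ∞ (fun e => C ((h, ε), e)) (ε + (0 : ℝ) • v) := by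
          rw [zero_smul, add_zero]
          exact (hC ε hε ε hε h).slice_right
        exact ContMDiffAt.comp (g := fun e => C ((h, ε), e)) (f := fun τ : ℝ => ε + τ • v) (0 : ℝ) h2
          (contMDiff_line ε v).contMDiffAt
      exact hm.contMDiff.contMDiffAt.comp 0 h1
    have hWs : ContMDiffAt 𝓘(ℝ, ℝ × ℝ) IG ∞ W (0, 0) := by
      have h1 : ContMDiffAt 𝓘(ℝ, ℝ × ℝ) IG ∞ (fun p : ℝ × ℝ => w p.2) (0, 0) :=
        ContMDiffAt.comp (g := w) (f := fun p : ℝ × ℝ => p.2) ((0, 0) : ℝ × ℝ) hws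
          contDiff_snd.contMDiff.contMDiffAt
      have h2 : ContMDiffAt 𝓘(ℝ, ℝ × ℝ) 𝓘(ℝ, Fin k → ℝ) ∞ (fun p : ℝ × ℝ => ε + p.1 • v) (0, 0) :=
        (contDiff_const.add (contDiff_fst.smul contDiff_const)).contMDiff.contMDiffAt
      have h3 : ∀ y : ℝ × ℝ → M, ContMDiffAt 𝓘(ℝ, ℝ × ℝ) IM ∞ y (0, 0) →
          ContMDiffAt 𝓘(ℝ, ℝ × ℝ) IG ∞ (fun p => B ((y p, ε), ε + p.1 • v)) (0, 0) := by
        intro y hy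
        have h4 : ContMDiffAt ((IM.prod 𝓘(ℝ, Fin k → ℝ)).prod 𝓘(ℝ, Fin k → ℝ)) IG ∞ B
            ((y (0, 0), ε), ε + (0 : ℝ) • v) := by
          rw [zero_smul, add_zero]
          exact hB ε hε ε hε _
        exact h4.comp ((0, 0) : ℝ × ℝ) ((hy.prodMk contMDiffAt_const).prodMk h2)
      refine 𝓖.contMDiffAt_mul (𝓖.contMDiffAt_mul (h3 _ ?_) h1 hc1)
        (𝓖.contMDiff_inv.contMDiffAt.comp _ (h3 _ ?_)) hc2
      · exact 𝓖.contMDiff_t.contMDiffAt.comp _ h1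
      · exact 𝓖.contMDiff_s.contMDiffAt.comp _ h1
    have hW1 : HasVelocity IG (fun a => W (a, 0))
        ((𝓖.rightTranslate g (𝓖.t g) (α ε (𝓖.t g)) : EG) +
          (𝓖.leftTranslate g (𝓖.s g) (𝓖.dInv (𝓖.s g) (α ε (𝓖.s g))) : EG)) 0 := by
      have hs1 : ∀ᶠ τ : ℝ in 𝓝 0, 𝓖.s (B ((𝓖.t g, ε), ε + τ • v)) = 𝓖.t g :=
        (hline ε hε).mono fun τ hτ => hBs ε hε _ hτ _
      have hs2 : ∀ᶠ τ : ℝ in 𝓝 0, 𝓖.s (𝓖.mul (B ((𝓖.t g, ε), ε + τ • v)) g) = 𝓖.s g :=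
        hs1.mono fun τ hτ => 𝓖.s_mul _ _ hτ
      have h1 := 𝓖.hasVelocity_rightTranslate (hB0' ε hε _) (hαv ε hε (𝓖.t g)) hs1
      have h2 := 𝓖.hasVelocity_inv (hB0' ε hε _) (hαv ε hε (𝓖.s g))
      have e1 : 𝓖.mul (B ((𝓖.t g, ε), ε + (0 : ℝ) • v)) g = g := by
        rw [hB0' ε hε, 𝓖.u_mul]
      have h3 := 𝓖.hasVelocity_mul e1 (by rw [hB0' ε hε, 𝓖.inv_u]) h1 h2 (by
        filter_upwards [hs2, hline ε hε] with τ k1 k2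
        rw [k1, 𝓖.t_inv, hBs ε hε _ k2])
      have h4 := h3.congr_velocity ((𝓖.dMul_add _ _ _ _).trans
        (congrArg (fun d : EG => d + _) (dMul_u h1 e1 hs2)))
      show HasVelocity IG (fun a => 𝓖.mul (𝓖.mul (B ((𝓖.t (w 0), ε), ε + a • v)) (w 0))
        (𝓖.inv (B ((𝓖.s (w 0), ε), ε + a • v)))) _ 0
      rw [hw0]
      exact h4
    have hW2 : HasVelocity IG (fun b => W (0, b))
        (tder IH IG (fun h' => Φ (h', ε)) h (Y ε h)) 0 := by
      have h1 := (hYv ε hε h).map (f := fun h' => Φ (h', ε))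
        (hm.contMDiff.mdifferentiableAt (by simp))
      have e1 : C ((h, ε), ε + (0 : ℝ) • v) = h := hc0
      rw [e1] at h1
      refine h1.congr_of_eventuallyEq (Filter.Eventually.of_forall fun b => ?_)
      show 𝓖.mul (𝓖.mul (B ((𝓖.t (w b), ε), ε + (0 : ℝ) • v)) (w b))
        (𝓖.inv (B ((𝓖.s (w b), ε), ε + (0 : ℝ) • v))) = w b
      rw [hB0' ε hε, hB0' ε hε, 𝓖.u_mul, 𝓖.inv_u, 𝓖.mul_u]
    have hW := HasVelocity.diag (hWs.mdifferentiableAt (by simp)) hW1 hW2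
    have hP : HasVelocity IG (fun τ : ℝ => Φ (h, ε + τ • v))
        (tder 𝓘(ℝ, Fin k → ℝ) IG (fun e => Φ (h, e)) ε v) 0 :=
      hasVelocity_line ((hΦ.smooth.contMDiffAt hJ hε h).slice_right.mdifferentiableAt (by simp)) v
    -- With x = F_{ε+τv}⁻¹(h), both Φ_{ε+τv}(h) and w(τ) are conjugates of the same arrow Ψ(x),
    -- because Ψ does not depend on ε_i; `mul_conj_mul` relates them.
    have hfin := hP.unique (hW.congr_of_eventuallyEq (by
      filter_upwards [hline ε hε] with τ hτ
      set x := F' (h, ε + τ • v) with hx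
      have k1 : F (x, ε + τ • v) = h := (hF' _ hτ).2.2 h
      have k2 : w τ = 𝓖.conj (fun x => σ (x, ε)) (Ψ x ε) := heq ε hε x
      have k3 : Φ (h, ε + τ • v) = 𝓖.conj (fun y => σ (y, ε + τ • v)) (Ψ x ε) := by
        rw [← hΨ x ε τ, ← heq _ hτ x, k1]
      rw [k3, ← mul_conj_mul (σ := fun x => σ (x, ε)) (hsσ ε hε) (hsσ _ hτ)]
      show _ = 𝓖.mul (𝓖.mul (B ((𝓖.t (w τ), ε), ε + τ • v)) (w τ))
        (𝓖.inv (B ((𝓖.s (w τ), ε), ε + τ • v)))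
      rw [k2, t_conj (hsσ ε hε), s_conj (hsσ ε hε)]
      show _ = 𝓖.mul (𝓖.mul (𝓖.mul (σ (z (𝓖.t (σ (𝓖.t (Ψ x ε), ε)), ε), ε + τ • v))
        (𝓖.inv (σ (z (𝓖.t (σ (𝓖.t (Ψ x ε), ε)), ε), ε)))) _)
        (𝓖.inv (𝓖.mul (σ (z (𝓖.t (σ (𝓖.s (Ψ x ε), ε)), ε), ε + τ • v))
        (𝓖.inv (σ (z (𝓖.t (σ (𝓖.s (Ψ x ε), ε)), ε), ε)))))
      rw [(hz ε hε _).1, (hz ε hε _).1]))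
    have e1 := congrArg (fun y => (𝓖.rightTranslate g y (α ε y) : EG)) (hm.map_t h)
    have e2 := congrArg (fun y => (𝓖.leftTranslate g y (𝓖.dInv y (α ε y)) : EG)) (hm.map_s h)
    exact (hfin.trans (add_comm _ _)).trans (congrArg (fun d : EG => tder IH IG (fun h' => Φ (h', ε)) h (Y ε h) + d)
      (congrArg₂ (fun a b : EG => a + b) e1 e2))

end LieGroupoid

end Infinitesimal

/-! ### Operations on vector fields, line curves and line flows -/

theorem one_mem_timeIoo : (1 : ℝ) ∈ timeIoo := by constructor <;> norm_num

theorem timeIoo_mem_nhds {t : ℝ} (ht : t ∈ timeIoo) : timeIoo ∈ 𝓝 t := isOpen_Ioo.mem_nhds ht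

section LineFields

variable {E HM : Type*} [NormedAddCommGroup E] [NormedSpace ℝ E] [TopologicalSpace HM]
  {I : ModelWithCorners ℝ E HM} {M : Type*} [TopologicalSpace M] [ChartedSpace HM M]
  {E' HM' : Type*} [NormedAddCommGroup E'] [NormedSpace ℝ E'] [TopologicalSpace HM']
  {I' : ModelWithCorners ℝ E' HM'} {M' : Type*} [TopologicalSpace M'] [ChartedSpace HM' M']
  {EX HX : Type*} [NormedAddCommGroup EX] [NormedSpace ℝ EX] [TopologicalSpace HX]
  {IX : ModelWithCorners ℝ EX HX} {X : Type*} [TopologicalSpace X] [ChartedSpace HX X]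
  {k : ℕ} {J : Set ℝ} {Y : Fin k → (Fin k → ℝ) → M → E} {Z : Fin k → (Fin k → ℝ) → M' → E'}
  {ε v : Fin k → ℝ}

omit [TopologicalSpace M] [TopologicalSpace M'] in
theorem map_lineField (L : E →L[ℝ] E') {t : ℝ} {x : M} {y : M'}
    (h : ∀ i, L (Y i (ε + t • v) x) = Z i (ε + t • v) y) :
    L (lineField Y ε v t x) = lineField Z ε v t y := by
  simp only [lineField, map_sum, map_smul, h]

/-- f-relatedness of the fields is only required along γ, where the parameters are known to lie in
the cube. -/
theorem IsLineCurve.map {γ : ℝ → M} (hγ : IsLineCurve I Y ε v γ) {f : M → M'}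
    (hf : ∀ x, MDifferentiableAt I I' f x)
    (h : ∀ i, ∀ t ∈ timeIoo, tder I I' f (γ t) (Y i (ε + t • v) (γ t)) =
      Z i (ε + t • v) (f (γ t))) :
    IsLineCurve I' Z ε v (fun t => f (γ t)) := fun t ht =>
  ((hγ t ht).map (hf _)).congr_velocity (map_lineField _ fun i => h i t ht)

theorem isLineCurve_const (x : M) : IsLineCurve I Y ε 0 (fun _ => x) := fun t _ =>
  (HasVelocity.const x t).congr_velocity (by simp [lineField])

/-- The interval (-1,2) is invariant under t ↦ 1 - t, which exchanges the times 0 and 1. -/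
theorem IsLineCurve.reverse {γ : ℝ → M} (hγ : IsLineCurve I Y ε v γ) :
    IsLineCurve I Y (ε + v) (-v) (fun t => γ (1 - t)) := by
  intro t ht
  have ht' : 1 - t ∈ timeIoo := by
    obtain ⟨h1, h2⟩ := ht
    constructor <;> linarith
  have h1 : HasDerivAt (fun t : ℝ => 1 - t) (-1) t := by
    simpa using (hasDerivAt_id t).const_sub 1
  refine ((hγ _ ht').scomp h1).congr_velocity ?_
  have h2 : ε + v + t • -v = ε + (1 - t) • v := by
    rw [smul_neg, sub_smul, one_smul]
    abel
  simp only [lineField, h2, Finset.smul_sum, Pi.neg_apply, neg_smul, one_smul]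

variable [IsManifold I ∞ M]

theorem ContMDiffAt.tangent_comp [IsManifold I' ∞ M'] {f : X → M} {V : X → E} {x₀ : X}
    (h : ContMDiffAt IX I.tangent ∞ (fun x => (⟨f x, V x⟩ : TangentBundle I M)) x₀) {g : M → M'}
    (hg : ContMDiff I I' ∞ g) :
    ContMDiffAt IX I'.tangent ∞
      (fun x => (⟨g (f x), tder I I' g (f x) (V x)⟩ : TangentBundle I' M')) x₀ := by
  have : IsManifold I 1 M := .of_le (n := ∞) (by simp)
  have : IsManifold I' 1 M' := .of_le (n := ∞) (by simp)
  exact (hg.contMDiff_tangentMap (m := ∞) (by simp)).contMDiffAt.comp x₀ h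

theorem ContMDiffAt.smul_tangent {f : X → M} {V : X → E} {x₀ : X}
    (h : ContMDiffAt IX I.tangent ∞ (fun x => (⟨f x, V x⟩ : TangentBundle I M)) x₀) {χ : X → ℝ}
    (hχ : ContMDiffAt IX 𝓘(ℝ, ℝ) ∞ χ x₀) :
    ContMDiffAt IX I.tangent ∞ (fun x => (⟨f x, χ x • V x⟩ : TangentBundle I M)) x₀ := by
  have hz := mem_extChartAt_source (I := I) (f x₀)
  have h1 := (contMDiffAt_tangent_iff hz).mp h
  refine (contMDiffAt_tangent_iff (V := fun x => χ x • V x) hz).mpr ⟨h1.1, ?_⟩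
  simp only [map_smul]
  exact hχ.smul h1.2

theorem SmoothVectorFields.contMDiffAt {W : (Fin k → ℝ) → M → E} (h : SmoothVectorFields I J W)
    (hJ : IsOpen J) (hε : ε ∈ cube k J) (x : M) :
    ContMDiffAt (I.prod 𝓘(ℝ, Fin k → ℝ)) I.tangent ∞
      (fun p : M × (Fin k → ℝ) => (⟨p.1, W p.2 p.1⟩ : TangentBundle I M)) (x, ε) :=
  ContMDiffOn.contMDiffAt h ((isOpen_univ.prod (isOpen_cube hJ)).mem_nhds ⟨mem_univ _, hε⟩)

theorem SmoothVectorFields.of_contMDiffAt {W : (Fin k → ℝ) → M → E}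
    (h : ∀ ε ∈ cube k J, ∀ x, ContMDiffAt (I.prod 𝓘(ℝ, Fin k → ℝ)) I.tangent ∞
      (fun p : M × (Fin k → ℝ) => (⟨p.1, W p.2 p.1⟩ : TangentBundle I M)) (x, ε)) :
    SmoothVectorFields I J W :=
  fun p hp => (h p.2 hp.2 p.1).contMDiffWithinAt

theorem SmoothVectorFields.mono {W : (Fin k → ℝ) → M → E} (h : SmoothVectorFields I J W)
    {J' : Set ℝ} (hJ' : J' ⊆ J) : SmoothVectorFields I J' W :=
  ContMDiffOn.mono h (prod_mono subset_rfl (cube_mono hJ'))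

theorem SmoothVectorFields.zero : SmoothVectorFields I J (fun _ _ => 0 : (Fin k → ℝ) → M → E) := by
  refine .of_contMDiffAt fun ε _ x => ?_
  refine (contMDiffAt_tangent_iff (f := fun p : M × (Fin k → ℝ) => p.1)
    (V := fun _ => (0 : E)) (mem_extChartAt_source x)).mpr ⟨contMDiffAt_fst, ?_⟩
  simp only [map_zero]
  exact contMDiffAt_const

/-- A family of solutions of the line equations, starting at the points `ι x`. -/
def IsLineFlow (IX : ModelWithCorners ℝ EX HX) (I : ModelWithCorners ℝ E HM) (J : Set ℝ)
    (Y : Fin k → (Fin k → ℝ) → M → E) (ι : X → M) (r : ℝ)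
    (T : X × ((Fin k → ℝ) × (Fin k → ℝ)) → ℝ → M) : Prop :=
  ∀ q ∈ Metric.ball (0 : (Fin k → ℝ) × (Fin k → ℝ)) r,
    (∀ t ∈ timeIoo, q.1 + t • q.2 ∈ cube k J) ∧
    ∀ x, T (x, q) 0 = ι x ∧ IsLineCurve I Y q.1 q.2 (T (x, q)) ∧
      ∀ t ∈ timeIoo, ContMDiffAt (IX.prod 𝓘(ℝ, (Fin k → ℝ) × (Fin k → ℝ))) I ∞
        (fun p => T p t) (x, q)

section Flow

variable {r : ℝ} {q : (Fin k → ℝ) × (Fin k → ℝ)}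

omit [IsManifold I ∞ M] in
theorem IsLineFlow.mono {ι : X → M} {T : X × ((Fin k → ℝ) × (Fin k → ℝ)) → ℝ → M}
    (hT : IsLineFlow IX I J Y ι r T) {r' : ℝ} (hr : r' ≤ r) : IsLineFlow IX I J Y ι r' T :=
  fun q hq => hT q (Metric.ball_subset_ball hr hq)

omit [IsManifold I ∞ M] in
theorem IsLineFlow.smoothFamily {ι : X → M} {T : X × ((Fin k → ℝ) × (Fin k → ℝ)) → ℝ → M}
    (hT : IsLineFlow IX I J Y ι r T) {J' : Set ℝ}
    {Q : (Fin k → ℝ) → (Fin k → ℝ) × (Fin k → ℝ)} (hQ : ContDiff ℝ ∞ Q)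
    (hQr : ∀ ε ∈ cube k J', Q ε ∈ Metric.ball 0 r) :
    SmoothFamily IX I J' (fun p => T (p.1, Q p.2) 1) := by
  refine .of_contMDiffAt fun ε hε x => ?_
  have h1 : ContMDiffAt (IX.prod 𝓘(ℝ, Fin k → ℝ)) (IX.prod 𝓘(ℝ, (Fin k → ℝ) × (Fin k → ℝ))) ∞
      (fun p : X × (Fin k → ℝ) => (p.1, Q p.2)) (x, ε) :=
    contMDiffAt_fst.prodMk (hQ.contMDiff.contMDiffAt.comp (x, ε) contMDiffAt_snd)
  exact ContMDiffAt.comp (g := fun p => T p 1) (x, ε)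
    (((hT _ (hQr ε hε)).2 x).2.2 1 one_mem_timeIoo) h1

/-- By uniqueness the flow along the reversed line retraces the curve, so time-one maps have
time-one maps as inverses. -/
theorem IsLineFlow.reverse_apply [T2Space M] [I.Boundaryless] (hJ : IsOpen J)
    (hY : ∀ i, SmoothVectorFields I J (Y i))
    {T : M × ((Fin k → ℝ) × (Fin k → ℝ)) → ℝ → M} (hT : IsLineFlow I I J Y id r T)
    (hq : q ∈ Metric.ball 0 r) (hq' : (q.1 + q.2, -q.2) ∈ Metric.ball 0 r) (x : M) :
    T (T (x, q) 1, (q.1 + q.2, -q.2)) 1 = x := by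
  have h1 := ((hT q hq).2 x).2.1.reverse
  have h2 := (hT _ hq').2 (T (x, q) 1)
  have h3 := h2.2.1.eqOn hJ hY h1 (hT _ hq').1 (by rw [h2.1, sub_zero]; rfl) one_mem_timeIoo
  refine h3.trans ?_
  show T (x, q) (1 - 1) = x
  rw [sub_self]
  exact ((hT q hq).2 x).1

end Flow

end LineFields

/-! ### Flows of multiplicative and of right-invariant vector fields -/

section Groupoid

variable {EG HG EM HM : Type*}
  [NormedAddCommGroup EG] [NormedSpace ℝ EG] [TopologicalSpace HG]
  [NormedAddCommGroup EM] [NormedSpace ℝ EM] [TopologicalSpace HM]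
  {IG : ModelWithCorners ℝ EG HG} {G : Type*} [TopologicalSpace G] [ChartedSpace HG G]
  {IM : ModelWithCorners ℝ EM HM} {M : Type*} [TopologicalSpace M] [ChartedSpace HM M]
  {𝓖 : LieGroupoid IG G IM M} {k : ℕ} {J : Set ℝ} {ε v : Fin k → ℝ}

namespace LieGroupoid

section Multiplicative

/-- The vector field on the base which underlies a multiplicative vector field. -/
def baseField (𝓖 : LieGroupoid IG G IM M) (Y : G → EG) (x : M) : EM :=
  tder IG IM 𝓖.s (𝓖.u x) (Y (𝓖.u x))

theorem IsMultiplicative.baseField {Y : G → EG} (h : 𝓖.IsMultiplicative Y) :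
    (∀ g, tder IG IM 𝓖.s g (Y g) = 𝓖.baseField Y (𝓖.s g)) ∧
    (∀ g, tder IG IM 𝓖.t g (Y g) = 𝓖.baseField Y (𝓖.t g)) ∧
    (∀ x, Y (𝓖.u x) = tder IM IG 𝓖.u x (𝓖.baseField Y x)) ∧
    ∀ g h, 𝓖.s g = 𝓖.t h → Y (𝓖.mul g h) = 𝓖.dMul g h (Y g, Y h) := by
  obtain ⟨y, h1, h2, h3, h4⟩ := h
  have hy : ∀ x, 𝓖.baseField Y x = y x := fun x =>
    (h1 (𝓖.u x)).trans (congrArg (fun z => (y z : EM)) (𝓖.s_u x))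
  refine ⟨fun g => (h1 g).trans (hy _).symm, fun g => (h2 g).trans (hy _).symm, fun x => ?_, h4⟩
  rw [hy]
  exact h3 x

theorem IsMultiplicative.neg {Y : G → EG} (h : 𝓖.IsMultiplicative Y) :
    𝓖.IsMultiplicative fun g => (-Y g : EG) := by
  obtain ⟨h1, h2, h3, h4⟩ := h.baseField
  refine ⟨fun x => (-𝓖.baseField Y x : EM), fun g => ?_, fun g => ?_, fun x => ?_,
    fun g h hgh => ?_⟩
  · exact ((tder IG IM 𝓖.s g).map_neg _).trans (congrArg Neg.neg (h1 g))
  · exact ((tder IG IM 𝓖.t g).map_neg _).trans (congrArg Neg.neg (h2 g))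
  · exact (congrArg Neg.neg (h3 x)).trans ((tder IM IG 𝓖.u x).map_neg _).symm
  · exact (congrArg Neg.neg (h4 g h hgh)).trans ((𝓖.dMul g h).map_neg _).symm

variable [IG.Boundaryless] [IsManifold IG ∞ G] [IM.Boundaryless] [IsManifold IM ∞ M]

omit [IG.Boundaryless] [IM.Boundaryless] in
-- Multiplicativity only asserts that some base field exists. The formula ds(Y) along the units
-- makes it smooth in ε, so that uniqueness of integral curves applies on the base.
theorem smoothVectorFields_baseField (hJ : IsOpen J) {Y : (Fin k → ℝ) → G → EG}
    (hY : SmoothVectorFields IG J Y) : SmoothVectorFields IM J fun ε => 𝓖.baseField (Y ε) := by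
  refine .of_contMDiffAt fun ε hε x => ?_
  have h1 : ContMDiffAt (IM.prod 𝓘(ℝ, Fin k → ℝ)) IG.tangent ∞
      (fun p : M × (Fin k → ℝ) => (⟨𝓖.u p.1, Y p.2 (𝓖.u p.1)⟩ : TangentBundle IG G)) (x, ε) := by
    have h2 : ContMDiffAt (IM.prod 𝓘(ℝ, Fin k → ℝ)) (IG.prod 𝓘(ℝ, Fin k → ℝ)) ∞
        (fun p : M × (Fin k → ℝ) => (𝓖.u p.1, p.2)) (x, ε) :=
      (𝓖.contMDiff_u.contMDiffAt.comp _ contMDiffAt_fst).prodMk contMDiffAt_snd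
    exact ContMDiffAt.comp (x, ε) (hY.contMDiffAt hJ hε (𝓖.u x)) h2
  refine (h1.tangent_comp 𝓖.contMDiff_s).congr_of_eventuallyEq
    (Filter.Eventually.of_forall fun p => ?_)
  exact TangentBundle.mk_congr (𝓖.s_u p.1).symm rfl

/-- The flow of a multiplicative vector field consists of morphisms. -/
theorem isMorphism_of_isLineFlow [T2Space G] [T2Space M] (hJ : IsOpen J)
    {Y : Fin k → (Fin k → ℝ) → G → EG} (hY : ∀ i, SmoothVectorFields IG J (Y i))
    (hmul : ∀ i, ∀ ε ∈ cube k J, 𝓖.IsMultiplicative (Y i ε)) {r : ℝ}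
    {T : G × ((Fin k → ℝ) × (Fin k → ℝ)) → ℝ → G} (hT : IsLineFlow IG IG J Y id r T)
    {q : (Fin k → ℝ) × (Fin k → ℝ)} (hq : q ∈ Metric.ball 0 r) :
    ∃ f, IsMorphism 𝓖 𝓖 (fun g => T (g, q) 1) f := by
  let y : Fin k → (Fin k → ℝ) → M → EM := fun i ε => 𝓖.baseField (Y i ε)
  have hy : ∀ i, SmoothVectorFields IM J (y i) := fun i => smoothVectorFields_baseField hJ (hY i)
  have hline := (hT q hq).1
  have hc := fun g => ((hT q hq).2 g).2.1
  have h0 : ∀ g, T (g, q) 0 = g := fun g => ((hT q hq).2 g).1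
  -- Each morphism identity compares two integral curves of one field with the same initial value;
  -- multiplicativity provides the equations for their sources, targets, units and products.
  have hs : ∀ g, IsLineCurve IM y q.1 q.2 (fun t => 𝓖.s (T (g, q) t)) := fun g =>
    (hc g).map 𝓖.mdifferentiableAt_s fun i t ht => (hmul i _ (hline t ht)).baseField.1 _
  have ht : ∀ g, IsLineCurve IM y q.1 q.2 (fun t => 𝓖.t (T (g, q) t)) := fun g =>
    (hc g).map 𝓖.mdifferentiableAt_t fun i t ht => (hmul i _ (hline t ht)).baseField.2.1 _
  have hss : ∀ g, EqOn (fun t => 𝓖.s (T (g, q) t)) (fun t => 𝓖.s (T (𝓖.u (𝓖.s g), q) t)) timeIoo :=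
    fun g => (hs g).eqOn hJ hy (hs _) hline (by rw [h0, h0, 𝓖.s_u])
  have htt : ∀ g, EqOn (fun t => 𝓖.t (T (g, q) t)) (fun t => 𝓖.s (T (𝓖.u (𝓖.t g), q) t)) timeIoo :=
    fun g => (ht g).eqOn hJ hy (hs _) hline (by rw [h0, h0, 𝓖.s_u])
  have huu : ∀ x, EqOn (T (𝓖.u x, q)) (fun t => 𝓖.u (𝓖.s (T (𝓖.u x, q) t))) timeIoo := by
    intro x
    have h1 : IsLineCurve IG Y q.1 q.2 (fun t => 𝓖.u (𝓖.s (T (𝓖.u x, q) t))) :=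
      (hs (𝓖.u x)).map 𝓖.mdifferentiableAt_u fun i t ht =>
        ((hmul i _ (hline t ht)).baseField.2.2.1 _).symm
    exact (hc _).eqOn hJ hY h1 hline (by rw [h0, 𝓖.s_u])
  have hcomp : ∀ g h, 𝓖.s g = 𝓖.t h → ∀ t ∈ timeIoo, 𝓖.s (T (g, q) t) = 𝓖.t (T (h, q) t) := by
    intro g h hgh t ht
    have h1 := hss g ht
    have h2 := htt h ht
    simp only at h1 h2
    rw [h1, h2, hgh]
  have hmm : ∀ g h, 𝓖.s g = 𝓖.t h →
      EqOn (T (𝓖.mul g h, q)) (fun t => 𝓖.mul (T (g, q) t) (T (h, q) t)) timeIoo := by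
    intro g h hgh
    have h1 : IsLineCurve IG Y q.1 q.2 (fun t => 𝓖.mul (T (g, q) t) (T (h, q) t)) := by
      intro t ht
      have h2 := 𝓖.hasVelocity_mul rfl rfl (hc g t ht) (hc h t ht)
        (Filter.mem_of_superset (timeIoo_mem_nhds ht) (hcomp g h hgh))
      refine h2.congr_velocity ?_
      have h3 : (lineField Y q.1 q.2 t (T (g, q) t), lineField Y q.1 q.2 t (T (h, q) t)) =
          ∑ i, q.2 i • (Y i (q.1 + t • q.2) (T (g, q) t), Y i (q.1 + t • q.2) (T (h, q) t)) := by
        refine Prod.ext ?_ ?_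
        · rw [Prod.fst_sum]
          rfl
        · rw [Prod.snd_sum]
          rfl
      rw [h3, map_sum]
      refine Finset.sum_congr rfl fun i _ => ?_
      rw [map_smul, (hmul i _ (hline t ht)).baseField.2.2.2 _ _ (hcomp g h hgh t ht)]
    exact (hc _).eqOn hJ hY h1 hline (by rw [h0, h0, h0])
  have hsm : ContMDiff IG IG ∞ (fun g => T (g, q) 1) := fun g =>
    (((hT q hq).2 g).2.2 1 one_mem_timeIoo).slice_left
  exact ⟨fun x => 𝓖.s (T (𝓖.u x, q) 1), hsm, 𝓖.contMDiff_s.comp (hsm.comp 𝓖.contMDiff_u),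
    fun g => hss g one_mem_timeIoo, fun g => htt g one_mem_timeIoo,
    fun x => huu x one_mem_timeIoo, fun g h hgh => hmm g h hgh one_mem_timeIoo⟩

end Multiplicative

section RightInvariant

variable (𝓖) in
/-- Right translation, as a map of the model space. -/
def rTrans (g : G) : EG →L[ℝ] EG :=
  (𝓖.dMul (𝓖.u (𝓖.t g)) g).comp (.inl ℝ EG EG)

variable (𝓖) in
/-- Left translation composed with the differential of the inversion, as a map of the model
space. -/
def lTrans (g : G) : EG →L[ℝ] EG :=
  ((𝓖.dMul g (𝓖.u (𝓖.s g))).comp (.inr ℝ EG EG)).comp (tder IG IG 𝓖.inv (𝓖.u (𝓖.s g)))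

variable (𝓖) in
/-- The right-invariant vector fields extending sections of the Lie algebroid. -/
def rightField (α : Fin k → (Fin k → ℝ) → M → EG) (i : Fin k) (ε : Fin k → ℝ) (g : G) : EG :=
  𝓖.rTrans g (α i ε (𝓖.t g))

variable (𝓖) in
/-- The image of sections of the Lie algebroid under the anchor. -/
def anchorField (α : Fin k → (Fin k → ℝ) → M → EG) (i : Fin k) (ε : Fin k → ℝ) (y : M) : EM :=
  tder IG IM 𝓖.t (𝓖.u y) (α i ε y)

theorem smoothVectorFields_anchorField [IsManifold IG ∞ G] [IsManifold IM ∞ M] (hJ : IsOpen J)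
    {α : Fin k → (Fin k → ℝ) → M → EG} {i : Fin k} (hα : 𝓖.SmoothAlgebroidSections J (α i)) :
    SmoothVectorFields IM J (𝓖.anchorField α i) := by
  refine .of_contMDiffAt fun ε hε x => ?_
  have h1 : ContMDiffAt (IM.prod 𝓘(ℝ, Fin k → ℝ)) IG.tangent ∞
      (fun p : M × (Fin k → ℝ) => (⟨𝓖.u p.1, α i p.2 p.1⟩ : TangentBundle IG G)) (x, ε) :=
    hα.2.contMDiffAt ((isOpen_univ.prod (isOpen_cube hJ)).mem_nhds ⟨mem_univ _, hε⟩)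
  refine (h1.tangent_comp 𝓖.contMDiff_t).congr_of_eventuallyEq
    (Filter.Eventually.of_forall fun p => ?_)
  exact TangentBundle.mk_congr (𝓖.t_u p.1).symm rfl

theorem rTrans_lineField (α : Fin k → (Fin k → ℝ) → M → EG) (τ : ℝ) (g : G) :
    𝓖.rTrans g (lineField α ε v τ (𝓖.t g)) = lineField (𝓖.rightField α) ε v τ g :=
  map_lineField _ fun _ => rfl

variable {α : Fin k → (Fin k → ℝ) → M → EG}

theorem tder_s_lineField {τ : ℝ} {y : M}
    (hα : ∀ i, tder IG IM 𝓖.s (𝓖.u y) (α i (ε + τ • v) y) = 0) :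
    tder IG IM 𝓖.s (𝓖.u y) (lineField α ε v τ y) = 0 := by
  simp only [lineField, map_sum, map_smul, hα, smul_zero, Finset.sum_const_zero]

variable [IG.Boundaryless] [IsManifold IG ∞ G] [IM.Boundaryless] [IsManifold IM ∞ M]
  [CompleteSpace EG] [CompleteSpace EM] (hJ : IsOpen J)
  (hα : ∀ i, 𝓖.SmoothAlgebroidSections J (α i)) (hε : ∀ τ ∈ timeIoo, ε + τ • v ∈ cube k J)

include hα hε

/-- Right-invariant fields are t-related to the images of their sections under the anchor. -/
theorem isLineCurve_t {γ : ℝ → G} (hγ : IsLineCurve IG (𝓖.rightField α) ε v γ) :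
    IsLineCurve IM (𝓖.anchorField α) ε v (fun τ => 𝓖.t (γ τ)) :=
  hγ.map 𝓖.mdifferentiableAt_t fun i τ hτ => 𝓖.tder_t_rightTranslate ((hα i).1 _ (hε τ hτ) _)

include hJ

/-- Right-invariant fields are tangent to the source fibres, so s ∘ γ is an integral curve of the
zero field. -/
theorem s_eq_of_isLineCurve [T2Space M] {γ : ℝ → G}
    (hγ : IsLineCurve IG (𝓖.rightField α) ε v γ) {τ : ℝ} (hτ : τ ∈ timeIoo) :
    𝓖.s (γ τ) = 𝓖.s (γ 0) := by
  let Z : Fin k → (Fin k → ℝ) → M → EM := fun _ _ _ => 0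
  have h1 : IsLineCurve IM Z ε v (fun τ => 𝓖.s (γ τ)) := hγ.map 𝓖.mdifferentiableAt_s
    fun i τ hτ => 𝓖.tder_s_rightTranslate ((hα i).1 _ (hε τ hτ) _)
  have h2 : IsLineCurve IM Z ε v (fun _ => 𝓖.s (γ 0)) := fun t _ =>
    (HasVelocity.const _ t).congr_velocity (by simp [lineField, Z])
  exact h1.eqOn hJ (fun _ => .zero) h2 hε rfl hτ

/-- Integral curves of right-invariant vector fields are unique, although the arrow space need not
be Hausdorff. -/
theorem eqOn_of_isLineCurve_rightField [T2Space M] {γ γ' : ℝ → G}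
    (hγ : IsLineCurve IG (𝓖.rightField α) ε v γ) (hγ' : IsLineCurve IG (𝓖.rightField α) ε v γ')
    (h0 : γ 0 = γ' 0) : EqOn γ γ' timeIoo := by
  have hX : ∀ i, SmoothVectorFields IG J (𝓖.rightField α i) := fun i =>
    𝓖.smoothVectorFields_rightTranslate hJ (hα i)
  have hb : ∀ i, SmoothVectorFields IM J (𝓖.anchorField α i) := fun i =>
    smoothVectorFields_anchorField hJ (hα i)
  have ht : EqOn (fun τ => 𝓖.t (γ τ)) (fun τ => 𝓖.t (γ' τ)) timeIoo :=
    (isLineCurve_t hα hε hγ).eqOn hJ hb (isLineCurve_t hα hε hγ') hε (by rw [h0])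
  have : T2Space HG := IG.isClosedEmbedding.isEmbedding.t2Space
  have : T1Space G := ChartedSpace.t1Space HG G
  refine hγ.eqOn_of_isClosed hJ hX hγ' hε h0 fun τ hτ hfr => ?_
  -- The targets agree because M is Hausdorff, so γ⁻¹γ' is defined and continuous. It equals one
  -- fixed unit wherever γ = γ', and points of G are closed since G is locally Euclidean; hence it
  -- equals that unit at the limit time too.
  have hcomp : ∀ᶠ r in 𝓝 τ, 𝓖.s (𝓖.inv (γ r)) = 𝓖.t (γ' r) := by
    filter_upwards [timeIoo_mem_nhds hτ] with r hr
    rw [𝓖.s_inv]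
    exact ht hr
  have hvel := 𝓖.hasVelocity_mul rfl rfl ((hγ τ hτ).map (𝓖.mdifferentiableAt_inv _)) (hγ' τ hτ)
    hcomp
  have hfr' : ∃ᶠ r in 𝓝 τ, 𝓖.mul (𝓖.inv (γ r)) (γ' r) ∈ ({𝓖.u (𝓖.s (γ 0))} : Set G) := by
    refine (hfr.and_eventually (timeIoo_mem_nhds hτ)).mono fun r hr => ?_
    rw [← hr.1, 𝓖.inv_mul, s_eq_of_isLineCurve hJ hα hε hγ hr.2]
    rfl
  have hmem : 𝓖.mul (𝓖.inv (γ τ)) (γ' τ) ∈ ({𝓖.u (𝓖.s (γ 0))} : Set G) := by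
    by_contra hne
    exact hfr' (hvel.continuousAt.preimage_mem_nhds (isClosed_singleton.isOpen_compl.mem_nhds hne))
  have hmem' : 𝓖.mul (𝓖.inv (γ τ)) (γ' τ) = 𝓖.u (𝓖.s (γ 0)) := hmem
  have h1 := 𝓖.inv_mul_cancel_left hcomp.self_of_nhds
  rw [𝓖.inv_inv, hmem', ← s_eq_of_isLineCurve hJ hα hε hγ hτ, 𝓖.mul_u] at h1
  exact h1

end RightInvariant

end LieGroupoid

end Groupoid

/-! ### Integration of the cohomological equations -/

section StrongTriviality

variable {EG HG EM HM EH HH EN HN : Type*}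
  [NormedAddCommGroup EG] [NormedSpace ℝ EG] [TopologicalSpace HG]
  [NormedAddCommGroup EM] [NormedSpace ℝ EM] [TopologicalSpace HM]
  [NormedAddCommGroup EH] [NormedSpace ℝ EH] [TopologicalSpace HH]
  [NormedAddCommGroup EN] [NormedSpace ℝ EN] [TopologicalSpace HN]
  {IH : ModelWithCorners ℝ EH HH} {H : Type*} [TopologicalSpace H] [ChartedSpace HH H]
  {IN : ModelWithCorners ℝ EN HN} {N : Type*} [TopologicalSpace N] [ChartedSpace HN N]
  {IG : ModelWithCorners ℝ EG HG} {G : Type*} [TopologicalSpace G] [ChartedSpace HG G]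
  {IM : ModelWithCorners ℝ EM HM} {M : Type*} [TopologicalSpace M] [ChartedSpace HM M]
  {𝓗 : LieGroupoid IH H IN N} {𝓖 : LieGroupoid IG G IM M} {k : ℕ} {J : Set ℝ}

theorem mem_cube_Ioo {r : ℝ} (hr : 0 < r) {ε : Fin k → ℝ} : ε ∈ cube k (Ioo (-r) r) ↔ ‖ε‖ < r := by
  rw [pi_norm_lt_iff hr]
  simp only [cube, mem_univ_pi, mem_Ioo, Real.norm_eq_abs, abs_lt]

theorem isOpenIntervalAtZero_Ioo {r : ℝ} (hr : 0 < r) : IsOpenIntervalAtZero (Ioo (-r) r) :=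
  ⟨isOpen_Ioo, ordConnected_Ioo, by constructor <;> linarith⟩

theorem exists_Ioo_subset {I : Set ℝ} (hI : IsOpenIntervalAtZero I) :
    ∃ r > 0, Ioo (-r) r ⊆ I := by
  obtain ⟨r, hr, h⟩ := Metric.isOpen_iff.mp hI.1 0 hI.2.2
  refine ⟨r, hr, fun x hx => h ?_⟩
  rwa [Real.ball_eq_Ioo, zero_sub, zero_add]

namespace LieGroupoid

theorem IsKDeformation.mono {I : Set ℝ} {Φ₀ : H → G} {φ₀ : N → M} {Φ : H × (Fin k → ℝ) → G}
    {φ : N × (Fin k → ℝ) → M} (h : IsKDeformation 𝓗 𝓖 I Φ₀ φ₀ Φ φ) (hJ : J ⊆ I) :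
    IsKDeformation 𝓗 𝓖 J Φ₀ φ₀ Φ φ :=
  ⟨h.smooth.mono hJ, h.smooth_base.mono hJ, fun ε hε => h.isMorphism ε (cube_mono hJ hε),
    h.map_zero, h.map_zero_base⟩

/-- The cohomological equations, with all vectors regarded as vectors of the model spaces. -/
def SolvesCohomologicalEquations (𝓖 : LieGroupoid IG G IM M) (IH : ModelWithCorners ℝ EH HH)
    (J : Set ℝ) (Φ : H × (Fin k → ℝ) → G) (Y : Fin k → (Fin k → ℝ) → H → EH)
    (α : Fin k → (Fin k → ℝ) → M → EG) : Prop :=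
  ∀ i, ∀ ε ∈ cube k J, ∀ h : H,
    tder 𝓘(ℝ, Fin k → ℝ) IG (fun e => Φ (h, e)) ε (Pi.single i 1) =
      tder IH IG (fun h' => Φ (h', ε)) h (Y i ε h) +
        (𝓖.rTrans (Φ (h, ε)) (α i ε (𝓖.t (Φ (h, ε)))) +
          𝓖.lTrans (Φ (h, ε)) (α i ε (𝓖.s (Φ (h, ε)))))

/-- Only the base points change form, φ(t h) to t(Φ h) and φ(s h) to s(Φ h); the base map φ then
disappears from the equations. -/
theorem solvesCohomologicalEquations_iff {Φ₀ : H → G} {φ₀ : N → M} {Φ : H × (Fin k → ℝ) → G}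
    {φ : N × (Fin k → ℝ) → M} (hΦ : IsKDeformation 𝓗 𝓖 J Φ₀ φ₀ Φ φ)
    {Y : Fin k → (Fin k → ℝ) → H → EH} {α : Fin k → (Fin k → ℝ) → M → EG} :
    SolvesCohomologicalEquations 𝓖 IH J Φ Y α ↔ ∀ i, ∀ ε ∈ cube k J, ∀ h : H,
        paramDeriv IG Φ i ε h = mfderiv IH IG (fun h' => Φ (h', ε)) h (Y i ε h) +
            delta 𝓗 𝓖 (fun h' => Φ (h', ε)) (fun x => φ (x, ε))
              (fun x => α i ε (φ (x, ε))) h := by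
  refine forall_congr' fun i => forall₂_congr fun ε hε => forall_congr' fun h => ?_
  have hm := hΦ.isMorphism ε hε
  have e1 := congrArg (fun y => (𝓖.rightTranslate (Φ (h, ε)) y (α i ε y) : EG)) (hm.map_t h)
  have e2 := congrArg (fun y => (𝓖.leftTranslate (Φ (h, ε)) y (𝓖.dInv y (α i ε y)) : EG))
    (hm.map_s h)
  have e3 := congrArg (fun d : EG => tder IH IG (fun h' => Φ (h', ε)) h (Y i ε h) + d)
    (congrArg₂ (fun a b : EG => a + b) e1 e2)
  exact ⟨fun h => h.trans e3, fun h => h.trans e3.symm⟩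

section Curves

variable [IsManifold IG ∞ G] [IG.Boundaryless] [IM.Boundaryless] [IsManifold IM ∞ M]
  [CompleteSpace EG] [CompleteSpace EM] [T2Space M]

-- Since c moves with velocity -∑ v_i Y^i, the terms dΦ(Y^i) of the equations cancel and only the
-- translates of α remain.
omit [IsManifold IG ∞ G] [IG.Boundaryless] [IM.Boundaryless] [IsManifold IM ∞ M]
  [CompleteSpace EG] [CompleteSpace EM] [T2Space M] in
theorem hasVelocity_family_along_line (hJ : IsOpen J) {Φ : H × (Fin k → ℝ) → G}
    (hΦ : SmoothFamily IH IG J Φ) {Y : Fin k → (Fin k → ℝ) → H → EH}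
    {α : Fin k → (Fin k → ℝ) → M → EG} (heq : SolvesCohomologicalEquations 𝓖 IH J Φ Y α)
    {ε v : Fin k → ℝ} {c : ℝ → H} {τ : ℝ}
    (hc : HasVelocity IH c (lineField (fun i ε h => -Y i ε h) ε v τ (c τ)) τ)
    (hε : ε + τ • v ∈ cube k J) :
    HasVelocity IG (fun τ => Φ (c τ, ε + τ • v))
      (𝓖.rTrans (Φ (c τ, ε + τ • v)) (lineField α ε v τ (𝓖.t (Φ (c τ, ε + τ • v)))) +
        𝓖.lTrans (Φ (c τ, ε + τ • v)) (lineField α ε v τ (𝓖.s (Φ (c τ, ε + τ • v))))) τ := by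
  have hsm := hΦ.contMDiffAt hJ hε (c τ)
  have hl : HasVelocity 𝓘(ℝ, Fin k → ℝ) (fun b : ℝ => ε + b • v) v τ := by
    refine HasVelocity.iff_hasDerivAt.mpr ?_
    simpa using ((hasDerivAt_id τ).smul_const v).const_add ε
  have hWd : MDifferentiableAt 𝓘(ℝ, ℝ × ℝ) IG (fun p : ℝ × ℝ => Φ (c p.1, ε + p.2 • v)) (τ, τ) := by
    have h1 : MDifferentiableAt 𝓘(ℝ, ℝ × ℝ) IH (fun p : ℝ × ℝ => c p.1) (τ, τ) :=
      MDifferentiableAt.comp (τ, τ) (g := c) (f := fun p : ℝ × ℝ => p.1)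
        (HasMFDerivAt.mdifferentiableAt hc)
        (contDiff_fst.contMDiff.contMDiffAt.mdifferentiableAt one_ne_zero)
    have h2 : MDifferentiableAt 𝓘(ℝ, ℝ × ℝ) 𝓘(ℝ, Fin k → ℝ) (fun p : ℝ × ℝ => ε + p.2 • v)
        (τ, τ) :=
      (contDiff_const.add (contDiff_snd.smul contDiff_const)).contMDiff.contMDiffAt.mdifferentiableAt
        one_ne_zero
    exact MDifferentiableAt.comp (τ, τ) (g := Φ) (f := fun p : ℝ × ℝ => (c p.1, ε + p.2 • v))
      (hsm.mdifferentiableAt (by simp)) (h1.prodMk h2)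
  have hW1 : HasVelocity IG (fun a => Φ (c a, ε + τ • v)) _ τ :=
    hc.map (f := fun h => Φ (h, ε + τ • v)) (hsm.slice_left.mdifferentiableAt (by simp))
  have hW2 : HasVelocity IG (fun b : ℝ => Φ (c τ, ε + b • v)) _ τ :=
    hl.map (f := fun e => Φ (c τ, e)) (hsm.slice_right.mdifferentiableAt (by simp))
  refine (HasVelocity.diag hWd hW1 hW2).congr_velocity ?_
  have hv : v = ∑ i, v i • (Pi.single i 1 : Fin k → ℝ) := by
    ext j
    simp [Finset.sum_apply, Pi.single_apply]
  have e1 : tder 𝓘(ℝ, Fin k → ℝ) IG (fun e => Φ (c τ, e)) (ε + τ • v) v =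
      ∑ i, v i • tder 𝓘(ℝ, Fin k → ℝ) IG (fun e => Φ (c τ, e)) (ε + τ • v) (Pi.single i 1) := by
    conv_lhs => rw [hv]
    simp only [map_sum, map_smul]
    rw [← hv]
  rw [e1]
  simp only [lineField, map_sum, map_smul, map_neg, heq _ _ hε, smul_add, smul_neg,
    Finset.sum_add_distrib, Finset.sum_neg_distrib]
  abel

/-- With g(τ) = Φ(c τ, ε + τv), multiplication by σ on the right removes the left-translated term of
g'. What is left is the equation of a right-invariant field, which σ(τ)g(0) also solves. -/
theorem eq_conj_of_lineCurves (hJ : IsOpen J) {Φ : H × (Fin k → ℝ) → G}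
    (hΦ : SmoothFamily IH IG J Φ) {Y : Fin k → (Fin k → ℝ) → H → EH}
    {α : Fin k → (Fin k → ℝ) → M → EG} (hα : ∀ i, 𝓖.SmoothAlgebroidSections J (α i))
    (heq : SolvesCohomologicalEquations 𝓖 IH J Φ Y α)
    {ε v : Fin k → ℝ} (hε : ∀ τ ∈ timeIoo, ε + τ • v ∈ cube k J) {c : ℝ → H}
    (hc : IsLineCurve IH (fun i ε h => -Y i ε h) ε v c) {σ : M → ℝ → G}
    (hσ0 : ∀ x, σ x 0 = 𝓖.u x) (hσ : ∀ x, IsLineCurve IG (𝓖.rightField α) ε v (σ x))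
    {τ : ℝ} (hτ : τ ∈ timeIoo) :
    Φ (c τ, ε + τ • v) = 𝓖.conj (fun x => σ x τ) (Φ (c 0, ε)) := by
  let g : ℝ → G := fun τ => Φ (c τ, ε + τ • v)
  have hg0 : g 0 = Φ (c 0, ε) := by
    show Φ (c 0, ε + (0 : ℝ) • v) = _
    rw [zero_smul, add_zero]
  have hg : ∀ τ ∈ timeIoo, HasVelocity IG g (𝓖.rTrans (g τ) (lineField α ε v τ (𝓖.t (g τ))) +
      𝓖.lTrans (g τ) (lineField α ε v τ (𝓖.s (g τ)))) τ := fun τ hτ =>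
    hasVelocity_family_along_line hJ hΦ heq (hc τ hτ) (hε τ hτ)
  have hker : ∀ τ ∈ timeIoo, ∀ y, tder IG IM 𝓖.s (𝓖.u y) (lineField α ε v τ y) = 0 :=
    fun τ hτ y => tder_s_lineField fun i => (hα i).1 _ (hε τ hτ) y
  have hb : ∀ i, SmoothVectorFields IM J (𝓖.anchorField α i) := fun i =>
    smoothVectorFields_anchorField hJ (hα i)
  have hσs : ∀ x, ∀ τ ∈ timeIoo, 𝓖.s (σ x τ) = x := fun x τ hτ => by
    rw [s_eq_of_isLineCurve hJ hα hε (hσ x) hτ, hσ0, 𝓖.s_u]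
  -- The source of g and the target of σ solve the same equation on M, so the product g(τ)σ(τ) is
  -- defined.
  have hgs : IsLineCurve IM (𝓖.anchorField α) ε v (fun τ => 𝓖.s (g τ)) := by
    intro τ hτ
    refine ((hg τ hτ).map (𝓖.mdifferentiableAt_s _)).congr_velocity ?_
    rw [map_add]
    have e1 : tder IG IM 𝓖.s (g τ) (𝓖.rTrans (g τ) (lineField α ε v τ (𝓖.t (g τ)))) = 0 :=
      𝓖.tder_s_rightTranslate (hker τ hτ _)
    have e2 : tder IG IM 𝓖.s (g τ) (𝓖.lTrans (g τ) (lineField α ε v τ (𝓖.s (g τ)))) =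
        tder IG IM 𝓖.t (𝓖.u (𝓖.s (g τ))) (lineField α ε v τ (𝓖.s (g τ))) :=
      𝓖.tder_s_leftTranslate (hker τ hτ _)
    rw [e1, e2, zero_add]
    exact map_lineField _ fun i => rfl
  have hst : ∀ τ ∈ timeIoo, 𝓖.s (g τ) = 𝓖.t (σ (𝓖.s (g 0)) τ) := fun τ hτ =>
    hgs.eqOn hJ hb (isLineCurve_t hα hε (hσ _)) hε (by rw [hσ0, 𝓖.t_u]) hτ
  have hQ : IsLineCurve IG (𝓖.rightField α) ε v (fun τ => 𝓖.mul (g τ) (σ (𝓖.s (g 0)) τ)) := by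
    intro τ hτ
    have h1 := 𝓖.hasVelocity_mul rfl rfl (hg τ hτ) (hσ (𝓖.s (g 0)) τ hτ)
      (Filter.mem_of_superset (timeIoo_mem_nhds hτ) hst)
    refine h1.congr_velocity ?_
    set h := σ (𝓖.s (g 0)) τ with hh
    have hgh : 𝓖.s (g τ) = 𝓖.t h := hst τ hτ
    rw [𝓖.dMul_add_left, ← rTrans_lineField, ← rTrans_lineField, ← hgh]
    have e1 : 𝓖.dMul (g τ) h (𝓖.rTrans (g τ) (lineField α ε v τ (𝓖.t (g τ))), 0) =
        𝓖.rTrans (𝓖.mul (g τ) h) (lineField α ε v τ (𝓖.t (g τ))) :=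
      𝓖.dMul_rightTranslate hgh (hker τ hτ _)
    have e2 : 𝓖.dMul (g τ) h (𝓖.lTrans (g τ) (lineField α ε v τ (𝓖.s (g τ))),
        𝓖.rTrans h (lineField α ε v τ (𝓖.s (g τ)))) = 0 :=
      𝓖.dMul_leftTranslate_rightTranslate hgh (hker τ hτ _)
    rw [e1, e2, add_zero, 𝓖.t_mul _ _ hgh]
  have hQ' : IsLineCurve IG (𝓖.rightField α) ε v (fun τ => 𝓖.mul (σ (𝓖.t (g 0)) τ) (g 0)) := by
    intro τ hτ
    have hst' : ∀ τ ∈ timeIoo, 𝓖.s (σ (𝓖.t (g 0)) τ) = 𝓖.t (g 0) := fun τ hτ => hσs _ τ hτ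
    have h1 := 𝓖.hasVelocity_mul rfl rfl (hσ (𝓖.t (g 0)) τ hτ) (HasVelocity.const (g 0) τ)
      (Filter.mem_of_superset (timeIoo_mem_nhds hτ) hst')
    refine h1.congr_velocity ?_
    set h := σ (𝓖.t (g 0)) τ with hh
    have hgh : 𝓖.s h = 𝓖.t (g 0) := hst' τ hτ
    rw [← rTrans_lineField, ← rTrans_lineField]
    have e1 : 𝓖.dMul h (g 0) (𝓖.rTrans h (lineField α ε v τ (𝓖.t h)), 0) =
        𝓖.rTrans (𝓖.mul h (g 0)) (lineField α ε v τ (𝓖.t h)) :=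
      𝓖.dMul_rightTranslate hgh (hker τ hτ _)
    rw [e1, 𝓖.t_mul _ _ hgh]
  have hQQ := eqOn_of_isLineCurve_rightField hJ hα hε hQ hQ'
    (by rw [hσ0, hσ0, 𝓖.mul_u, 𝓖.u_mul]) hτ
  simp only at hQQ
  have e1 := 𝓖.mul_inv_cancel_right (hst τ hτ)
  rw [hQQ] at e1
  rw [← hg0]
  exact e1.symm

end Curves

/-- Solutions of the cohomological equations integrate to strong trivialisations along the lines
from `P ε` to `ε`, for every retraction `P` of the parameter space. -/
theorem exists_strong_trivialisation [FiniteDimensional ℝ EH] [FiniteDimensional ℝ EG]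
    [FiniteDimensional ℝ EM] [IH.Boundaryless] [IsManifold IH ∞ H] [IN.Boundaryless]
    [IsManifold IN ∞ N] [IsManifold IG ∞ G] [IG.Boundaryless] [IM.Boundaryless] [IsManifold IM ∞ M]
    [T2Space H] [T2Space N] [T2Space M] [CompactSpace H] (hJ : IsOpen J) (h0 : (0 : ℝ) ∈ J)
    {Φ : H × (Fin k → ℝ) → G} (hΦ : SmoothFamily IH IG J Φ)
    {Y : Fin k → (Fin k → ℝ) → H → EH} (hY : ∀ i, SmoothVectorFields IH J (Y i))
    (hmul : ∀ i, ∀ ε ∈ cube k J, 𝓗.IsMultiplicative (Y i ε))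
    {α : Fin k → (Fin k → ℝ) → M → EG} (hα : ∀ i, 𝓖.SmoothAlgebroidSections J (α i)) {C : Set M}
    (hC : IsCompact C) (hvan : ∀ i, ∀ ε ∈ cube k J, ∀ x ∉ C, α i ε x = 0)
    (heq : SolvesCohomologicalEquations 𝓖 IH J Φ Y α) :
    ∃ r > 0, ∀ r' ∈ Ioc 0 r, ∀ P : (Fin k → ℝ) → (Fin k → ℝ), ContDiff ℝ ∞ P →
      (∀ ε, ‖P ε‖ ≤ ‖ε‖) → (∀ ε, ‖ε - P ε‖ ≤ ‖ε‖) →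
      ∃ (F : H × (Fin k → ℝ) → H) (σ : M × (Fin k → ℝ) → G),
        𝓗.SmoothAutomorphisms (Ioo (-r') r') F ∧ 𝓖.SmoothBisections (Ioo (-r') r') σ ∧
        (∀ ε ∈ cube k (Ioo (-r') r'), P ε = ε → (∀ h, F (h, ε) = h) ∧ ∀ x, σ (x, ε) = 𝓖.u x) ∧
        ∀ ε ∈ cube k (Ioo (-r') r'), ∀ h,
          Φ (F (h, ε), ε) = 𝓖.conj (fun x => σ (x, ε)) (Φ (h, P ε)) := by
  have : CompleteSpace EG := FiniteDimensional.complete ℝ EG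
  have : CompleteSpace EM := FiniteDimensional.complete ℝ EM
  -- The sign is the one that makes the Y-terms cancel along the flow.
  let Z : Fin k → (Fin k → ℝ) → H → EH := fun i ε h => -Y i ε h
  have hZ : ∀ i, SmoothVectorFields IH J (Z i) := by
    refine fun i => .of_contMDiffAt fun ε hε h => ?_
    refine (((hY i).contMDiffAt hJ hε h).smul_tangent (χ := fun _ => -1)
      contMDiffAt_const).congr_of_eventuallyEq (Filter.Eventually.of_forall fun p => ?_)
    exact TangentBundle.mk_congr rfl (neg_one_smul ℝ _).symm
  have hZm : ∀ i, ∀ ε ∈ cube k J, 𝓗.IsMultiplicative (Z i ε) := fun i ε hε => (hmul i ε hε).neg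
  have hb : ∀ i, SmoothVectorFields IM J (𝓖.anchorField α i) := fun i =>
    smoothVectorFields_anchorField hJ (hα i)
  have hX : ∀ i, SmoothVectorFields IG J (𝓖.rightField α i) := fun i =>
    𝓖.smoothVectorFields_rightTranslate hJ (hα i)
  obtain ⟨r₁, hr₁, T, hT⟩ : ∃ r > 0, ∃ T, IsLineFlow IH IH J Z id r T :=
    exists_lineFlow hJ h0 hZ contMDiff_id isCompact_univ isClosed_univ
      (fun _ _ _ x hx => absurd (mem_univ x) hx)
      fun x ε v hε γ γ' hγ hγ' e e' => hγ.eqOn hJ hZ hγ' hε (e.trans e'.symm)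
  obtain ⟨r₂, hr₂, R, hR⟩ : ∃ r > 0, ∃ R, IsLineFlow IM IM J (𝓖.anchorField α) id r R := by
    refine exists_lineFlow hJ h0 hb contMDiff_id hC hC.isClosed (fun i ε hε x hx => ?_)
      fun x ε v hε γ γ' hγ hγ' e e' => hγ.eqOn hJ hb hγ' hε (e.trans e'.symm)
    simp only [anchorField, id_eq, hvan i ε hε x hx, map_zero]
  -- The right-invariant flow is needed only from the units, so the initial values are indexed by M
  -- and compactness of C in M suffices.
  obtain ⟨r₃, hr₃, S, hS⟩ : ∃ r > 0, ∃ S, IsLineFlow IM IG J (𝓖.rightField α) 𝓖.u r S := by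
    refine exists_lineFlow hJ h0 hX 𝓖.contMDiff_u hC hC.isClosed (fun i ε hε x hx => ?_)
      fun x ε v hε γ γ' hγ hγ' e e' =>
        eqOn_of_isLineCurve_rightField hJ hα hε hγ hγ' (e.trans e'.symm)
    simp only [rightField, 𝓖.t_u, hvan i ε hε x hx, map_zero]
  refine ⟨min r₁ (min r₂ r₃), by positivity, fun r ⟨hr, hrr⟩ P hP hP1 hP2 => ?_⟩
  replace hT := hT.mono (hrr.trans (min_le_left _ _))
  replace hR := hR.mono (hrr.trans ((min_le_right _ _).trans (min_le_left _ _)))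
  replace hS := hS.mono (hrr.trans ((min_le_right _ _).trans (min_le_right _ _)))
  -- Base point and direction of the line from P ε to ε; Q' describes the same line reversed. The
  -- two norm bounds on P keep both in the ball of radius r.
  let Q : (Fin k → ℝ) → (Fin k → ℝ) × (Fin k → ℝ) := fun ε => (P ε, ε - P ε)
  let Q' : (Fin k → ℝ) → (Fin k → ℝ) × (Fin k → ℝ) := fun ε => (ε, P ε - ε)
  have hQs : ContDiff ℝ ∞ Q := hP.prodMk (contDiff_id.sub hP)
  have hQ : ∀ ε ∈ cube k (Ioo (-r) r), Q ε ∈ Metric.ball 0 r := by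
    intro ε hε
    rw [mem_cube_Ioo hr] at hε
    rw [mem_ball_zero_iff, Prod.norm_mk]
    exact max_lt ((hP1 ε).trans_lt hε) ((hP2 ε).trans_lt hε)
  have hQ' : ∀ ε ∈ cube k (Ioo (-r) r), Q' ε ∈ Metric.ball 0 r := by
    intro ε hε
    rw [mem_cube_Ioo hr] at hε
    rw [mem_ball_zero_iff, Prod.norm_mk, norm_sub_rev]
    exact max_lt hε ((hP2 ε).trans_lt hε)
  have hQQ' : ∀ ε, ((Q ε).1 + (Q ε).2, -(Q ε).2) = Q' ε := fun ε => by
    refine Prod.ext (add_sub_cancel _ _) (neg_sub _ _)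
  have hQ'Q : ∀ ε, ((Q' ε).1 + (Q' ε).2, -(Q' ε).2) = Q ε := fun ε => by
    refine Prod.ext (add_sub_cancel _ _) (neg_sub _ _)
  have hS0 : ∀ ε ∈ cube k (Ioo (-r) r), ∀ x, S (x, Q ε) 0 = 𝓖.u x := fun ε hε x =>
    ((hS _ (hQ ε hε)).2 x).1
  have hSs : ∀ ε ∈ cube k (Ioo (-r) r), ∀ x, 𝓖.s (S (x, Q ε) 1) = x := fun ε hε x => by
    rw [s_eq_of_isLineCurve hJ hα (hS _ (hQ ε hε)).1 ((hS _ (hQ ε hε)).2 x).2.1 one_mem_timeIoo,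
      hS0 ε hε, 𝓖.s_u]
  -- Hence t ∘ σ_ε is a time-one map of the anchor fields, and the reversed line provides its smooth
  -- inverse.
  have hSt : ∀ ε ∈ cube k (Ioo (-r) r), ∀ x, R (x, Q ε) 1 = 𝓖.t (S (x, Q ε) 1) := fun ε hε x => by
    have hq := hQ ε hε
    exact ((hR _ hq).2 x).2.1.eqOn hJ hb (isLineCurve_t hα (hS _ hq).1 ((hS _ hq).2 x).2.1)
      (hS _ hq).1 (by rw [hS0 ε hε, 𝓖.t_u]; exact ((hR _ hq).2 x).1) one_mem_timeIoo
  have hTsm := hT.smoothFamily (J' := Ioo (-r) r) hQs hQ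
  have hSsm := hS.smoothFamily (J' := Ioo (-r) r) hQs hQ
  refine ⟨fun p => T (p.1, Q p.2) 1, fun p => S (p.1, Q p.2) 1, ⟨hTsm, fun ε hε => ?_⟩,
    ⟨hSsm, fun ε hε => ⟨hSsm.slice isOpen_Ioo hε, hSs ε hε, ?_⟩⟩, fun ε hε hPε => ⟨fun h => ?_,
      fun x => ?_⟩, fun ε hε h => ?_⟩
  · obtain ⟨f, hf⟩ := isMorphism_of_isLineFlow hJ hZ hZm hT (hQ ε hε)
    obtain ⟨f', hf'⟩ := isMorphism_of_isLineFlow hJ hZ hZm hT (hQ' ε hε)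
    refine ⟨f, _, f', hf, hf', fun h => ?_, fun h => ?_⟩
    · have := hT.reverse_apply hJ hZ (hQ ε hε) (by rw [hQQ']; exact hQ' ε hε) h
      rwa [hQQ'] at this
    · have := hT.reverse_apply hJ hZ (hQ' ε hε) (by rw [hQ'Q]; exact hQ ε hε) h
      rwa [hQ'Q] at this
  · refine ⟨⟨⟨fun x => R (x, Q ε) 1, fun x => R (x, Q' ε) 1, fun x => ?_, fun x => ?_⟩,
      fun x => ?_, fun x => ?_⟩, hSt ε hε⟩
    · have := hR.reverse_apply hJ hb (hQ ε hε) (by rw [hQQ']; exact hQ' ε hε) x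
      rwa [hQQ'] at this
    · have := hR.reverse_apply hJ hb (hQ' ε hε) (by rw [hQ'Q]; exact hQ ε hε) x
      rwa [hQ'Q] at this
    · exact (((hR _ (hQ ε hε)).2 x).2.2 1 one_mem_timeIoo).slice_left
    · exact (((hR _ (hQ' ε hε)).2 x).2.2 1 one_mem_timeIoo).slice_left
  · have hq := hQ ε hε
    -- If P ε = ε, the line is a point and the flow is constant.
    have e1 : (Q ε).2 = 0 := by
      show ε - P ε = 0
      rw [hPε, sub_self]
    have h1 := (hT _ hq).2 h
    have h2 := h1.2.1
    have h3 := (hT _ hq).1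
    rw [e1] at h2 h3
    exact h2.eqOn hJ hZ (isLineCurve_const h) h3 h1.1 one_mem_timeIoo
  · have hq := hQ ε hε
    have e1 : (Q ε).2 = 0 := by
      show ε - P ε = 0
      rw [hPε, sub_self]
    have h1 := (hS _ hq).2 x
    have h2 := h1.2.1
    have h3 := (hS _ hq).1
    rw [e1] at h2 h3
    exact eqOn_of_isLineCurve_rightField hJ hα h3 h2 (isLineCurve_const _) h1.1 one_mem_timeIoo
  · have hq := hQ ε hε
    have h1 := eq_conj_of_lineCurves hJ hΦ hα heq (hT _ hq).1 ((hT _ hq).2 h).2.1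
      (σ := fun x => S (x, Q ε)) (hS0 ε hε) (fun x => ((hS _ hq).2 x).2.1) one_mem_timeIoo
    have e1 : (Q ε).1 + (1 : ℝ) • (Q ε).2 = ε := by
      rw [one_smul]
      exact add_sub_cancel _ _
    have e2 : T (h, Q ε) 0 = h := ((hT _ hq).2 h).1
    rw [e1, e2] at h1
    exact h1

end LieGroupoid

end StrongTriviality

/-- Smooth cutoff functions. -/
theorem exists_contMDiff_cutoff {E HM : Type*} [NormedAddCommGroup E] [NormedSpace ℝ E]
    [FiniteDimensional ℝ E] [TopologicalSpace HM] (I : ModelWithCorners ℝ E HM) {M : Type*}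
    [TopologicalSpace M] [ChartedSpace HM M] [IsManifold I ∞ M] [T2Space M]
    [SecondCountableTopology M] {C V : Set M} (hC : IsCompact C) (hV : IsOpen V) (hCV : C ⊆ V) :
    ∃ χ : M → ℝ, ContMDiff I 𝓘(ℝ, ℝ) ∞ χ ∧ (∀ᶠ x in 𝓝ˢ C, χ x = 1) ∧
      ∃ K ⊆ V, IsCompact K ∧ ∀ x ∉ K, χ x = 0 := by
  have : LocallyCompactSpace HM := I.locallyCompactSpace
  have : LocallyCompactSpace M := ChartedSpace.locallyCompactSpace HM M
  obtain ⟨K, hK, hCK, hKV⟩ := exists_compact_between hC hV hCV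
  obtain ⟨χ, h1, h2, -⟩ :=
    exists_contMDiffMap_one_nhds_of_subset_interior I (n := ⊤) hC.isClosed hCK
  exact ⟨χ, χ.contMDiff, h1, K, hKV, hK, h2⟩

/-! ### The equivalence of the three conditions -/

section Equivalence

variable {EG HG EM HM EH HH EN HN : Type*}
  [NormedAddCommGroup EG] [NormedSpace ℝ EG] [TopologicalSpace HG]
  [NormedAddCommGroup EM] [NormedSpace ℝ EM] [TopologicalSpace HM]
  [NormedAddCommGroup EH] [NormedSpace ℝ EH] [TopologicalSpace HH]
  [NormedAddCommGroup EN] [NormedSpace ℝ EN] [TopologicalSpace HN]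
  {IH : ModelWithCorners ℝ EH HH} {H : Type*} [TopologicalSpace H] [ChartedSpace HH H]
  {IN : ModelWithCorners ℝ EN HN} {N : Type*} [TopologicalSpace N] [ChartedSpace HN N]
  {IG : ModelWithCorners ℝ EG HG} {G : Type*} [TopologicalSpace G] [ChartedSpace HG G]
  {IM : ModelWithCorners ℝ EM HM} {M : Type*} [TopologicalSpace M] [ChartedSpace HM M]
  {𝓗 : LieGroupoid IH H IN N} {𝓖 : LieGroupoid IG G IM M} {k : ℕ} {I J : Set ℝ}
  {Φ₀ : H → G} {φ₀ : N → M} {Φ : H × (Fin k → ℝ) → G} {φ : N × (Fin k → ℝ) → M}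

namespace LieGroupoid

theorem compactSpace_base (𝓖 : LieGroupoid IG G IM M) [CompactSpace G] : CompactSpace M :=
  (show Function.Surjective 𝓖.s from fun x => ⟨𝓖.u x, 𝓖.s_u x⟩).compactSpace
    𝓖.contMDiff_s.continuous

theorem SmoothAutomorphisms.mono {F : H × (Fin k → ℝ) → H} {J' : Set ℝ}
    (h : 𝓗.SmoothAutomorphisms J F) (hJ : J' ⊆ J) : 𝓗.SmoothAutomorphisms J' F :=
  ⟨h.1.mono hJ, fun ε hε => h.2 ε (cube_mono hJ hε)⟩

theorem SmoothBisections.mono {σ : M × (Fin k → ℝ) → G} {J' : Set ℝ}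
    (h : 𝓖.SmoothBisections J σ) (hJ : J' ⊆ J) : 𝓖.SmoothBisections J' σ :=
  ⟨h.1.mono hJ, fun ε hε => h.2 ε (cube_mono hJ hε)⟩

theorem SmoothAlgebroidSections.mono [IsManifold IG ∞ G] {α : (Fin k → ℝ) → M → EG} {J' : Set ℝ}
    (h : 𝓖.SmoothAlgebroidSections J α) (hJ : J' ⊆ J) : 𝓖.SmoothAlgebroidSections J' α :=
  ⟨fun ε hε => h.1 ε (cube_mono hJ hε), h.2.mono (prod_mono subset_rfl (cube_mono hJ))⟩

theorem SmoothAlgebroidSections.smul [IsManifold IG ∞ G] {α : (Fin k → ℝ) → M → EG} (hJ : IsOpen J)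
    (h : 𝓖.SmoothAlgebroidSections J α) {χ : M → ℝ} (hχ : ContMDiff IM 𝓘(ℝ, ℝ) ∞ χ) :
    𝓖.SmoothAlgebroidSections J fun ε x => (χ x • α ε x : EG) := by
  refine ⟨fun ε hε x => ?_, fun p hp => ?_⟩
  · have h1 : tder IG IM 𝓖.s (𝓖.u x) (α ε x) = 0 := h.1 ε hε x
    have h2 : tder IG IM 𝓖.s (𝓖.u x) (χ x • α ε x) = 0 := by rw [map_smul, h1, smul_zero]
    exact h2
  · have h1 : ContMDiffAt (IM.prod 𝓘(ℝ, Fin k → ℝ)) IG.tangent ∞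
        (fun p : M × (Fin k → ℝ) => (⟨𝓖.u p.1, α p.2 p.1⟩ : TangentBundle IG G)) p :=
      h.2.contMDiffAt ((isOpen_univ.prod (isOpen_cube hJ)).mem_nhds hp)
    exact (h1.smul_tangent (χ := fun p => χ p.1)
      (hχ.contMDiffAt.comp p contMDiffAt_fst)).contMDiffWithinAt

variable [FiniteDimensional ℝ EH] [FiniteDimensional ℝ EG] [FiniteDimensional ℝ EM]
  [IH.Boundaryless] [IsManifold IH ∞ H] [IsManifold IG ∞ G] [IM.Boundaryless] [IsManifold IM ∞ M]

/-- Multiplying α by a cutoff equal to 1 on the image of φ leaves the equations unchanged and makes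
α vanish outside a compact set, as needed for the flows on the noncompact side. -/
theorem SmoothPreimage.exists_strong_trivialisation [IN.Boundaryless] [IsManifold IN ∞ N]
    [IG.Boundaryless] [T2Space H] [T2Space N] [T2Space M] [SecondCountableTopology M]
    [CompactSpace H] (hΦ : IsKDeformation 𝓗 𝓖 I Φ₀ φ₀ Φ φ)
    (h : SmoothPreimage 𝓗 𝓖 I Φ φ) :
    ∃ J ⊆ I, IsOpenIntervalAtZero J ∧ ∀ P : (Fin k → ℝ) → (Fin k → ℝ), ContDiff ℝ ∞ P →
      (∀ ε, ‖P ε‖ ≤ ‖ε‖) → (∀ ε, ‖ε - P ε‖ ≤ ‖ε‖) →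
      ∃ (F : H × (Fin k → ℝ) → H) (σ : M × (Fin k → ℝ) → G),
        𝓗.SmoothAutomorphisms J F ∧ 𝓖.SmoothBisections J σ ∧
        (∀ ε ∈ cube k J, P ε = ε → (∀ h, F (h, ε) = h) ∧ ∀ x, σ (x, ε) = 𝓖.u x) ∧
        ∀ ε ∈ cube k J, ∀ h, Φ (F (h, ε), ε) = 𝓖.conj (fun x => σ (x, ε)) (Φ (h, P ε)) := by
  obtain ⟨J, hJI, hJ, Y, α, hY, hmul, hα, heq⟩ := h
  have := 𝓗.compactSpace_base
  obtain ⟨r, hr, hrJ⟩ := exists_Ioo_subset hJ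
  let J' : Set ℝ := Ioo (-(r / 2)) (r / 2)
  have hJ' : IsOpenIntervalAtZero J' := isOpenIntervalAtZero_Ioo (by positivity)
  have hIcc : Icc (-(r / 2)) (r / 2) ⊆ J := (Icc_subset_Ioo (by linarith) (by linarith)).trans hrJ
  have hJJ : J' ⊆ J := Ioo_subset_Icc_self.trans hIcc
  -- N is compact as the image of H under s; halving the interval leaves a closed cube inside the
  -- domain, so the image is compact.
  have hK : IsCompact (φ '' (univ ×ˢ cube k (Icc (-(r / 2)) (r / 2)))) := by
    refine (isCompact_univ.prod (isCompact_univ_pi fun _ => isCompact_Icc)).image_of_continuousOn ?_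
    exact hΦ.smooth_base.continuousOn.mono
      (prod_mono subset_rfl (cube_mono (hIcc.trans hJI)))
  obtain ⟨χ, hχ, hχ1, C, -, hC, hχ0⟩ :=
    exists_contMDiff_cutoff IM hK isOpen_univ (subset_univ _)
  have hχ1' := hχ1.self_of_nhdsSet
  have heq' := (solvesCohomologicalEquations_iff (hΦ.mono hJI)).mpr heq
  have hΦ' := hΦ.mono (hJJ.trans hJI)
  have hsol : SolvesCohomologicalEquations 𝓖 IH J' Φ Y fun i ε x => χ x • α i ε x := by
    intro i ε hε h
    have hm := hΦ'.isMorphism ε hε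
    have hχφ : ∀ x, χ (φ (x, ε)) = 1 := fun x =>
      hχ1' _ ⟨(x, ε), ⟨mem_univ _, cube_mono Ioo_subset_Icc_self hε⟩, rfl⟩
    have e1 : χ (𝓖.t (Φ (h, ε))) = 1 := by rw [hm.map_t]; exact hχφ _
    have e2 : χ (𝓖.s (Φ (h, ε))) = 1 := by rw [hm.map_s]; exact hχφ _
    simp only [e1, e2, one_smul]
    exact heq' i ε (cube_mono hJJ hε) h
  obtain ⟨r', hr', hmain⟩ := LieGroupoid.exists_strong_trivialisation hJ'.1 hJ'.2.2 hΦ'.smooth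
    (fun i => (hY i).mono hJJ) (fun i ε hε => hmul i ε (cube_mono hJJ hε))
    (fun i => ((hα i).mono hJJ).smul hJ'.1 hχ) hC
    (fun i ε _ x hx => by rw [hχ0 x hx]; exact zero_smul ℝ (α i ε x : EG)) hsol
  have hmin : 0 < min r' (r / 2) := by positivity
  refine ⟨Ioo (-min r' (r / 2)) (min r' (r / 2)), ?_, isOpenIntervalAtZero_Ioo hmin,
    hmain _ ⟨hmin, min_le_left _ _⟩⟩
  exact (Ioo_subset_Ioo (neg_le_neg (min_le_right _ _)) (min_le_right _ _)).trans (hJJ.trans hJI)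

theorem SmoothPreimage.stronglyTrivialLeft [IN.Boundaryless] [IsManifold IN ∞ N]
    [IG.Boundaryless] [T2Space H] [T2Space N] [T2Space M] [SecondCountableTopology M]
    [CompactSpace H] (hΦ : IsKDeformation 𝓗 𝓖 I Φ₀ φ₀ Φ φ)
    (h : SmoothPreimage 𝓗 𝓖 I Φ φ) : StronglyTrivialLeft 𝓗 𝓖 I Φ₀ Φ := by
  obtain ⟨J, hJI, hJ, hmain⟩ := h.exists_strong_trivialisation hΦ
  -- Lines from the origin.
  obtain ⟨F, σ, hF, hσ, h0, heq⟩ := hmain (fun _ => 0) contDiff_const (fun ε => by simp)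
    (fun ε => by simp)
  have h1 := h0 0 (fun _ _ => hJ.2.2) rfl
  refine ⟨J, hJI, hJ, F, σ, hF, hσ, h1.1, h1.2, fun ε hε h => ?_⟩
  rw [heq ε hε h, hΦ.map_zero]

theorem SmoothPreimage.canonicalStronglyTrivialLeft [IN.Boundaryless] [IsManifold IN ∞ N]
    [IG.Boundaryless] [T2Space H] [T2Space N] [T2Space M] [SecondCountableTopology M]
    [CompactSpace H] (hΦ : IsKDeformation 𝓗 𝓖 I Φ₀ φ₀ Φ φ)
    (h : SmoothPreimage 𝓗 𝓖 I Φ φ) (i : Fin k) : CanonicalStronglyTrivialLeft 𝓗 𝓖 I Φ i := by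
  obtain ⟨J, hJI, hJ, hmain⟩ := h.exists_strong_trivialisation hΦ
  -- Lines parallel to e_i starting in the hyperplane ε_i = 0, which P fixes pointwise. The norm
  -- bounds hold coordinatewise for the sup norm.
  have hP1 : ContDiff ℝ ∞ fun ε : Fin k → ℝ => Function.update ε i 0 := by
    rw [contDiff_pi]
    intro j
    by_cases hj : j = i
    · subst hj
      simp only [Function.update_self]
      exact contDiff_const
    · simp only [Function.update_of_ne hj]
      exact contDiff_apply ℝ ℝ j
  have hP2 : ∀ ε : Fin k → ℝ, ‖Function.update ε i 0‖ ≤ ‖ε‖ := by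
    refine fun ε => (pi_norm_le_iff_of_nonneg (norm_nonneg ε)).mpr fun j => ?_
    by_cases hj : j = i
    · subst hj
      simp
    · rw [Function.update_of_ne hj]
      exact norm_le_pi_norm ε j
  have hP3 : ∀ ε : Fin k → ℝ, ‖ε - Function.update ε i 0‖ ≤ ‖ε‖ := by
    refine fun ε => (pi_norm_le_iff_of_nonneg (norm_nonneg ε)).mpr fun j => ?_
    by_cases hj : j = i
    · subst hj
      simpa using norm_le_pi_norm ε j
    · simp [Function.update_of_ne hj]
  obtain ⟨F, σ, hF, hσ, h0, heq⟩ := hmain _ hP1 hP2 hP3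
  have hP : ∀ ε : Fin k → ℝ, ε i = 0 → Function.update ε i 0 = ε := fun ε hε => by
    rw [← hε, Function.update_eq_self]
  exact ⟨J, hJI, hJ, F, σ, hF, hσ, fun ε hε hi => (h0 ε hε (hP ε hi)).1,
    fun ε hε hi => (h0 ε hε (hP ε hi)).2, heq⟩

omit [FiniteDimensional ℝ EG] in
theorem StronglyTrivialLeft.smoothPreimage (hΦ : IsKDeformation 𝓗 𝓖 I Φ₀ φ₀ Φ φ)
    (h : StronglyTrivialLeft 𝓗 𝓖 I Φ₀ Φ) : SmoothPreimage 𝓗 𝓖 I Φ φ := by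
  have : CompleteSpace EH := FiniteDimensional.complete ℝ EH
  have : CompleteSpace EM := FiniteDimensional.complete ℝ EM
  obtain ⟨J, hJI, hJ, F, σ, hF, hσ, -, -, heq⟩ := h
  choose Y α h1 h2 h3 h4 using fun i => exists_cohomological_solution hJ.1 i (hΦ.mono hJI) hF hσ
    (Ψ := fun h _ => Φ₀ h) (fun _ _ _ => rfl) heq
  exact ⟨J, hJI, hJ, Y, α, h1, h2, h3, h4⟩

omit [FiniteDimensional ℝ EG] in
theorem smoothPreimage_of_canonicalStronglyTrivialLeft (hI : IsOpenIntervalAtZero I)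
    (hΦ : IsKDeformation 𝓗 𝓖 I Φ₀ φ₀ Φ φ)
    (h : ∀ i, CanonicalStronglyTrivialLeft 𝓗 𝓖 I Φ i) : SmoothPreimage 𝓗 𝓖 I Φ φ := by
  have : CompleteSpace EH := FiniteDimensional.complete ℝ EH
  have : CompleteSpace EM := FiniteDimensional.complete ℝ EM
  choose J hJI hJ F σ hF hσ _ _ heq using h
  -- For k = 0 the intersection over i is all of ℝ, so I has to be included.
  let J' := I ∩ ⋂ i, J i
  have hJ' : IsOpenIntervalAtZero J' := hI.inter (.iInter hJ)
  have hJJ : ∀ i, J' ⊆ J i := fun i => inter_subset_right.trans (iInter_subset _ i)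
  choose Y α h1 h2 h3 h4 using fun i => exists_cohomological_solution hJ'.1 i
    (hΦ.mono inter_subset_left) ((hF i).mono (hJJ i)) ((hσ i).mono (hJJ i))
    (Ψ := fun h ε => Φ (h, Function.update ε i 0)) (fun h ε τ => by
      congr 2
      ext j
      by_cases hj : j = i
      · subst hj
        simp
      · simp [Function.update_of_ne hj, Pi.single_eq_of_ne hj])
    (fun ε hε => heq i ε (cube_mono (hJJ i) hε))
  exact ⟨J', inter_subset_left, hJ', Y, α, h1, h2, h3, h4⟩

end LieGroupoid

end Equivalence

/-! ### Pair groupoids -/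

section PairGroupoid

variable {EM HM EN HN : Type*}
  [NormedAddCommGroup EM] [NormedSpace ℝ EM] [TopologicalSpace HM]
  [NormedAddCommGroup EN] [NormedSpace ℝ EN] [TopologicalSpace HN]
  {IN : ModelWithCorners ℝ EN HN} {N : Type*} [TopologicalSpace N] [ChartedSpace HN N]
  {IM : ModelWithCorners ℝ EM HM} {M : Type*} [TopologicalSpace M] [ChartedSpace HM M]
  {k : ℕ} {I J : Set ℝ}

theorem exists_hasVelocity [IM.Boundaryless] [IsManifold IM ∞ M] (x : M) (v : EM) :
    ∃ γ : ℝ → M, γ 0 = x ∧ HasVelocity IM γ v 0 := by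
  have h0 : (extChartAt IM x).symm (extChartAt IM x x) = x := extChartAt_to_inv x
  refine ⟨fun τ => (extChartAt IM x).symm
    (extChartAt IM x x + τ • tder IM 𝓘(ℝ, EM) (extChartAt IM x) x v), ?_, ?_⟩
  · simp only [zero_smul, add_zero]
    exact h0
  · refine hasVelocity_extChartAt_symm (w := tder IM 𝓘(ℝ, EM) (extChartAt IM x) x v) ?_ ?_ ?_
    · simpa using ((hasDerivAt_id (0 : ℝ)).smul_const
        (tder IM 𝓘(ℝ, EM) (extChartAt IM x) x v)).const_add (extChartAt IM x x)
    · rw [zero_smul, add_zero]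
      exact mem_extChartAt_target x
    · rw [zero_smul, add_zero, h0]

theorem ContMDiffAt.tangent_prodMk [IsManifold IM ∞ M] [IsManifold IN ∞ N] {EX HX X : Type*}
    [NormedAddCommGroup EX] [NormedSpace ℝ EX] [TopologicalSpace HX] {IX : ModelWithCorners ℝ EX HX}
    [TopologicalSpace X] [ChartedSpace HX X] {f : X → M} {V : X → EM} {g : X → N} {W : X → EN}
    {x₀ : X} (hf : ContMDiffAt IX IM.tangent ∞ (fun x => (⟨f x, V x⟩ : TangentBundle IM M)) x₀)
    (hg : ContMDiffAt IX IN.tangent ∞ (fun x => (⟨g x, W x⟩ : TangentBundle IN N)) x₀) :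
    ContMDiffAt IX (IM.prod IN).tangent ∞ (fun x =>
      (⟨(f x, g x), ((V x, W x) : EM × EN)⟩ : TangentBundle (IM.prod IN) (M × N))) x₀ := by
  have : IsManifold IM 1 M := .of_le (n := ∞) (by simp)
  have : IsManifold IN 1 N := .of_le (n := ∞) (by simp)
  exact (contMDiff_equivTangentBundleProd_symm (I := IM) (M := M) (I' := IN) (M' := N)
    (n := ∞)).contMDiffAt.comp x₀ (hf.prodMk hg)

theorem tder_fst (p : M × N) : tder (IM.prod IN) IM Prod.fst p = .fst ℝ EM EN :=
  mfderiv_fst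

theorem tder_snd (p : M × N) : tder (IM.prod IN) IN Prod.snd p = .snd ℝ EM EN :=
  mfderiv_snd

namespace LieGroupoid

section Translations

variable [IM.Boundaryless] [IsManifold IM ∞ M] [CompleteSpace EM]

omit [CompleteSpace EM] in
theorem dMul_pairGroupoid (p q r : M) (u v w : EM) :
    (pairGroupoid IM M).dMul (p, q) (q, r) ((u, v), (v, w)) = (u, w) := by
  obtain ⟨a, ha, hav⟩ := exists_hasVelocity (IM := IM) p u
  obtain ⟨b, hb, hbv⟩ := exists_hasVelocity (IM := IM) q v
  obtain ⟨c, hc, hcv⟩ := exists_hasVelocity (IM := IM) r w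
  have h1 := (pairGroupoid IM M).hasVelocity_mul (g := (p, q)) (h := (q, r)) (by rw [ha, hb])
    (by rw [hb, hc]) (hav.prodMk hbv) (hbv.prodMk hcv) (Filter.Eventually.of_forall fun _ => rfl)
  exact h1.unique (hav.prodMk hcv)

/-- A tangent vector of M × M is determined by its images under ds and dt, which are known for
translates. -/
theorem rTrans_pairGroupoid (g : M × M) {v : EM × EM}
    (hv : tder (IM.prod IM) IM (pairGroupoid IM M).s
      ((pairGroupoid IM M).u ((pairGroupoid IM M).t g)) v = 0) :
    (pairGroupoid IM M).rTrans g v = (v.1, 0) := by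
  have h1 : tder (IM.prod IM) IM (Prod.snd : M × M → M) g ((pairGroupoid IM M).rTrans g v) = 0 :=
    (pairGroupoid IM M).tder_s_rightTranslate hv
  have h2 : tder (IM.prod IM) IM (Prod.fst : M × M → M) g ((pairGroupoid IM M).rTrans g v) =
      tder (IM.prod IM) IM (Prod.fst : M × M → M) ((pairGroupoid IM M).u g.1) v :=
    (pairGroupoid IM M).tder_t_rightTranslate hv
  rw [tder_snd] at h1
  rw [tder_fst, tder_fst] at h2
  exact Prod.ext h2 h1

theorem lTrans_pairGroupoid (g : M × M) {v : EM × EM}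
    (hv : tder (IM.prod IM) IM (pairGroupoid IM M).s
      ((pairGroupoid IM M).u ((pairGroupoid IM M).s g)) v = 0) :
    (pairGroupoid IM M).lTrans g v = (0, v.1) := by
  have h1 : tder (IM.prod IM) IM (Prod.fst : M × M → M) g ((pairGroupoid IM M).lTrans g v) = 0 :=
    (pairGroupoid IM M).tder_t_leftTranslate hv
  have h2 : tder (IM.prod IM) IM (Prod.snd : M × M → M) g ((pairGroupoid IM M).lTrans g v) =
      tder (IM.prod IM) IM (Prod.fst : M × M → M) ((pairGroupoid IM M).u g.2) v :=
    (pairGroupoid IM M).tder_s_leftTranslate hv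
  rw [tder_fst] at h1
  rw [tder_snd, tder_fst] at h2
  exact Prod.ext h1 h2

end Translations

/-- An arrow of a pair groupoid is its pair (target, source), so a morphism is determined by its
base map. -/
theorem IsKDeformation.of_pairGroupoid {Φ₀ : N × N → M × M} {φ₀ : N → M}
    {Φ : (N × N) × (Fin k → ℝ) → M × M} {φ : N × (Fin k → ℝ) → M}
    (h : IsKDeformation (pairGroupoid IN N) (pairGroupoid IM M) I Φ₀ φ₀ Φ φ) :
    IsMapKDeformation IN IM I φ₀ φ ∧ ∀ ε ∈ cube k I, ∀ p, Φ (p, ε) = pairFamily φ (p, ε) :=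
  ⟨⟨h.smooth_base, h.map_zero_base⟩, fun ε hε p =>
    Prod.ext ((h.isMorphism ε hε).map_t p) ((h.isMorphism ε hε).map_s p)⟩

theorem isKDeformation_pairFamily (hI : IsOpen I) {f₀ : N → M} {f : N × (Fin k → ℝ) → M}
    (hf : IsMapKDeformation IN IM I f₀ f) :
    IsKDeformation (pairGroupoid IN N) (pairGroupoid IM M) I (Prod.map f₀ f₀) f₀
      (pairFamily f) f := by
  have hs : SmoothFamily (IN.prod IN) (IM.prod IM) I (pairFamily f) := by
    refine .of_contMDiffAt fun ε hε p => ?_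
    have k1 : ContMDiffAt ((IN.prod IN).prod 𝓘(ℝ, Fin k → ℝ)) (IN.prod IN) ∞
        (fun p : (N × N) × (Fin k → ℝ) => p.1) (p, ε) := contMDiffAt_fst
    have h1 := (hf.1.contMDiffAt hI hε p.1).comp (p, ε)
      (f := fun p : (N × N) × (Fin k → ℝ) => (p.1.1, p.2)) (k1.fst.prodMk contMDiffAt_snd)
    have h2 := (hf.1.contMDiffAt hI hε p.2).comp (p, ε)
      (f := fun p : (N × N) × (Fin k → ℝ) => (p.1.2, p.2)) (k1.snd.prodMk contMDiffAt_snd)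
    exact h1.prodMk h2
  exact ⟨hs, hf.1, fun ε hε => ⟨hs.slice hI hε, hf.1.slice hI hε, fun _ => rfl, fun _ => rfl,
    fun _ => rfl, fun _ _ _ => rfl⟩, fun p => Prod.ext (hf.2 p.1) (hf.2 p.2), hf.2⟩

/-- The derivatives of the family `f_ε × f_ε`. -/
theorem tder_pairFamily (hI : IsOpen I) {f : N × (Fin k → ℝ) → M} (hf : SmoothFamily IN IM I f)
    {ε : Fin k → ℝ} (hε : ε ∈ cube k I) (p : N × N) (y : EN × EN) (v : Fin k → ℝ) :
    tder (IN.prod IN) (IM.prod IM) (fun p => pairFamily f (p, ε)) p y =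
      (tder IN IM (fun x => f (x, ε)) p.1 y.1, tder IN IM (fun x => f (x, ε)) p.2 y.2) ∧
    tder 𝓘(ℝ, Fin k → ℝ) (IM.prod IM) (fun e => pairFamily f (p, e)) ε v =
      (tder 𝓘(ℝ, Fin k → ℝ) IM (fun e => f (p.1, e)) ε v,
        tder 𝓘(ℝ, Fin k → ℝ) IM (fun e => f (p.2, e)) ε v) := by
  have h1 : ∀ x, MDifferentiableAt IN IM (fun x => f (x, ε)) x := fun x =>
    (hf.contMDiffAt hI hε x).slice_left.mdifferentiableAt (by simp)
  have h2 : ∀ x, MDifferentiableAt 𝓘(ℝ, Fin k → ℝ) IM (fun e => f (x, e)) ε := fun x =>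
    (hf.contMDiffAt hI hε x).slice_right.mdifferentiableAt (by simp)
  constructor
  · have e1 := tder_comp (I := IN.prod IN) (I' := IN) (I'' := IM) (x := p)
      (g := fun x => f (x, ε)) (f := Prod.fst) (h1 _) mdifferentiableAt_fst
    have e2 := tder_comp (I := IN.prod IN) (I' := IN) (I'' := IM) (x := p)
      (g := fun x => f (x, ε)) (f := Prod.snd) (h1 _) mdifferentiableAt_snd
    rw [tder_fst] at e1
    rw [tder_snd] at e2
    have e3 := mfderiv_prodMk
      ((h1 p.1).comp p (mdifferentiableAt_fst (I := IN) (I' := IN) (x := p)))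
      ((h1 p.2).comp p (mdifferentiableAt_snd (I := IN) (I' := IN) (x := p)))
    have e4 := congrArg (fun L : EN × EN →L[ℝ] EM × EM => L y) e3
    refine e4.trans (Prod.ext ?_ ?_)
    · exact congrArg (fun L : EN × EN →L[ℝ] EM => L y) e1
    · exact congrArg (fun L : EN × EN →L[ℝ] EM => L y) e2
  · have e3 := mfderiv_prodMk (h2 p.1) (h2 p.2)
    exact congrArg (fun L : (Fin k → ℝ) →L[ℝ] EM × EM => L v) e3

variable [IsManifold IN ∞ N] [IN.Boundaryless] [IM.Boundaryless] [IsManifold IM ∞ M]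
  [CompleteSpace EM]

theorem smoothPreimage_of_thomLevine (hI : IsOpen I) {f₀ : N → M} {f : N × (Fin k → ℝ) → M}
    (hf : IsMapKDeformation IN IM I f₀ f) (h : ThomLevineEquations IN IM I f) :
    SmoothPreimage (pairGroupoid IN N) (pairGroupoid IM M) I (pairFamily f) f := by
  obtain ⟨J, hJI, hJ, ζ, η, hζ, hη, heq⟩ := h
  -- The field ζ × ζ is multiplicative, and (η, 0) lies in the kernel of ds along the diagonal. The
  -- two components of the cohomological equation are then the Thom–Levine equation at the two
  -- points.
  let Y : Fin k → (Fin k → ℝ) → N × N → EN × EN := fun i ε p => (ζ i ε p.1, ζ i ε p.2)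
  let α : Fin k → (Fin k → ℝ) → M → EM × EM := fun i ε y => (η i ε y, 0)
  have hα0 : ∀ i ε y, tder (IM.prod IM) IM (pairGroupoid IM M).s ((pairGroupoid IM M).u y)
      (α i ε y) = 0 := by
    intro i ε y
    have h1 : tder (IM.prod IM) IM (Prod.snd : M × M → M) ((pairGroupoid IM M).u y) (α i ε y) =
      0 := by rw [tder_snd]; rfl
    exact h1
  refine ⟨J, hJI, hJ, Y, α, fun i => ?_, fun i ε hε => ?_, fun i => ⟨fun ε hε y => hα0 i ε y, ?_⟩,
    ?_⟩
  · refine .of_contMDiffAt fun ε hε p => ?_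
    have k1 : ContMDiffAt ((IN.prod IN).prod 𝓘(ℝ, Fin k → ℝ)) (IN.prod IN) ∞
        (fun p : (N × N) × (Fin k → ℝ) => p.1) (p, ε) := contMDiffAt_fst
    have h1 := ((hζ i).contMDiffAt hJ.1 hε p.1).comp (p, ε)
      (f := fun p : (N × N) × (Fin k → ℝ) => (p.1.1, p.2)) (k1.fst.prodMk contMDiffAt_snd)
    have h2 := ((hζ i).contMDiffAt hJ.1 hε p.2).comp (p, ε)
      (f := fun p : (N × N) × (Fin k → ℝ) => (p.1.2, p.2)) (k1.snd.prodMk contMDiffAt_snd)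
    exact ContMDiffAt.tangent_prodMk (f := fun p : (N × N) × (Fin k → ℝ) => p.1.1)
      (g := fun p : (N × N) × (Fin k → ℝ) => p.1.2) h1 h2
  · refine ⟨ζ i ε, fun g => ?_, fun g => ?_, fun x => ?_, fun g h hgh => ?_⟩
    · exact congrArg (fun L : EN × EN →L[ℝ] EN => L (Y i ε g)) (tder_snd (IM := IN) (IN := IN) g)
    · exact congrArg (fun L : EN × EN →L[ℝ] EN => L (Y i ε g)) (tder_fst (IM := IN) (IN := IN) g)
    · have h1 := mfderiv_prodMk (I := IN) (I' := IN) (I'' := IN) (x := x) (f := fun x : N => x)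
        (g := fun x : N => x) mdifferentiableAt_id mdifferentiableAt_id
      have h2 : ((tder IN IN (fun x : N => x) x).prod (tder IN IN (fun x : N => x) x)) (ζ i ε x) =
          Y i ε (x, x) := by
        rw [tder_id]
        rfl
      exact (h2.symm.trans
        (congrArg (fun L : EN →L[ℝ] EN × EN => L (ζ i ε x)) h1).symm)
    · obtain ⟨p, q⟩ := g
      obtain ⟨q', r⟩ := h
      have hq : q = q' := hgh
      subst hq
      exact (dMul_pairGroupoid p q r _ _ _).symm
  · rintro ⟨y, ε⟩ ⟨-, hε⟩
    refine ContMDiffAt.contMDiffWithinAt ?_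
    have h2 : SmoothVectorFields IM J (fun _ _ => 0 : (Fin k → ℝ) → M → EM) := .zero
    exact ((hη i).contMDiffAt hJ.1 hε y).tangent_prodMk (h2.contMDiffAt hJ.1 hε y)
  · refine (solvesCohomologicalEquations_iff
      ((isKDeformation_pairFamily hI hf).mono hJI)).mp fun i ε hε p => ?_
    have hf' := hf.1.mono hJI
    rw [(tder_pairFamily hJ.1 hf' hε p (Y i ε p) 0).1,
      (tder_pairFamily hJ.1 hf' hε p (Y i ε p) (Pi.single i 1)).2,
      rTrans_pairGroupoid _ (hα0 i ε _), lTrans_pairGroupoid _ (hα0 i ε _)]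
    exact Prod.ext
      ((heq i ε hε p.1).trans (congrArg (fun d : EM => _ + d) (add_zero _).symm))
      ((heq i ε hε p.2).trans (congrArg (fun d : EM => _ + d) (zero_add _).symm))

-- The target component of the equation at the unit (x, x) is the Thom–Levine equation at x, with
-- the base field of Y and the anchor image of α.
omit [IN.Boundaryless] in
theorem SmoothPreimage.thomLevine (hI : IsOpen I) {f₀ : N → M} {f : N × (Fin k → ℝ) → M}
    (hf : IsMapKDeformation IN IM I f₀ f)
    (h : SmoothPreimage (pairGroupoid IN N) (pairGroupoid IM M) I (pairFamily f) f) :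
    ThomLevineEquations IN IM I f := by
  obtain ⟨J, hJI, hJ, Y, α, hY, hmul, hα, heq⟩ := h
  have heq' := (solvesCohomologicalEquations_iff
    ((isKDeformation_pairFamily hI hf).mono hJI)).mpr heq
  refine ⟨J, hJI, hJ, fun i ε => (pairGroupoid IN N).baseField (Y i ε),
    (pairGroupoid IM M).anchorField α, fun i => smoothVectorFields_baseField hJ.1 (hY i),
    fun i => smoothVectorFields_anchorField hJ.1 (hα i), fun i ε hε x => ?_⟩
  have hf' := hf.1.mono hJI
  have h1 := heq' i ε hε (x, x)
  have hα0 : ∀ y, tder (IM.prod IM) IM (pairGroupoid IM M).s ((pairGroupoid IM M).u y)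
      (α i ε y) = 0 := (hα i).1 ε hε
  rw [(tder_pairFamily hJ.1 hf' hε (x, x) (Y i ε (x, x)) 0).1,
    (tder_pairFamily hJ.1 hf' hε (x, x) (Y i ε (x, x)) (Pi.single i 1)).2,
    rTrans_pairGroupoid _ (hα0 _), lTrans_pairGroupoid _ (hα0 _)] at h1
  have h2 := congrArg Prod.fst h1
  have h3 : tder (IN.prod IN) IN (Prod.fst : N × N → N) (x, x) (Y i ε (x, x)) =
      (pairGroupoid IN N).baseField (Y i ε) x := (hmul i ε hε).baseField.2.1 (x, x)
  have h4 : (pairGroupoid IM M).anchorField α i ε (f (x, ε)) =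
      tder (IM.prod IM) IM (Prod.fst : M × M → M) _ (α i ε (f (x, ε))) := rfl
  rw [tder_fst] at h3 h4
  refine h2.trans ?_
  refine congrArg₂ (fun a b : EM => a + b)
    (congrArg (tder IN IM (fun x => f (x, ε)) x) h3) ?_
  rw [h4]
  exact add_zero _

end LieGroupoid

end PairGroupoid

/-! ### Trivial deformations of maps and the Thom–Levine equations -/

section MapDeformations

variable {EM HM EN HN : Type*}
  [NormedAddCommGroup EM] [NormedSpace ℝ EM] [TopologicalSpace HM]
  [NormedAddCommGroup EN] [NormedSpace ℝ EN] [TopologicalSpace HN]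
  {IN : ModelWithCorners ℝ EN HN} {N : Type*} [TopologicalSpace N] [ChartedSpace HN N]
  {IM : ModelWithCorners ℝ EM HM} {M : Type*} [TopologicalSpace M] [ChartedSpace HM M]
  {k : ℕ} {I J : Set ℝ} {f₀ : N → M} {f : N × (Fin k → ℝ) → M}

/-- Evaluate at the units (x, x) and take targets: F restricts to the base, and K_ε = t ∘ σ_ε. -/
theorem trivialMapDeformation_of_stronglyTrivialLeft
    (h : LieGroupoid.StronglyTrivialLeft (pairGroupoid IN N) (pairGroupoid IM M) I
      (Prod.map f₀ f₀) (pairFamily f)) : TrivialMapDeformation IN IM I f₀ f := by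
  obtain ⟨J, hJI, hJ, F, σ, hF, hσ, hF0, hσ0, heq⟩ := h
  refine ⟨J, hJI, hJ, fun p => (F ((p.1, p.1), p.2)).1, fun p => (σ p).1,
    ⟨.of_contMDiffAt fun ε hε x => ?_, fun x => congrArg Prod.fst (hF0 (x, x))⟩,
    ⟨.of_contMDiffAt fun ε hε x => ?_, fun x => congrArg Prod.fst (hσ0 x)⟩,
    fun ε hε x => congrArg Prod.fst (heq ε hε (x, x))⟩
  · have h1 : ContMDiffAt (IN.prod 𝓘(ℝ, Fin k → ℝ)) ((IN.prod IN).prod 𝓘(ℝ, Fin k → ℝ)) ∞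
        (fun p : N × (Fin k → ℝ) => ((p.1, p.1), p.2)) (x, ε) :=
      (contMDiffAt_fst.prodMk contMDiffAt_fst).prodMk contMDiffAt_snd
    exact ((hF.1.contMDiffAt hJ.1 hε (x, x)).comp (x, ε)
      (f := fun p : N × (Fin k → ℝ) => ((p.1, p.1), p.2)) h1).fst
  · exact (hσ.1.contMDiffAt hJ.1 hε x).fst

variable [FiniteDimensional ℝ EN] [FiniteDimensional ℝ EM] [IN.Boundaryless] [IM.Boundaryless]
  [IsManifold IN ∞ N] [IsManifold IM ∞ M] [T2Space N] [T2Space M] [SecondCountableTopology M]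
  [CompactSpace N]

/-- For small ε, F_ε is invertible because N is compact, while K_ε has an inverse κ_ε only near the
compact set f₀(N). Then f_{ε+τe_i} is K_{ε+τe_i} ∘ κ_ε ∘ f_ε ∘ F_ε ∘ F_{ε+τe_i}⁻¹ for small τ, and
the two outer factors give η and ζ. -/
theorem TrivialMapDeformation.thomLevine (hI : IsOpenIntervalAtZero I)
    (hf : IsMapKDeformation IN IM I f₀ f) (h : TrivialMapDeformation IN IM I f₀ f) :
    ThomLevineEquations IN IM I f := by
  obtain ⟨J, hJI, hJ, F, K, ⟨hF, hF0⟩, ⟨hK, hK0⟩, heq⟩ := h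
  have h0I : (0 : Fin k → ℝ) ∈ cube k I := fun _ _ => hI.2.2
  have hf₀ : Continuous f₀ := by
    have := (hf.1.slice hI.1 h0I).continuous
    simpa only [hf.2] using this
  obtain ⟨V, hV, hCV, r₁, hr₁, hball₁, κ, hκ⟩ :=
    exists_inverse_near_identity hJ.1 hJ.2.2 hK hK0 (isCompact_range hf₀)
  obtain ⟨U, -, hU, r₂, hr₂, hball₂, x, hx⟩ :=
    exists_inverse_near_identity hJ.1 hJ.2.2 hF hF0 (isCompact_univ (X := N))
  obtain ⟨χ, hχ, hχ1, C, hCV', hC, hχ0⟩ :=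
    exists_contMDiff_cutoff IM (isCompact_range hf₀) hV hCV
  have hU' : ∀ y, y ∈ U := fun y => hU (mem_univ y)
  -- For small ε the image of f_ε lies where κ is an inverse and the cutoff equals 1.
  have hnear : ∀ᶠ ε in 𝓝 (0 : Fin k → ℝ), ∀ y ∈ (univ : Set N), f (y, ε) ∈ V ∧
      ∀ᶠ z in 𝓝 (f (y, ε)), χ z = 1 := by
    refine isCompact_univ.eventually_forall_of_forall_eventually fun y _ => ?_
    have h1 : Filter.Tendsto (fun p : (Fin k → ℝ) × N => f (p.2, p.1)) (𝓝 (0, y)) (𝓝 (f₀ y)) := by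
      have h2 := (hf.1.contMDiffAt hI.1 h0I y).continuousAt.tendsto.comp
        (continuous_swap.tendsto ((0 : Fin k → ℝ), y))
      rwa [hf.2] at h2
    have h3 : ∀ᶠ z in 𝓝 (f₀ y), χ z = 1 :=
      mem_nhdsSet_iff_forall.mp hχ1 _ (mem_range_self y)
    have h4 : ∀ᶠ z in 𝓝 (f₀ y), z ∈ V := hV.mem_nhds (hCV (mem_range_self y))
    exact h1.eventually (h4.and h3.eventually_nhds)
  obtain ⟨r₃, hr₃, hball₃⟩ := Metric.eventually_nhds_iff_ball.mp hnear
  let r := min r₁ (min r₂ r₃)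
  have hr : 0 < r := by positivity
  obtain ⟨r', hr', hr'J⟩ := exists_Ioo_subset hJ
  have hmin : 0 < min r r' := by positivity
  let J' : Set ℝ := Ioo (-min r r') (min r r')
  have hJ' : IsOpenIntervalAtZero J' := isOpenIntervalAtZero_Ioo hmin
  have hJJ : J' ⊆ J :=
    (Ioo_subset_Ioo (neg_le_neg (min_le_right _ _)) (min_le_right _ _)).trans hr'J
  have hcb : ∀ ε ∈ cube k J', ‖ε‖ < r := fun ε hε =>
    ((mem_cube_Ioo hmin).mp hε).trans_le (min_le_left _ _)
  have hb1 : ∀ ε ∈ cube k J', ε ∈ Metric.ball (0 : Fin k → ℝ) r₁ := fun ε hε =>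
    mem_ball_zero_iff.mpr ((hcb ε hε).trans_le (min_le_left _ _))
  have hb2 : ∀ ε ∈ cube k J', ε ∈ Metric.ball (0 : Fin k → ℝ) r₂ := fun ε hε =>
    mem_ball_zero_iff.mpr ((hcb ε hε).trans_le ((min_le_right _ _).trans (min_le_left _ _)))
  have hb3 : ∀ ε ∈ cube k J', ε ∈ Metric.ball (0 : Fin k → ℝ) r₃ := fun ε hε =>
    mem_ball_zero_iff.mpr ((hcb ε hε).trans_le ((min_le_right _ _).trans (min_le_right _ _)))
  have hcJ : ∀ ε ∈ cube k J', ε ∈ cube k J := cube_mono hJJ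
  let A : (N × (Fin k → ℝ)) × (Fin k → ℝ) → N := fun p => F (x (p.1.1, p.2), p.1.2)
  let B : (M × (Fin k → ℝ)) × (Fin k → ℝ) → M := fun p => K (κ p.1, p.2)
  have hA : ∀ ε ∈ cube k J', ∀ e ∈ cube k J', ∀ y,
      ContMDiffAt ((IN.prod 𝓘(ℝ, Fin k → ℝ)).prod 𝓘(ℝ, Fin k → ℝ)) IN ∞ A ((y, ε), e) := by
    intro ε hε e he y
    have k1 : ContMDiffAt ((IN.prod 𝓘(ℝ, Fin k → ℝ)).prod 𝓘(ℝ, Fin k → ℝ))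
        (IN.prod 𝓘(ℝ, Fin k → ℝ)) ∞
        (fun p : (N × (Fin k → ℝ)) × (Fin k → ℝ) => p.1) ((y, ε), e) := contMDiffAt_fst
    have h1 := ((hx e (hb2 e he)).1 y (hU' y)).comp ((y, ε), e)
      (f := fun p : (N × (Fin k → ℝ)) × (Fin k → ℝ) => (p.1.1, p.2)) (k1.fst.prodMk contMDiffAt_snd)
    exact (hF.contMDiffAt hJ.1 (hcJ ε hε) _).comp ((y, ε), e)
      (f := fun p : (N × (Fin k → ℝ)) × (Fin k → ℝ) => (x (p.1.1, p.2), p.1.2)) (h1.prodMk k1.snd)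
  have hB : ∀ ε ∈ cube k J', ∀ e ∈ cube k J', ∀ z ∈ V,
      ContMDiffAt ((IM.prod 𝓘(ℝ, Fin k → ℝ)).prod 𝓘(ℝ, Fin k → ℝ)) IM ∞ B ((z, ε), e) := by
    intro ε hε e he z hz
    have h1 : ContMDiffAt ((IM.prod 𝓘(ℝ, Fin k → ℝ)).prod 𝓘(ℝ, Fin k → ℝ)) IM ∞
        (fun p : (M × (Fin k → ℝ)) × (Fin k → ℝ) => κ p.1) ((z, ε), e) :=
      ((hκ ε (hb1 ε hε)).1 z hz).comp ((z, ε), e) contMDiffAt_fst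
    exact (hK.contMDiffAt hJ.1 (hcJ e he) _).comp ((z, ε), e)
      (f := fun p : (M × (Fin k → ℝ)) × (Fin k → ℝ) => (κ p.1, p.2)) (h1.prodMk contMDiffAt_snd)
  have hA0 : ∀ ε ∈ cube k J', ∀ y, A ((y, ε), ε) = y := fun ε hε y =>
    (hx ε (hb2 ε hε)).2.1 y (hU' y)
  have hB0 : ∀ ε ∈ cube k J', ∀ z ∈ V, B ((z, ε), ε) = z := fun ε hε z hz =>
    (hκ ε (hb1 ε hε)).2.1 z hz
  let ζ : Fin k → (Fin k → ℝ) → N → EN := fun i ε y =>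
    tder 𝓘(ℝ, Fin k → ℝ) IN (fun e => A ((y, ε), e)) ε (Pi.single i 1)
  -- B is controlled only over V; the cutoff, supported in a compact subset of V, extends the field
  -- by zero to M.
  let η : Fin k → (Fin k → ℝ) → M → EM := fun i ε z =>
    χ z • tder 𝓘(ℝ, Fin k → ℝ) IM (fun e => B ((z, ε), e)) ε (Pi.single i 1)
  refine ⟨J', hJJ.trans hJI, hJ', ζ, η, fun i => ?_, fun i => ?_, fun i ε hε y => ?_⟩
  · refine .of_contMDiffAt fun ε hε y => ?_
    refine (contMDiffAt_paramVelocity (A := A) (p := fun q : N × (Fin k → ℝ) => q.2)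
      (x₀ := (y, ε)) (hA ε hε ε hε y) contMDiffAt_snd (Pi.single i 1)).congr_of_eventuallyEq ?_
    have e1 : ∀ᶠ p : N × (Fin k → ℝ) in 𝓝 (y, ε), p.2 ∈ cube k J' :=
      continuousAt_snd.preimage_mem_nhds ((isOpen_cube hJ'.1).mem_nhds hε)
    filter_upwards [e1] with p hp
    exact TangentBundle.mk_congr (hA0 _ hp p.1).symm rfl
  · refine .of_contMDiffAt fun ε hε z => ?_
    have e1 : ∀ᶠ p : M × (Fin k → ℝ) in 𝓝 (z, ε), p.2 ∈ cube k J' :=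
      continuousAt_snd.preimage_mem_nhds ((isOpen_cube hJ'.1).mem_nhds hε)
    by_cases hz : z ∈ V
    · have h1 := (contMDiffAt_paramVelocity (A := B) (p := fun q : M × (Fin k → ℝ) => q.2)
        (x₀ := (z, ε)) (hB ε hε ε hε z hz) contMDiffAt_snd (Pi.single i 1)).smul_tangent
        (χ := fun q : M × (Fin k → ℝ) => χ q.1) (hχ.contMDiffAt.comp (z, ε) contMDiffAt_fst)
      refine h1.congr_of_eventuallyEq ?_
      have e2 : ∀ᶠ p : M × (Fin k → ℝ) in 𝓝 (z, ε), p.1 ∈ V :=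
        continuousAt_fst.preimage_mem_nhds (hV.mem_nhds hz)
      filter_upwards [e1, e2] with p hp hp'
      exact TangentBundle.mk_congr (hB0 _ hp p.1 hp').symm rfl
    · have h1 : SmoothVectorFields IM J' (fun _ _ => 0 : (Fin k → ℝ) → M → EM) := .zero
      refine (h1.contMDiffAt hJ'.1 hε z).congr_of_eventuallyEq ?_
      have e2 : ∀ᶠ p : M × (Fin k → ℝ) in 𝓝 (z, ε), p.1 ∈ Cᶜ :=
        continuousAt_fst.preimage_mem_nhds
          (hC.isClosed.isOpen_compl.mem_nhds fun h => hz (hCV' h))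
      filter_upwards [e2] with p hp
      refine TangentBundle.mk_congr rfl ?_
      simp only [η, hχ0 _ hp, zero_smul]
  · let v : Fin k → ℝ := Pi.single i 1
    have hline : ∀ᶠ τ : ℝ in 𝓝 0, ε + τ • v ∈ cube k J' :=
      (tendsto_line ε v).eventually ((isOpen_cube hJ'.1).mem_nhds hε)
    have hf' := hf.1.contMDiffAt hI.1 (cube_mono (hJJ.trans hJI) hε)
    have hfV : f (y, ε) ∈ V := (hball₃ ε (hb3 ε hε) y (mem_univ y)).1
    have hfχ : χ (f (y, ε)) = 1 := (hball₃ ε (hb3 ε hε) y (mem_univ y)).2.self_of_nhds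
    let w : ℝ → M := fun τ => f (A ((y, ε), ε + τ • v), ε)
    have hA0' : A ((y, ε), ε + (0 : ℝ) • v) = y := by rw [zero_smul, add_zero, hA0 ε hε]
    have hw0 : w 0 = f (y, ε) := by
      show f (A ((y, ε), ε + (0 : ℝ) • v), ε) = _
      rw [hA0']
    have hws : ContMDiffAt 𝓘(ℝ, ℝ) IM ∞ w 0 := by
      have h2 : ContMDiffAt 𝓘(ℝ, Fin k → ℝ) IN ∞ (fun e => A ((y, ε), e)) (ε + (0 : ℝ) • v) := by
        rw [zero_smul, add_zero]
        exact (hA ε hε ε hε y).slice_right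
      have h1 : ContMDiffAt 𝓘(ℝ, ℝ) IN ∞ (fun τ : ℝ => A ((y, ε), ε + τ • v)) 0 :=
        ContMDiffAt.comp (g := fun e => A ((y, ε), e)) (f := fun τ : ℝ => ε + τ • v) (0 : ℝ) h2
          (contMDiff_line ε v).contMDiffAt
      exact ContMDiffAt.comp (g := fun y => f (y, ε)) (0 : ℝ) (hf' _).slice_left h1
    -- As for groupoids, the motions on the target and on the source are separated into two
    -- variables; the diagonal is τ ↦ f_{ε+τv}(y).
    let W : ℝ × ℝ → M := fun p => B ((w p.2, ε), ε + p.1 • v)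
    have hWs : ContMDiffAt 𝓘(ℝ, ℝ × ℝ) IM ∞ W (0, 0) := by
      have h1 : ContMDiffAt 𝓘(ℝ, ℝ × ℝ) IM ∞ (fun p : ℝ × ℝ => w p.2) (0, 0) :=
        ContMDiffAt.comp (g := w) (f := fun p : ℝ × ℝ => p.2) ((0, 0) : ℝ × ℝ) hws
          contDiff_snd.contMDiff.contMDiffAt
      have h2 : ContMDiffAt 𝓘(ℝ, ℝ × ℝ) 𝓘(ℝ, Fin k → ℝ) ∞ (fun p : ℝ × ℝ => ε + p.1 • v) (0, 0) :=
        (contDiff_const.add (contDiff_fst.smul contDiff_const)).contMDiff.contMDiffAt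
      have h4 : ContMDiffAt ((IM.prod 𝓘(ℝ, Fin k → ℝ)).prod 𝓘(ℝ, Fin k → ℝ)) IM ∞ B
          ((w 0, ε), ε + (0 : ℝ) • v) := by
        rw [zero_smul, add_zero, hw0]
        exact hB ε hε ε hε _ hfV
      exact ContMDiffAt.comp (g := B) (f := fun p : ℝ × ℝ => ((w p.2, ε), ε + p.1 • v))
        ((0, 0) : ℝ × ℝ) h4 ((h1.prodMk contMDiffAt_const).prodMk h2)
    have hW1 : HasVelocity IM (fun a => W (a, 0)) (η i ε (f (y, ε))) 0 := by
      have h1 : HasVelocity IM (fun τ : ℝ => B ((f (y, ε), ε), ε + τ • v))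
          (tder 𝓘(ℝ, Fin k → ℝ) IM (fun e => B ((f (y, ε), ε), e)) ε v) 0 :=
        hasVelocity_line ((hB ε hε ε hε _ hfV).slice_right.mdifferentiableAt (by simp)) v
      have h2 : η i ε (f (y, ε)) =
          tder 𝓘(ℝ, Fin k → ℝ) IM (fun e => B ((f (y, ε), ε), e)) ε v := by
        simp only [η, hfχ, one_smul, v]
      rw [h2]
      show HasVelocity IM (fun a : ℝ => B ((w 0, ε), ε + a • v)) _ 0
      rw [hw0]
      exact h1
    have hW2 : HasVelocity IM (fun b => W (0, b)) (tder IN IM (fun y => f (y, ε)) y (ζ i ε y)) 0 := by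
      have h1 : HasVelocity IN (fun τ : ℝ => A ((y, ε), ε + τ • v)) (ζ i ε y) 0 :=
        hasVelocity_line ((hA ε hε ε hε y).slice_right.mdifferentiableAt (by simp)) v
      have h2 := h1.map (f := fun y => f (y, ε)) ((hf' _).slice_left.mdifferentiableAt (by simp))
      rw [hA0'] at h2
      refine h2.congr_of_eventuallyEq ?_
      have h3 : ∀ᶠ b in 𝓝 0, w b ∈ V :=
        hws.continuousAt.preimage_mem_nhds (hV.mem_nhds (by rw [hw0]; exact hfV))
      filter_upwards [h3] with b hb
      show B ((w b, ε), ε + (0 : ℝ) • v) = w b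
      rw [zero_smul, add_zero]
      exact hB0 ε hε _ hb
    have hW := HasVelocity.diag (hWs.mdifferentiableAt (by simp)) hW1 hW2
    have hP : HasVelocity IM (fun τ : ℝ => f (y, ε + τ • v))
        (tder 𝓘(ℝ, Fin k → ℝ) IM (fun e => f (y, e)) ε v) 0 :=
      hasVelocity_line ((hf' y).slice_right.mdifferentiableAt (by simp)) v
    have hfin := hP.unique (hW.congr_of_eventuallyEq (by
      filter_upwards [hline] with τ hτ
      have k1 : F (x (y, ε + τ • v), ε + τ • v) = y := (hx _ (hb2 _ hτ)).2.1 y (hU' y)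
      have k2 : f (y, ε + τ • v) = K (f₀ (x (y, ε + τ • v)), ε + τ • v) := by
        rw [← heq _ (hcJ _ hτ), k1]
      have k3 : w τ = K (f₀ (x (y, ε + τ • v)), ε) := heq _ (hcJ _ hε) _
      have k4 : κ (w τ, ε) = f₀ (x (y, ε + τ • v)) := by
        rw [k3]
        exact (hκ ε (hb1 ε hε)).2.2 _ (mem_range_self _)
      show _ = K (κ (w τ, ε), ε + τ • v)
      rw [k4, k2]))
    exact hfin.trans (add_comm _ _)

/-- The integration is not repeated for maps: the groupoid theorem is applied to pair groupoids,
where compactness of N makes N × N compact. -/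
theorem ThomLevineEquations.stronglyTrivialLeft (hI : IsOpenIntervalAtZero I)
    (hf : IsMapKDeformation IN IM I f₀ f) (h : ThomLevineEquations IN IM I f) :
    LieGroupoid.StronglyTrivialLeft (pairGroupoid IN N) (pairGroupoid IM M) I
      (Prod.map f₀ f₀) (pairFamily f) := by
  have : CompleteSpace EM := FiniteDimensional.complete ℝ EM
  exact (LieGroupoid.smoothPreimage_of_thomLevine hI.1 hf h).stronglyTrivialLeft
    (LieGroupoid.isKDeformation_pairFamily hI.1 hf)

end MapDeformations

end

theorem mainTheorem10
    {EH HH EN HN EG HG EM HM : Type*}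
    [NormedAddCommGroup EH] [NormedSpace ℝ EH] [FiniteDimensional ℝ EH] [TopologicalSpace HH]
    [NormedAddCommGroup EN] [NormedSpace ℝ EN] [FiniteDimensional ℝ EN] [TopologicalSpace HN]
    [NormedAddCommGroup EG] [NormedSpace ℝ EG] [FiniteDimensional ℝ EG] [TopologicalSpace HG]
    [NormedAddCommGroup EM] [NormedSpace ℝ EM] [FiniteDimensional ℝ EM] [TopologicalSpace HM]
    (IH : ModelWithCorners ℝ EH HH) [IH.Boundaryless]
    (IN : ModelWithCorners ℝ EN HN) [IN.Boundaryless]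
    (IG : ModelWithCorners ℝ EG HG) [IG.Boundaryless]
    (IM : ModelWithCorners ℝ EM HM) [IM.Boundaryless]
    (H : Type*) [TopologicalSpace H] [T2Space H] [ChartedSpace HH H] [IsManifold IH ∞ H]
    (N : Type*) [TopologicalSpace N] [T2Space N] [ChartedSpace HN N] [IsManifold IN ∞ N]
    (G : Type*) [TopologicalSpace G] [ChartedSpace HG G] [IsManifold IG ∞ G]
    (M : Type*) [TopologicalSpace M] [T2Space M] [SecondCountableTopology M]
    [ChartedSpace HM M] [IsManifold IM ∞ M]
    (k : ℕ) (I : Set ℝ) (hI : IsOpenIntervalAtZero I) :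
    -- the theorem for Lie groupoids `H ⇉ N` and `G ⇉ M`
    (CompactSpace H →
      ∀ (𝓗 : LieGroupoid IH H IN N) (𝓖 : LieGroupoid IG G IM M)
        (Φ₀ : H → G) (φ₀ : N → M) (Φ : H × (Fin k → ℝ) → G) (φ : N × (Fin k → ℝ) → M),
        LieGroupoid.IsKDeformation 𝓗 𝓖 I Φ₀ φ₀ Φ φ →
          (LieGroupoid.StronglyTrivialLeft 𝓗 𝓖 I Φ₀ Φ ↔
            ∀ i, LieGroupoid.CanonicalStronglyTrivialLeft 𝓗 𝓖 I Φ i) ∧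
          (LieGroupoid.StronglyTrivialLeft 𝓗 𝓖 I Φ₀ Φ ↔
            LieGroupoid.SmoothPreimage 𝓗 𝓖 I Φ φ)) ∧
    -- its specialization to pair groupoids, and the Thom–Levine theorem
    (CompactSpace N →
      (∀ (Φ₀ : N × N → M × M) (φ₀ : N → M) (Φ : (N × N) × (Fin k → ℝ) → M × M)
          (φ : N × (Fin k → ℝ) → M),
        LieGroupoid.IsKDeformation (pairGroupoid IN N) (pairGroupoid IM M) I Φ₀ φ₀ Φ φ →
          IsMapKDeformation IN IM I φ₀ φ ∧
            ∀ ε ∈ cube k I, ∀ p, Φ (p, ε) = pairFamily φ (p, ε)) ∧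
      ∀ (f₀ : N → M) (f : N × (Fin k → ℝ) → M), IsMapKDeformation IN IM I f₀ f →
        LieGroupoid.IsKDeformation (pairGroupoid IN N) (pairGroupoid IM M) I
          (Prod.map f₀ f₀) f₀ (pairFamily f) f ∧
        (TrivialMapDeformation IN IM I f₀ f ↔
          LieGroupoid.StronglyTrivialLeft (pairGroupoid IN N) (pairGroupoid IM M) I
            (Prod.map f₀ f₀) (pairFamily f)) ∧
        (ThomLevineEquations IN IM I f ↔
          LieGroupoid.SmoothPreimage (pairGroupoid IN N) (pairGroupoid IM M) I
            (pairFamily f) f) ∧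
        (TrivialMapDeformation IN IM I f₀ f ↔ ThomLevineEquations IN IM I f)) := by
  -- Conditions 1 and 2 are each compared with 3. For maps, triviality yields strong triviality of
  -- the pair family only through the Thom–Levine equations, since the given F_ε and K_ε need not be
  -- diffeomorphisms.
  refine ⟨fun hH 𝓗 𝓖 Φ₀ φ₀ Φ φ hΦ => ?_, fun hN => ⟨fun Φ₀ φ₀ Φ φ hΦ => hΦ.of_pairGroupoid,
    fun f₀ f hf => ?_⟩⟩
  · have h1 : 𝓗.StronglyTrivialLeft 𝓖 I Φ₀ Φ ↔ 𝓗.SmoothPreimage 𝓖 I Φ φ :=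
      ⟨fun h => h.smoothPreimage hΦ, fun h => h.stronglyTrivialLeft hΦ⟩
    have h2 : (∀ i, 𝓗.CanonicalStronglyTrivialLeft 𝓖 I Φ i) ↔ 𝓗.SmoothPreimage 𝓖 I Φ φ :=
      ⟨fun h => LieGroupoid.smoothPreimage_of_canonicalStronglyTrivialLeft hI hΦ h,
        fun h i => h.canonicalStronglyTrivialLeft hΦ i⟩
    exact ⟨h1.trans h2.symm, h1⟩
  · have : CompleteSpace EM := FiniteDimensional.complete ℝ EM
    have h1 := LieGroupoid.isKDeformation_pairFamily hI.1 hf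
    have h2 : ThomLevineEquations IN IM I f → TrivialMapDeformation IN IM I f₀ f := fun h =>
      trivialMapDeformation_of_stronglyTrivialLeft (h.stronglyTrivialLeft hI hf)
    exact ⟨h1, ⟨fun h => (h.thomLevine hI hf).stronglyTrivialLeft hI hf,
      trivialMapDeformation_of_stronglyTrivialLeft⟩,
      ⟨fun h => LieGroupoid.smoothPreimage_of_thomLevine hI.1 hf h, fun h => h.thomLevine hI.1 hf⟩,
      fun h => h.thomLevine hI hf, h2⟩
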